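/- **Setting.** Let $\mathcal G$ be a locally compact Hausdorff groupoid with base space $X$, source map $s$ and range map $r$. A slice is an open set $O\subseteq\mathcal G$ such that $s|_O$ and $r|_O$ are homeomorphisms onto their images; assume that $\mathcal G$ is $r$-discrete, i.e. its slices form a basis of its topology. Let $S$ be a Cantor inverse semigroup embedded in $\mathcal G$: a set of slices which is closed under $st=\{gh : g\in s,\,h\in t\}$ and $s^*=\{g^{-1}: g\in s\}$, whose set $E$ of projections ($e^2=e$) is upward directed and consists of clopen subsets of $X$, and which is full: it generates the topology of $\mathcal G$. Here fullness means: if $g\in s\cap t$ with $s,t\in S$, then $g\in u\subseteq s\cap t$ for some $u\in S$; and the sets $\{g\in s : r(g)\notin f_1\cup\dots\cup f_n\}$ ($s\in S$, $f_i\in E$, $n\ge 0$) form a basis of the topology. (Both hold if $S$ is a basis of the topology.) For a $C_0(X)$-algebra $A$ let $A_x=A/\overline{C_0(X\setminus\{x\})A}$, and for a Hilbert module $\mathcal E$ over a $C_0(X)$-algebra $B$ let $\mathcal E_x=\mathcal E/\overline{\mathcal E\,C_0(X\setminus\{x\})B}$; write $a_x,\xi_x$ for the classes. A $\mathcal G$-action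 on $\mathcal E$ (or $A$) is a family of linear maps $V_g:\mathcal E_{s(g)}\to\mathcal E_{r(g)}$ with $V_{gh}=V_gV_h$ and $V_x=\mathrm{id}$ for units $x$, which is a continuous field of maps $s^*\mathcal E\to r^*\mathcal E$ (it maps sections locally approximable by $\xi\circ s$ to sections locally approximable by $\xi\circ r$, $\xi\in\mathcal E$). * A $\mathcal G$-$C^*$-algebra is a $C_0(X)$-algebra $A$ with a $\mathcal G$-action $\alpha$ by $*$-homomorphisms. A $\mathcal G$-Hilbert bimodule $(\pi,\mathcal E,V)$ consists of $\mathcal G$-$C^*$-algebras $(A,\alpha^A)$, $(B,\alpha^B)$, a Hilbert $B$-module $\mathcal E$, a $*$-homomorphism $\pi:A\to\mathcal L(\mathcal E)$ with $\pi(fa)(\xi b)=\pi(a)(\xi (fb))$ for $f\in C_0(X)$, and a $\mathcal G$-action $V$ on $\mathcal E$ with $V_g(\xi b)=V_g(\xi)\alpha^B_g(b)$, $\langle V_g\xi,V_g\eta\rangle=\alpha^B_g\langle\xi,\eta\rangle$ and $V_g(\pi(a)\xi)=\pi(\alpha^A_g(a))V_g(\xi)$ on fibres. * A compatible $S$-Hilbert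 $C^*$-algebra is a $C_0(X)$-algebra $A$ with a semigroup homomorphism $\beta$ from $S$ to the $*$-endomorphisms of $A$ such that $\beta_e(a)b=a\beta_e(b)$ and $\beta_e(a)=1_e\cdot a$ (the bounded continuous function $1_e$ acting as a multiplier) for $e\in E$. A compatible $S$-Hilbert bimodule $(\pi,\mathcal E,U)$ consists of two such algebras $(A,\beta^A)$, $(B,\beta^B)$, a Hilbert $B$-module $\mathcal E$, a $*$-homomorphism $\pi:A\to\mathcal L(\mathcal E)$, and a semigroup homomorphism $U$ from $S$ to the linear maps on $\mathcal E$ such that $U_s(\xi b)=U_s(\xi)\beta^B_s(b)$, $\langle U_s\xi,\eta\rangle=\beta^B_s\langle\xi,U_{s^*}\eta\rangle$, $U_s\pi(a)U_{s^*}=\pi(\beta^A_s(a))U_sU_{s^*}$, and, for $e\in E$, $U_e(\xi)b=\xi\beta^B_e(b)$ and $\pi(\beta^A_e(a))\xi=\pi(a)U_e(\xi)$. * A morphism consists of $*$-homomorphisms of the two coefficient algebras and a bounded linear map of the modules compatible with left and right multiplication, all equivariant (and, for $\mathcal G$-Hilbert bimodules, the $*$-homomorphisms are $C_0(X)$-linear).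 **Proposition.** There is an equivalence $\rho_H$ from the category of $\mathcal G$-Hilbert bimodules to the category of compatible $S$-Hilbert bimodules, with $\rho_H\rho_H^{-1}=1$ and $\rho_H^{-1}\rho_H=1$ the identity functors, which changes neither the underlying Hilbert bimodules nor the underlying maps of morphisms: $\rho_H(\pi,\mathcal E,V)=(\pi,\mathcal E,U)$. The actions $V$ and $U$ determine each other by either of the formulas $$\big(U_s(\xi)\big)_x=1_{\{x\in ss^*\}}\,V_{xs}\big(\xi_{s^*xs}\big)\quad(x\in X),\qquad V_g(\xi_{s(g)})=\big(U_s(\xi)\big)_{r(g)}\quad(g\in s),$$ for all $s\in S$, $\xi\in\mathcal E$, where $xs$ is the unique element of $s$ with range $x$; the actions on the coefficient algebras are related by the same formulas. Moreover $\rho_H$ respects tensor products: * Let $\mathcal E$ be a $\mathcal G$-Hilbert $(A,B)$-bimodule and $\mathcal F$ a $\mathcal G$-Hilbert $(B,C)$-bimodule. On the internal tensor product $\mathcal E\otimes_B\mathcal F$ there are a unique diagonal $\mathcal G$-action ($V_g(\xi\otimes\eta)=V_g\xi\otimes V_g\eta$ on fibres) and a unique diagonal $S$-action ($U_s(\xi\otimes\eta)=U_s\xi\otimes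 U_s\eta$) which make it a $\mathcal G$-Hilbert, resp. compatible $S$-Hilbert, $(A,C)$-bimodule for the given actions on $A$ and $C$, and a $\mathcal G$-action on it is diagonal if and only if the $S$-action assigned to it by $\rho_H$ is so; i.e. $\rho_H(\mathcal E\otimes_B\mathcal F)=\rho_H(\mathcal E)\otimes_B\rho_H(\mathcal F)$. * Let $\mathcal E$ and $\mathcal F$ be $\mathcal G$-Hilbert $(A_1,B_1)$- and $(A_2,B_2)$-bimodules. On the external $C_0(X)$-balanced tensor product $\mathcal E\otimes\mathcal F$, an $(A_1\otimes_{C_0(X)}A_2,\;B_1\otimes_{C_0(X)}B_2)$-bimodule, with the maximal $C_0(X)$-balanced tensor products of the coefficient algebras, there are a unique diagonal $\mathcal G$-action and a unique diagonal $S$-action (on the coefficient algebras and on the module). For this, and also for any other $C^*$-completions of the $C_0(X)$-balanced algebraic tensor products of the coefficient algebras for which the bimodule $\mathcal E\otimes\mathcal F$ is defined, a $\mathcal G$-action is diagonal if and only if the $S$-action assigned to it by $\rho_H$ is so; i.e. $\rho_H(\mathcal E\otimes\mathcal F)=\rho_H(\mathcal E)\otimes\rho_H(\mathcal F)$. -/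

import Mathlib

open CategoryTheory Topology Filter
open scoped ZeroAtInfty

universe u w v

/-! ### Topological groupoids, slices and Cantor inverse semigroups -/

/-- A topological groupoid with arrow space `G` and base space `X`. The base space is identified
with the space of unit arrows through `unit`; since `src` is a continuous left inverse of `unit`,
this is a homeomorphism onto the units. `mul g h` is defined if `src g = rng h`. -/
structure TopGroupoid (G : Type w) (X : Type u) [TopologicalSpace G] [TopologicalSpace X] where
  src : G → X
  rng : G → X
  unit : X → G
  inv : G → G
  mul : (g h : G) → src g = rng h → G
  src_unit : ∀ x, src (unit x) = x
  rng_unit : ∀ x, rng (unit x) = x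
  src_inv : ∀ g, src (inv g) = rng g
  rng_inv : ∀ g, rng (inv g) = src g
  src_mul : ∀ g h hgh, src (mul g h hgh) = src h
  rng_mul : ∀ g h hgh, rng (mul g h hgh) = rng g
  mul_assoc : ∀ (g h k : G) (hgh : src g = rng h) (hhk : src h = rng k),
    mul (mul g h hgh) k ((src_mul g h hgh).trans hhk)
      = mul g (mul h k hhk) (hgh.trans (rng_mul h k hhk).symm)
  mul_unit : ∀ g, mul g (unit (src g)) (rng_unit (src g)).symm = g
  unit_mul : ∀ g, mul (unit (rng g)) g (src_unit (rng g)) = g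
  mul_inv : ∀ g, mul g (inv g) (rng_inv g).symm = unit (rng g)
  inv_mul : ∀ g, mul (inv g) g (src_inv g) = unit (src g)
  continuous_src : Continuous src
  continuous_rng : Continuous rng
  continuous_unit : Continuous unit
  continuous_inv : Continuous inv
  continuous_mul : Continuous (fun p : {p : G × G // src p.1 = rng p.2} => mul p.1.1 p.1.2 p.2)

namespace TopGroupoid

variable {G : Type w} {X : Type u} [TopologicalSpace G] [TopologicalSpace X]
  (𝒢 : TopGroupoid G X)

/-- A slice: an open set of arrows on which source and range are homeomorphisms onto their
images. -/
def IsSlice (O : Set G) : Prop :=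
  IsOpen O ∧ IsEmbedding (O.domRestrict 𝒢.src) ∧ IsEmbedding (O.domRestrict 𝒢.rng)

/-- The groupoid is `r`-discrete: the slices form a basis of the topology. -/
def IsRDiscrete : Prop := TopologicalSpace.IsTopologicalBasis {O : Set G | 𝒢.IsSlice O}

/-- The product `O · P = {g h | g ∈ O, h ∈ P}`. -/
def setMul (O P : Set G) : Set G :=
  {k | ∃ g ∈ O, ∃ h ∈ P, ∃ hgh : 𝒢.src g = 𝒢.rng h, 𝒢.mul g h hgh = k}

/-- The inverse `O^* = {g⁻¹ | g ∈ O}`. -/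
def setInv (O : Set G) : Set G := 𝒢.inv '' O

/-- The points of the base space whose unit arrow lies in `O`. -/
def base (O : Set G) : Set X := 𝒢.unit ⁻¹' O

end TopGroupoid

/-- A Cantor inverse semigroup embedded in the groupoid `𝒢`: an upward-directed inverse semigroup
of slices, which is a full system of slices, and whose projections are clopen subsets of the
base space. -/
structure CantorInvSemigroup {G : Type w} {X : Type u} [TopologicalSpace G] [TopologicalSpace X]
    (𝒢 : TopGroupoid G X) where
  carrier : Set (Set G)
  isSlice : ∀ s ∈ carrier, 𝒢.IsSlice s
  mul_mem : ∀ s ∈ carrier, ∀ t ∈ carrier, 𝒢.setMul s t ∈ carrier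
  inv_mem : ∀ s ∈ carrier, 𝒢.setInv s ∈ carrier
  /-- every projection is a clopen subset of the base space -/
  clopen : ∀ e ∈ carrier, 𝒢.setMul e e = e → IsClopen (𝒢.base e)
  /-- any two projections have a common upper bound among the projections -/
  directed : ∀ e₁ ∈ carrier, 𝒢.setMul e₁ e₁ = e₁ → ∀ e₂ ∈ carrier, 𝒢.setMul e₂ e₂ = e₂ →
    ∃ e₃ ∈ carrier, 𝒢.setMul e₃ e₃ = e₃ ∧ e₁ ⊆ e₃ ∧ e₂ ⊆ e₃
  /-- fullness, first half: a common arrow of two elements lies in an element below both -/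
  full_inter : ∀ s ∈ carrier, ∀ t ∈ carrier, ∀ g ∈ s ∩ t, ∃ r ∈ carrier, g ∈ r ∧ r ⊆ s ∩ t
  /-- fullness, second half: the topology of `G` is generated by the elements of the semigroup and
  the complements of its (clopen) projections: the sets `s \ (f₁ ∪ ⋯ ∪ fₙ) s` form a basis.
  If the semigroup is itself a basis of the topology, then both halves hold, with `n = 0`. -/
  full_basis : ∀ (g : G) (O : Set G), IsOpen O → g ∈ O →
    ∃ s ∈ carrier, ∃ F : Finset (Set G), (∀ f ∈ F, f ∈ carrier ∧ 𝒢.setMul f f = f) ∧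
      g ∈ s ∧ (∀ f ∈ F, 𝒢.rng g ∉ 𝒢.base f) ∧
      ∀ h ∈ s, (∀ f ∈ F, 𝒢.rng h ∉ 𝒢.base f) → h ∈ O

namespace CantorInvSemigroup

variable {G : Type w} {X : Type u} [TopologicalSpace G] [TopologicalSpace X]
  {𝒢 : TopGroupoid G X} (S : CantorInvSemigroup 𝒢)

/-- The elements of the inverse semigroup. -/
def Elt : Type w := {s : Set G // s ∈ S.carrier}

instance : Mul S.Elt := ⟨fun s t => ⟨𝒢.setMul s.1 t.1, S.mul_mem s.1 s.2 t.1 t.2⟩⟩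

instance : Star S.Elt := ⟨fun s => ⟨𝒢.setInv s.1, S.inv_mem s.1 s.2⟩⟩

/-- The set `E` of projections of the inverse semigroup. -/
def Proj : Type w := {e : S.Elt // e * e = e}

/-- A projection as a subset of the base space. -/
def Proj.set {S : CantorInvSemigroup 𝒢} (e : S.Proj) : Set X := 𝒢.base e.1.1

theorem Proj.isClopen {S : CantorInvSemigroup 𝒢} (e : S.Proj) : IsClopen e.set :=
  S.clopen e.1.1 e.1.2 (congrArg Subtype.val e.2)

end CantorInvSemigroup

/-! ### `C₀(X)`-algebras, Hilbert modules and their fibres -/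

/-- The product `1_Y f` of the characteristic function of a clopen set `Y` and `f ∈ C₀(X)`. -/
noncomputable def clopenMul {X : Type u} [TopologicalSpace X] (Y : Set X) (hY : IsClopen Y)
    (f : C₀(X, ℂ)) : C₀(X, ℂ) where
  toFun := Y.indicator f
  continuous_toFun := f.continuous.indicator (by simp [hY.frontier_eq])
  zero_at_infty' := by
    refine squeeze_zero_norm (a := fun x => ‖f x‖) (fun x => norm_indicator_le_norm_self _ _) ?_
    simpa using (zero_at_infty f).norm

/-- A `C₀(X)`-algebra: a C⋆-algebra with a nondegenerate ⋆-homomorphism from `C₀(X)` into the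
centre of its multiplier algebra, given as the action `smul f a = f · a`. -/
structure C0Alg (X : Type u) [TopologicalSpace X] where
  carrier : Type v
  [cstar : NonUnitalCStarAlgebra carrier]
  smul : C₀(X, ℂ) →ₗ[ℂ] carrier →ₗ[ℂ] carrier
  mul_smul : ∀ f g a, smul (f * g) a = smul f (smul g a)
  smul_mul : ∀ f a b, smul f (a * b) = smul f a * b
  mul_smul_comm : ∀ f a b, smul f (a * b) = a * smul f b
  star_smul : ∀ f a, star (smul f a) = smul (star f) (star a)
  nondegenerate : (Submodule.span ℂ {c | ∃ f a, smul f a = c}).topologicalClosure = ⊤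

attribute [instance] C0Alg.cstar

instance {X : Type u} [TopologicalSpace X] : CoeSort (C0Alg.{u, v} X) (Type v) :=
  ⟨C0Alg.carrier⟩

/-- The closed ideal `C₀(X \ {x}) A`; the fibre of `A` at `x` is `A_x = A ⧸ A.null x`, and the
class of `a` in it is `a_x`. -/
noncomputable def C0Alg.null {X : Type u} [TopologicalSpace X] (A : C0Alg.{u, v} X) (x : X) :
    Submodule ℂ A :=
  (Submodule.span ℂ {c | ∃ (f : C₀(X, ℂ)) (a : A), f x = 0 ∧ A.smul f a = c}).topologicalClosure

/-- A (right) Hilbert module over a `C₀(X)`-algebra `B`; `rsmul ξ b = ξ b`, and the inner product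
is linear in the second variable. -/
structure HilbMod {X : Type u} [TopologicalSpace X] (B : C0Alg.{u, v} X) where
  carrier : Type v
  [normedAddCommGroup : NormedAddCommGroup carrier]
  [normedSpace : NormedSpace ℂ carrier]
  [complete : CompleteSpace carrier]
  rsmul : carrier →ₗ[ℂ] B →ₗ[ℂ] carrier
  rsmul_mul : ∀ ξ b c, rsmul ξ (b * c) = rsmul (rsmul ξ b) c
  inner : carrier → carrier → B
  inner_add : ∀ ξ η ζ, inner ξ (η + ζ) = inner ξ η + inner ξ ζ
  inner_smul : ∀ ξ η (z : ℂ), inner ξ (z • η) = z • inner ξ η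
  inner_rsmul : ∀ ξ η b, inner ξ (rsmul η b) = inner ξ η * b
  star_inner : ∀ ξ η, star (inner ξ η) = inner η ξ
  inner_self_nonneg : ∀ ξ, ∃ b : B, inner ξ ξ = star b * b
  norm_sq : ∀ ξ, ‖ξ‖ ^ 2 = ‖inner ξ ξ‖

attribute [instance] HilbMod.normedAddCommGroup HilbMod.normedSpace HilbMod.complete

/-- The closed submodule `E · C₀(X \ {x}) B`, where the `C₀(X)`-structure of `E` is inherited from
`B`; the fibre of `E` at `x` is `E_x = E ⧸ E.null x`, and the class of `ξ` in it is `ξ_x`. -/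
noncomputable def HilbMod.null {X : Type u} [TopologicalSpace X] {B : C0Alg.{u, v} X}
    (E : HilbMod B) (x : X) : Submodule ℂ E.carrier :=
  (Submodule.span ℂ {ζ | ∃ (f : C₀(X, ℂ)) (ξ : E.carrier) (b : B),
    f x = 0 ∧ E.rsmul ξ (B.smul f b) = ζ}).topologicalClosure

/-- A Hilbert `(A, B)`-bimodule `(π, E)`: a Hilbert `B`-module `E` with a ⋆-homomorphism `π` from
`A` to the adjointable operators on `E`. -/
structure HilbBimod {X : Type u} [TopologicalSpace X] (A B : C0Alg.{u, v} X)
    extends HilbMod B where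
  π : A →ₙₐ[ℂ] Module.End ℂ carrier
  adjoint : ∀ a ξ η, inner (π a ξ) η = inner ξ (π (star a) η)

/-! ### Groupoid actions -/

/-- Let `E` be given with its fibres `E_x = E ⧸ N x`, and let `f : Y → X` be continuous. A section
`σ` of the fibres `E_{f y}` belongs to the pullback `f^* E` if it is locally approximable by the
sections `ξ ∘ f`, `ξ ∈ E`. -/
def IsPullbackSection {X : Type u} {Y : Type w} [TopologicalSpace Y] {E : Type v}
    [NormedAddCommGroup E] [NormedSpace ℂ E] (N : X → Submodule ℂ E) (f : Y → X)
    (σ : ∀ y, E ⧸ N (f y)) : Prop :=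
  ∀ y₀ : Y, ∀ ε > (0 : ℝ), ∃ ξ : E, ∀ᶠ y in 𝓝 y₀, ‖σ y - (N (f y)).mkQ ξ‖ < ε

section Actions

variable {G : Type w} {X : Type u} [TopologicalSpace G] [TopologicalSpace X]

/-- An action of the groupoid on the field of fibres `E_x = E ⧸ N x`: linear maps
`V_g : E_{s(g)} → E_{r(g)}` with `V_{gh} = V_g V_h` and `V_x = id` for units `x`, which form a
continuous field of linear maps `s^* E → r^* E`. (As the classes `ξ_x`, `ξ ∈ E`, exhaust `E_x`,
the algebraic laws are expressed on such classes.) -/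
structure FieldAction (𝒢 : TopGroupoid G X) {E : Type v} [NormedAddCommGroup E]
    [NormedSpace ℂ E] (N : X → Submodule ℂ E) where
  map : ∀ g : G, (E ⧸ N (𝒢.src g)) →ₗ[ℂ] (E ⧸ N (𝒢.rng g))
  map_unit : ∀ (x : X) (ξ : E), map (𝒢.unit x) ((N _).mkQ ξ) = (N _).mkQ ξ
  map_mul : ∀ (g h : G) (hgh : 𝒢.src g = 𝒢.rng h) (ξ η ζ : E),
    map h ((N _).mkQ ξ) = (N _).mkQ η → map g ((N _).mkQ η) = (N _).mkQ ζ →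
      map (𝒢.mul g h hgh) ((N _).mkQ ξ) = (N _).mkQ ζ
  continuous : ∀ σ : (∀ g : G, E ⧸ N (𝒢.src g)), IsPullbackSection N 𝒢.src σ →
    IsPullbackSection N 𝒢.rng (fun g => map g (σ g))

/-- `V.Rel g ξ η` says that `V_g (ξ_{s(g)}) = η_{r(g)}`. -/
def FieldAction.Rel {𝒢 : TopGroupoid G X} {E : Type v} [NormedAddCommGroup E]
    [NormedSpace ℂ E] {N : X → Submodule ℂ E} (V : FieldAction 𝒢 N) (g : G) (ξ η : E) : Prop :=
  V.map g ((N (𝒢.src g)).mkQ ξ) = (N (𝒢.rng g)).mkQ η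

/-- A `𝒢`-action on a `C₀(X)`-algebra `A`, which makes it a `𝒢`-C⋆-algebra: the maps
`α_g : A_{s(g)} → A_{r(g)}` are moreover ⋆-homomorphisms. -/
structure GAlgAction (𝒢 : TopGroupoid G X) (A : C0Alg.{u, v} X)
    extends FieldAction 𝒢 A.null where
  map_prod : ∀ g a a₁ b b₁, toFieldAction.Rel g a a₁ → toFieldAction.Rel g b b₁ →
    toFieldAction.Rel g (a * b) (a₁ * b₁)
  map_star : ∀ g a a₁, toFieldAction.Rel g a a₁ → toFieldAction.Rel g (star a) (star a₁)

/-- A `𝒢`-action `V` on a Hilbert `(A, B)`-bimodule `(π, E)`, where `A` and `B` are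
`𝒢`-C⋆-algebras, which makes it a `𝒢`-Hilbert bimodule. -/
structure GBimodAction {𝒢 : TopGroupoid G X} {A B : C0Alg.{u, v} X} (αA : GAlgAction 𝒢 A)
    (αB : GAlgAction 𝒢 B) (M : HilbBimod A B) extends FieldAction 𝒢 M.null where
  /-- `V_g(ξ b) = V_g(ξ) α_g(b)` -/
  map_rsmul : ∀ g ξ ξ₁ b b₁, toFieldAction.Rel g ξ ξ₁ → αB.Rel g b b₁ →
    toFieldAction.Rel g (M.rsmul ξ b) (M.rsmul ξ₁ b₁)
  /-- `⟨V_g(ξ), V_g(η)⟩ = α_g(⟨ξ, η⟩)` -/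
  map_inner : ∀ g ξ ξ₁ η η₁, toFieldAction.Rel g ξ ξ₁ → toFieldAction.Rel g η η₁ →
    αB.Rel g (M.inner ξ η) (M.inner ξ₁ η₁)
  /-- `V_g(π(a) ξ) = π(α_g(a)) V_g(ξ)` -/
  map_π : ∀ g a a₁ ξ ξ₁, αA.Rel g a a₁ → toFieldAction.Rel g ξ ξ₁ →
    toFieldAction.Rel g (M.π a ξ) (M.π a₁ ξ₁)
  /-- the left multiplication is compatible with the `C₀(X)`-structures: `(f a) ξ = a (f ξ)` -/
  π_smul : ∀ f a ξ b, M.π (A.smul f a) (M.rsmul ξ b) = M.π a (M.rsmul ξ (B.smul f b))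

/-! ### Inverse semigroup actions -/

variable {𝒢 : TopGroupoid G X}

/-- An `S`-action on a `C₀(X)`-algebra `A`, which makes it a compatible `S`-Hilbert C⋆-algebra. -/
structure SAlgAction (S : CantorInvSemigroup 𝒢) (A : C0Alg.{u, v} X) where
  map : S.Elt → (A →⋆ₙₐ[ℂ] A)
  map_mul : ∀ s t a, map (s * t) a = map s (map t a)
  /-- `e(a) b = a e(b)` -/
  central : ∀ (e : S.Proj) a b, map e.1 a * b = a * map e.1 b
  /-- compatibility `e(a) = 1_e · a`, where the bounded continuous function `1_e` acts on `A` as a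
  multiplier, that is, `f · (1_e · a) = (1_e f) · a` for all `f ∈ C₀(X)` -/
  compatible : ∀ (e : S.Proj) (f : C₀(X, ℂ)) a,
    A.smul f (map e.1 a) = A.smul (clopenMul e.set e.isClopen f) a

/-- An `S`-action `U` on a Hilbert `(A, B)`-bimodule `(π, E)`, where `A` and `B` are compatible
`S`-Hilbert C⋆-algebras, which makes it a compatible `S`-Hilbert bimodule. -/
structure SBimodAction {S : CantorInvSemigroup 𝒢} {A B : C0Alg.{u, v} X} (βA : SAlgAction S A)
    (βB : SAlgAction S B) (M : HilbBimod A B) where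
  map : S.Elt → (M.carrier →ₗ[ℂ] M.carrier)
  map_mul : ∀ s t ξ, map (s * t) ξ = map s (map t ξ)
  map_rsmul : ∀ s ξ b, map s (M.rsmul ξ b) = M.rsmul (map s ξ) (βB.map s b)
  map_inner : ∀ s ξ η, M.inner (map s ξ) η = βB.map s (M.inner ξ (map (star s) η))
  /-- equivariance of `π`: `U_s π(a) U_s^* = π(s(a)) U_s U_s^*` -/
  map_π : ∀ s a ξ, map s (M.π a (map (star s) ξ)) = M.π (βA.map s a) (map s (map (star s) ξ))
  /-- compatibility of the right multiplication: `U_e(ξ) b = ξ e(b)` -/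
  compatible : ∀ (e : S.Proj) ξ b, M.rsmul (map e.1 ξ) b = M.rsmul ξ (βB.map e.1 b)
  /-- compatibility of the left multiplication: `e(a) ξ = a U_e(ξ)` -/
  compatible_π : ∀ (e : S.Proj) a ξ, M.π (βA.map e.1 a) ξ = M.π a (map e.1 ξ)

/-! ### The formulas that link the two kinds of actions -/

/-- `(U_s(ξ))_x = 1_{x ∈ s s^*} V_{xs}(ξ_{s^* x s})` for all `s`, `ξ`, `x`. If `x ∈ s s^*`, then
`g = x s` is the unique arrow in `s` with range `x`, and its source is `s^* x s`. -/
def InverseSemigroupFormula (S : CantorInvSemigroup 𝒢) {E : Type v} [NormedAddCommGroup E]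
    [NormedSpace ℂ E] {N : X → Submodule ℂ E} (V : FieldAction 𝒢 N) (U : S.Elt → E → E) : Prop :=
  ∀ (s : S.Elt) (ξ : E),
    (∀ g ∈ s.1, (N (𝒢.rng g)).mkQ (U s ξ) = V.map g ((N (𝒢.src g)).mkQ ξ)) ∧
    (∀ x : X, x ∉ 𝒢.base (s * star s).1 → (N x).mkQ (U s ξ) = 0)

/-- `V_g(ξ_{s(g)}) = (U_s(ξ))_{r(g)}` for all `ξ` and `g ∈ s`. -/
def GroupoidFormula (S : CantorInvSemigroup 𝒢) {E : Type v} [NormedAddCommGroup E]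
    [NormedSpace ℂ E] {N : X → Submodule ℂ E} (V : FieldAction 𝒢 N) (U : S.Elt → E → E) : Prop :=
  ∀ (s : S.Elt) (ξ : E), ∀ g ∈ s.1,
    V.map g ((N (𝒢.src g)).mkQ ξ) = (N (𝒢.rng g)).mkQ (U s ξ)

end Actions

/-! ### The categories -/

/-- A Hilbert bimodule over some pair of `C₀(X)`-algebras, without action. -/
structure PlainBimod (X : Type u) [TopologicalSpace X] where
  A : C0Alg.{u, v} X
  B : C0Alg.{u, v} X
  M : HilbBimod A B

/-- A morphism of Hilbert bimodules: a bounded linear map which is compatible with the left and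
right multiplications along ⋆-homomorphisms of the coefficient algebras. -/
@[ext]
structure BimodHom {X : Type u} [TopologicalSpace X] (M N : PlainBimod.{u, v} X) where
  homA : M.A →⋆ₙₐ[ℂ] N.A
  homB : M.B →⋆ₙₐ[ℂ] N.B
  homE : M.M.carrier →L[ℂ] N.M.carrier
  hom_π : ∀ a ξ, homE (M.M.π a ξ) = N.M.π (homA a) (homE ξ)
  hom_rsmul : ∀ ξ b, homE (M.M.rsmul ξ b) = N.M.rsmul (homE ξ) (homB b)

namespace BimodHom

variable {X : Type u} [TopologicalSpace X]

/-- The identity. -/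
def id (M : PlainBimod.{u, v} X) : BimodHom M M where
  homA := NonUnitalStarAlgHom.id ℂ _
  homB := NonUnitalStarAlgHom.id ℂ _
  homE := ContinuousLinearMap.id ℂ _
  hom_π _ _ := rfl
  hom_rsmul _ _ := rfl

/-- First `φ`, then `ψ`. -/
def comp {M N P : PlainBimod.{u, v} X} (φ : BimodHom M N) (ψ : BimodHom N P) : BimodHom M P where
  homA := ψ.homA.comp φ.homA
  homB := ψ.homB.comp φ.homB
  homE := ψ.homE.comp φ.homE
  hom_π a ξ := by simp [φ.hom_π, ψ.hom_π]
  hom_rsmul ξ b := by simp [φ.hom_rsmul, ψ.hom_rsmul]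

end BimodHom

instance {X : Type u} [TopologicalSpace X] : Category (PlainBimod.{u, v} X) where
  Hom := BimodHom
  id := BimodHom.id
  comp := BimodHom.comp
  id_comp _ := rfl
  comp_id _ := rfl
  assoc _ _ _ := rfl

section Categories

variable {G : Type w} {X : Type u} [TopologicalSpace G] [TopologicalSpace X]

/-- A `𝒢`-Hilbert bimodule `(π, E, V)` over `𝒢`-C⋆-algebras `A` and `B`. -/
structure GHilbBimod (𝒢 : TopGroupoid G X) where
  A : C0Alg.{u, v} X
  B : C0Alg.{u, v} X
  αA : GAlgAction 𝒢 A
  αB : GAlgAction 𝒢 B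
  M : HilbBimod A B
  V : GBimodAction αA αB M

/-- The underlying Hilbert bimodule. -/
def GHilbBimod.toBimod {𝒢 : TopGroupoid G X} (M : GHilbBimod.{u, w, v} 𝒢) : PlainBimod.{u, v} X :=
  ⟨M.A, M.B, M.M⟩

/-- A compatible `S`-Hilbert bimodule `(π, E, U)` over compatible `S`-Hilbert C⋆-algebras `A` and
`B`. -/
structure SHilbBimod {𝒢 : TopGroupoid G X} (S : CantorInvSemigroup 𝒢) where
  A : C0Alg.{u, v} X
  B : C0Alg.{u, v} X
  βA : SAlgAction S A
  βB : SAlgAction S B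
  M : HilbBimod A B
  U : SBimodAction βA βB M

/-- The underlying Hilbert bimodule. -/
def SHilbBimod.toBimod {𝒢 : TopGroupoid G X} {S : CantorInvSemigroup 𝒢}
    (M : SHilbBimod.{u, w, v} S) : PlainBimod.{u, v} X :=
  ⟨M.A, M.B, M.M⟩

/-- A morphism of `𝒢`-Hilbert bimodules: the maps between the algebras are `C₀(X)`-linear (and then
the map between the modules is so as well), and all maps are `𝒢`-equivariant on the fibres. -/
@[ext]
structure GHom {𝒢 : TopGroupoid G X} (M N : GHilbBimod.{u, w, v} 𝒢)
    extends BimodHom M.toBimod N.toBimod where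
  smulA : ∀ f (a : M.A), homA (M.A.smul f a) = N.A.smul f (homA a)
  smulB : ∀ f (b : M.B), homB (M.B.smul f b) = N.B.smul f (homB b)
  equivA : ∀ g (a a₁ : M.A), M.αA.Rel g a a₁ → N.αA.Rel g (homA a) (homA a₁)
  equivB : ∀ g (b b₁ : M.B), M.αB.Rel g b b₁ → N.αB.Rel g (homB b) (homB b₁)
  equivE : ∀ g (ξ ξ₁ : M.M.carrier), M.V.Rel g ξ ξ₁ → N.V.Rel g (homE ξ) (homE ξ₁)

/-- A morphism of compatible `S`-Hilbert bimodules: all maps are `S`-equivariant. -/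
@[ext]
structure SHom {𝒢 : TopGroupoid G X} {S : CantorInvSemigroup 𝒢} (M N : SHilbBimod.{u, w, v} S)
    extends BimodHom M.toBimod N.toBimod where
  equivA : ∀ s (a : M.A), homA (M.βA.map s a) = N.βA.map s (homA a)
  equivB : ∀ s (b : M.B), homB (M.βB.map s b) = N.βB.map s (homB b)
  equivE : ∀ s (ξ : M.M.carrier), homE (M.U.map s ξ) = N.U.map s (homE ξ)

instance {𝒢 : TopGroupoid G X} : Category (GHilbBimod.{u, w, v} 𝒢) where
  Hom := GHom
  id M :=
    { BimodHom.id M.toBimod with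
      smulA := fun _ _ => rfl
      smulB := fun _ _ => rfl
      equivA := fun _ _ _ h => h
      equivB := fun _ _ _ h => h
      equivE := fun _ _ _ h => h }
  comp φ ψ :=
    { BimodHom.comp φ.toBimodHom ψ.toBimodHom with
      smulA := fun f a => (congrArg ψ.homA (φ.smulA f a)).trans (ψ.smulA f (φ.homA a))
      smulB := fun f b => (congrArg ψ.homB (φ.smulB f b)).trans (ψ.smulB f (φ.homB b))
      equivA := fun g _ _ h => ψ.equivA g _ _ (φ.equivA g _ _ h)
      equivB := fun g _ _ h => ψ.equivB g _ _ (φ.equivB g _ _ h)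
      equivE := fun g _ _ h => ψ.equivE g _ _ (φ.equivE g _ _ h) }
  id_comp _ := rfl
  comp_id _ := rfl
  assoc _ _ _ := rfl

instance {𝒢 : TopGroupoid G X} {S : CantorInvSemigroup 𝒢} :
    Category (SHilbBimod.{u, w, v} S) where
  Hom := SHom
  id M :=
    { BimodHom.id M.toBimod with
      equivA := fun _ _ => rfl
      equivB := fun _ _ => rfl
      equivE := fun _ _ => rfl }
  comp φ ψ :=
    { BimodHom.comp φ.toBimodHom ψ.toBimodHom with
      equivA := fun s a => (congrArg ψ.homA (φ.equivA s a)).trans (ψ.equivA s (φ.homA a))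
      equivB := fun s b => (congrArg ψ.homB (φ.equivB s b)).trans (ψ.equivB s (φ.homB b))
      equivE := fun s ξ => (congrArg ψ.homE (φ.equivE s ξ)).trans (ψ.equivE s (φ.homE ξ)) }
  id_comp _ := rfl
  comp_id _ := rfl
  assoc _ _ _ := rfl

/-- Forget the `𝒢`-actions. -/
def forgetG (𝒢 : TopGroupoid G X) : GHilbBimod.{u, w, v} 𝒢 ⥤ PlainBimod.{u, v} X where
  obj M := M.toBimod
  map φ := φ.toBimodHom

/-- Forget the `S`-actions. -/
def forgetS {𝒢 : TopGroupoid G X} (S : CantorInvSemigroup 𝒢) :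
    SHilbBimod.{u, w, v} S ⥤ PlainBimod.{u, v} X where
  obj M := M.toBimod
  map φ := φ.toBimodHom

end Categories

/-! ### Tensor products -/

section Tensor

variable {X : Type u} [TopologicalSpace X]

/-- `P`, with `t ξ η = ξ ⊗ η`, is the internal tensor product `M ⊗_B N`: it is the completion of
the algebraic tensor product for the inner product
`⟨ξ ⊗ η, ξ₁ ⊗ η₁⟩ = ⟨η, ⟨ξ, ξ₁⟩ η₁⟩`, with the left multiplication `a (ξ ⊗ η) = a ξ ⊗ η`. This
determines `(P, t)` up to a unique isomorphism. -/
structure IsInternalTensor {A B C : C0Alg.{u, v} X} (M : HilbBimod A B) (N : HilbBimod B C)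
    (P : HilbBimod A C) (t : M.carrier →ₗ[ℂ] N.carrier →ₗ[ℂ] P.carrier) : Prop where
  inner : ∀ ξ ξ₁ η η₁, P.inner (t ξ η) (t ξ₁ η₁) = N.inner η (N.π (M.inner ξ ξ₁) η₁)
  dense : (Submodule.span ℂ {ζ | ∃ ξ η, t ξ η = ζ}).topologicalClosure = ⊤
  π : ∀ a ξ η, P.π a (t ξ η) = t (M.π a ξ) η

/-- `A`, with `t a b = a ⊗ b`, is a `C₀(X)`-balanced C⋆-tensor product of `A₁` and `A₂`: the
completion of the `C₀(X)`-balanced algebraic tensor product for some C⋆-seminorm. -/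
structure IsC0Tensor (A₁ A₂ A : C0Alg.{u, v} X) (t : A₁ →ₗ[ℂ] A₂ →ₗ[ℂ] A) : Prop where
  mul : ∀ a a₁ b b₁, t a b * t a₁ b₁ = t (a * a₁) (b * b₁)
  star : ∀ a b, star (t a b) = t (star a) (star b)
  smul_left : ∀ f a b, t (A₁.smul f a) b = A.smul f (t a b)
  smul_right : ∀ f a b, t a (A₂.smul f b) = A.smul f (t a b)
  dense : (Submodule.span ℂ {c | ∃ a b, t a b = c}).topologicalClosure = ⊤

/-- The C⋆-seminorm is the maximal one, so that `A = A₁ ⊗_{C₀(X)} A₂` is the maximal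
`C₀(X)`-balanced tensor product, which is determined by this up to a unique isomorphism. -/
structure IsMaxC0Tensor (A₁ A₂ A : C0Alg.{u, v} X) (t : A₁ →ₗ[ℂ] A₂ →ₗ[ℂ] A) : Prop
    extends IsC0Tensor A₁ A₂ A t where
  universal : ∀ (D : Type v) [NonUnitalCStarAlgebra D] (p : A₁ →ₗ[ℂ] A₂ →ₗ[ℂ] D),
    (∀ a a₁ b b₁, p a b * p a₁ b₁ = p (a * a₁) (b * b₁)) →
    (∀ a b, Star.star (p a b) = p (Star.star a) (Star.star b)) →
    (∀ f a b, p (A₁.smul f a) b = p a (A₂.smul f b)) →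
    ∃ Φ : A →⋆ₙₐ[ℂ] D, ∀ a b, Φ (t a b) = p a b

/-- `P`, with `t ξ η = ξ ⊗ η`, is the external `C₀(X)`-balanced tensor product of `M` and `N`: it is
the completion of the algebraic tensor product for the inner product
`⟨ξ ⊗ η, ξ₁ ⊗ η₁⟩ = ⟨ξ, ξ₁⟩ ⊗ ⟨η, η₁⟩`, with the left multiplication
`(a ⊗ b) (ξ ⊗ η) = a ξ ⊗ b η`. Here `tA` and `tB` are the tensor products of the coefficient
algebras. This determines `(P, t)` up to a unique isomorphism. -/
structure IsExternalTensor {A₁ B₁ A₂ B₂ A B : C0Alg.{u, v} X} (tA : A₁ →ₗ[ℂ] A₂ →ₗ[ℂ] A)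
    (tB : B₁ →ₗ[ℂ] B₂ →ₗ[ℂ] B) (M : HilbBimod A₁ B₁) (N : HilbBimod A₂ B₂) (P : HilbBimod A B)
    (t : M.carrier →ₗ[ℂ] N.carrier →ₗ[ℂ] P.carrier) : Prop where
  inner : ∀ ξ ξ₁ η η₁, P.inner (t ξ η) (t ξ₁ η₁) = tB (M.inner ξ ξ₁) (N.inner η η₁)
  dense : (Submodule.span ℂ {ζ | ∃ ξ η, t ξ η = ζ}).topologicalClosure = ⊤
  π : ∀ a b ξ η, P.π (tA a b) (t ξ η) = t (M.π a ξ) (N.π b η)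

end Tensor

/-- The groupoid action `V` is diagonal, `V_g(ξ ⊗ η) = V₁_g(ξ) ⊗ V₂_g(η)` on the fibres, with
respect to the bilinear map `t ξ η = ξ ⊗ η`. -/
def GDiagonal {G : Type w} {X : Type u} [TopologicalSpace G] [TopologicalSpace X]
    {𝒢 : TopGroupoid G X} {E₁ E₂ E : Type v} [NormedAddCommGroup E₁] [NormedSpace ℂ E₁]
    [NormedAddCommGroup E₂] [NormedSpace ℂ E₂] [NormedAddCommGroup E] [NormedSpace ℂ E]
    {N₁ : X → Submodule ℂ E₁} {N₂ : X → Submodule ℂ E₂} {N : X → Submodule ℂ E}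
    (V₁ : FieldAction 𝒢 N₁) (V₂ : FieldAction 𝒢 N₂) (t : E₁ →ₗ[ℂ] E₂ →ₗ[ℂ] E)
    (V : FieldAction 𝒢 N) : Prop :=
  ∀ g ξ ξ₁ η η₁, V₁.Rel g ξ ξ₁ → V₂.Rel g η η₁ → V.Rel g (t ξ η) (t ξ₁ η₁)

/-- The family of maps `U` is diagonal, `U_s(ξ ⊗ η) = U₁_s(ξ) ⊗ U₂_s(η)`, with respect to the
bilinear map `t ξ η = ξ ⊗ η`. -/
def SDiagonal {I : Type w} {E₁ E₂ E : Type v} [AddCommGroup E₁] [Module ℂ E₁]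
    [AddCommGroup E₂] [Module ℂ E₂] [AddCommGroup E] [Module ℂ E] (U₁ : I → E₁ → E₁)
    (U₂ : I → E₂ → E₂) (t : E₁ →ₗ[ℂ] E₂ →ₗ[ℂ] E) (U : I → E → E) : Prop :=
  ∀ s ξ η, U s (t ξ η) = t (U₁ s ξ) (U₂ s η)

/-!
Both kinds of action are compared fibre by fibre. The basic observation is that `C₀(X)`-algebras and
Hilbert modules over them are fields of fibres in the sense of `IsC0Mod`: since the semigroup is
full, `X` is a locally compact space with a basis of compact open sets
(`CantorInvSemigroup.locallyBooleanSpace`), hence an element is small near a point if its class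
there is small (`IsC0Mod.exists_norm_act_lt`), its norm is the supremum of the norms of its classes
(`IsC0Mod.norm_le_of_forall`), and every locally approximable field of classes which vanishes at
infinity comes from an element (`IsC0Mod.exists_forall_sub_mem`).

From a groupoid action `V` to the inverse semigroup: the maps `V_g` are contractive, for algebras as
⋆-homomorphisms of C⋆-algebras, and for modules by `‖ξ_x‖² = ‖⟨ξ, ξ⟩_x‖`. Therefore the field
`x ↦ 1_{x ∈ s s⋆} V_{xs}(ξ_{s(xs)})` vanishes at infinity, and it is locally approximable because `V`
is continuous and `s` is an open set on which `r` is a homeomorphism onto the clopen set `s s⋆`; so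
it defines `U_s ξ` (`FieldAction.exists_semigroup_apply`).

From an inverse semigroup action `U` to the groupoid: compatibility says that the projection `e` acts
as `1_e`. If `ξ_{s(g)} = 0`, then by fullness `ξ` can be made arbitrarily small by multiplication
with some `1_e (1 - 1_{f₁}) ⋯ (1 - 1_{fₙ})` that is `1` at `s(g)`, and this does not change
`(U_s ξ)_{r(g)}` for `g ∈ s` (`IsCompatibleAction.map_mem`). So `V_g(ξ_{s(g)}) = (U_s ξ)_{r(g)}` is
well defined; it does not depend on `s`, as two elements of the semigroup which contain `g` agree
near `g`. The same argument shows that `S`-equivariant homomorphisms are `C₀(X)`-linear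
(`SAlgAction.hom_smul`), and that `(f a) ξ = a (f ξ)` holds in a compatible `S`-Hilbert bimodule
(`SBimodAction.π_smul`). The algebraic identities of the two kinds of action translate into each
other since they can be tested on the fibres.

For tensor products, the bilinear map `ξ ⊗ η` is bounded and `C₀(X)`-bilinear, so it is defined on the
fibres, and diagonal actions correspond to each other (`gDiagonal_iff_sDiagonal`). On the side of the
inverse semigroup the diagonal action exists on modules because the maps `ξ ⊗ η ↦ U_s ξ ⊗ U_s η`
preserve the inner product up to `β_s` (`HilbMod.exists_extension`), and on the maximal tensor product
of algebras by its universal property; it is unique by density. On the side of the groupoid existence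
and uniqueness follow from the correspondence.
-/

open TopologicalSpace (CompactOpens)

/-! ### Inequalities in C⋆-algebras -/

section CStar

variable {A : Type*} [NonUnitalCStarAlgebra A]

/-- In the unitization, `h = 1 - √(1 - a⋆a)`, so that `1 - a⋆a = (1 - h)²`. This turns
`a⋆a ≤ 1` into an algebraic identity that survives in every representation. -/
theorem exists_one_sub_sq (a : A) (ha : ‖a‖ ≤ 1) :
    ∃ h : A, star h = h ∧ h + h - h * h = star a * a := by
  have hs : IsSelfAdjoint (star a * a) := IsSelfAdjoint.star_mul_self a
  have hn : ‖star a * a‖ ≤ 1 := by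
    rw [CStarRing.norm_star_mul_self]; nlinarith [norm_nonneg a]
  have hc : Continuous fun t : ℝ => 1 - √(1 - t) := by fun_prop
  have h0 : (fun t : ℝ => 1 - √(1 - t)) 0 = 0 := by simp
  let f : ℝ → ℝ := fun t => 1 - √(1 - t)
  have hp : IsSelfAdjoint (cfcₙ f (star a * a)) := cfcₙ_predicate f (star a * a)
  refine ⟨cfcₙ f (star a * a), hp.star_eq, ?_⟩
  rw [← cfcₙ_add (a := star a * a) f f hc.continuousOn h0 hc.continuousOn h0,
    ← cfcₙ_mul f f (star a * a) hc.continuousOn h0 hc.continuousOn h0,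
    ← cfcₙ_sub (a := star a * a) (fun t => f t + f t) (fun t => f t * f t)
      (hc.add hc).continuousOn (by simp [f]) (hc.mul hc).continuousOn (by simp [f])]
  conv_rhs => rw [← cfcₙ_id' ℝ (star a * a)]
  refine cfcₙ_congr fun t ht => ?_
  have h1 : t ≤ 1 :=
    (le_abs_self t).trans ((NonUnitalIsometricContinuousFunctionalCalculus.norm_quasispectrum_le
      (star a * a) ht hs).trans hn)
  have := Real.mul_self_sqrt (sub_nonneg.2 h1)
  simp only [f]
  linarith

theorem norm_le_of_star_mul_self_add (a b c d : A)
    (h : star a * a + star b * b + star c * c = star d * d) : ‖a‖ ≤ ‖d‖ := by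
  let := CStarAlgebra.spectralOrder A
  have := CStarAlgebra.spectralOrderedRing A
  have h1 : ‖star a * a‖ ≤ ‖star d * d‖ := by
    refine CStarAlgebra.norm_le_norm_of_nonneg_of_le (star_mul_self_nonneg a) ?_
    rw [← h, add_assoc]
    exact le_add_of_nonneg_right (add_nonneg (star_mul_self_nonneg b) (star_mul_self_nonneg c))
  rw [CStarRing.norm_star_mul_self, CStarRing.norm_star_mul_self] at h1
  exact abs_le_of_sq_le_sq' (by nlinarith) (norm_nonneg _) |>.2

theorem norm_le_of_star_mul_self_add' (a b d : A)
    (h : star a * a + star b * b = star d * d) : ‖a‖ ≤ ‖d‖ :=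
  norm_le_of_star_mul_self_add a b 0 d (by simpa using h)

/-- A C⋆-algebra has an approximate unit, used here one element at a time. -/
theorem exists_norm_sub_mul_lt (a : A) {ε : ℝ} (hε : 0 < ε) :
    ∃ e : A, star e = e ∧ ‖e‖ ≤ 1 ∧ ‖a - a * e‖ < ε := by
  let := CStarAlgebra.spectralOrder A
  have := CStarAlgebra.spectralOrderedRing A
  have hl := CStarAlgebra.increasingApproximateUnit A
  have h1 := hl.tendsto_mul_left a
  have h2 := (Metric.tendsto_nhds.1 h1) ε hε
  obtain ⟨e, he, he', he''⟩ := (h2.and (hl.eventually_star_eq.and hl.eventually_norm)).exists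
  refine ⟨e, he', he'', ?_⟩
  rwa [dist_comm, dist_eq_norm] at he

end CStar

theorem NonUnitalStarAlgHom.continuous_of_cstar {A B : Type*} [NonUnitalCStarAlgebra A]
    [NonUnitalCStarAlgebra B] (φ : A →⋆ₙₐ[ℂ] B) : Continuous φ :=
  AddMonoidHomClass.continuous_of_bound φ 1 fun a =>
    (NonUnitalStarAlgHom.norm_apply_le φ a).trans (one_mul _).ge

/-! ### Hilbert modules -/

namespace HilbMod

variable {X : Type u} [TopologicalSpace X] {B : C0Alg.{u, v} X} (E : HilbMod B)

theorem inner_add_left (ξ η ζ : E.carrier) : E.inner (ξ + η) ζ = E.inner ξ ζ + E.inner η ζ := by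
  rw [← E.star_inner, E.inner_add, star_add, E.star_inner, E.star_inner]

theorem inner_smul_left (z : ℂ) (ξ η : E.carrier) :
    E.inner (z • ξ) η = star z • E.inner ξ η := by
  rw [← E.star_inner, E.inner_smul, star_smul, E.star_inner]

/-- The inner product as a linear map in its second variable. -/
def innerₗ (ξ : E.carrier) : E.carrier →ₗ[ℂ] B where
  toFun := E.inner ξ
  map_add' := E.inner_add ξ
  map_smul' z η := E.inner_smul ξ η z

theorem inner_sub (ξ η ζ : E.carrier) : E.inner ξ (η - ζ) = E.inner ξ η - E.inner ξ ζ :=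
  map_sub (E.innerₗ ξ) η ζ

theorem inner_zero (ξ : E.carrier) : E.inner ξ 0 = 0 := map_zero (E.innerₗ ξ)

theorem inner_sub_left (ξ η ζ : E.carrier) : E.inner (ξ - η) ζ = E.inner ξ ζ - E.inner η ζ := by
  rw [← E.star_inner, E.inner_sub, star_sub, E.star_inner, E.star_inner]

theorem inner_zero_left (ξ : E.carrier) : E.inner 0 ξ = 0 := by
  rw [← E.star_inner, E.inner_zero, star_zero]

theorem inner_rsmul_left (ξ η : E.carrier) (b : B) :
    E.inner (E.rsmul ξ b) η = star b * E.inner ξ η := by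
  rw [← E.star_inner, E.inner_rsmul, star_mul, E.star_inner]

theorem eq_zero_of_inner_self {ξ : E.carrier} (h : E.inner ξ ξ = 0) : ξ = 0 := by
  have := E.norm_sq ξ
  rw [h, norm_zero] at this
  simpa using this

theorem eq_of_forall_inner {ξ η : E.carrier} (h : ∀ ζ, E.inner ζ ξ = E.inner ζ η) : ξ = η := by
  rw [← sub_eq_zero]
  apply E.eq_zero_of_inner_self
  rw [E.inner_sub, h, sub_self]

/-- If `⟨ξ, ξ⟩ + ⟨ζ, ζ⟩ = ⟨η, η⟩` then `‖ξ‖ ≤ ‖η‖`. -/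
theorem norm_le_of_inner_add {ξ ζ η : E.carrier}
    (h : E.inner ξ ξ + E.inner ζ ζ = E.inner η η) : ‖ξ‖ ≤ ‖η‖ := by
  obtain ⟨a, ha⟩ := E.inner_self_nonneg ξ
  obtain ⟨b, hb⟩ := E.inner_self_nonneg ζ
  obtain ⟨d, hd⟩ := E.inner_self_nonneg η
  have h1 := norm_le_of_star_mul_self_add' a b d (by rw [← ha, ← hb, ← hd, h])
  have h2 := E.norm_sq ξ
  have h3 := E.norm_sq η
  rw [ha, CStarRing.norm_star_mul_self] at h2
  rw [hd, CStarRing.norm_star_mul_self] at h3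
  exact abs_le_of_sq_le_sq' (by nlinarith [norm_nonneg a]) (norm_nonneg _) |>.2

/-- The Cauchy-Schwarz inequality for `‖ξ‖ ≤ 1`: if `b = ⟨ξ, η⟩`, then `b⋆b ≤ ⟨η, η⟩`, because
the difference is `⟨ξ b - η, ξ b - η⟩ + b⋆(1 - ⟨ξ, ξ⟩)b`. -/
theorem norm_inner_le_of_norm_le_one {ξ : E.carrier} (hξ : ‖ξ‖ ≤ 1) (η : E.carrier) :
    ‖E.inner ξ η‖ ≤ ‖η‖ := by
  obtain ⟨c, hc⟩ := E.inner_self_nonneg ξ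
  obtain ⟨d, hd⟩ := E.inner_self_nonneg η
  have hcn : ‖c‖ ≤ 1 := by
    have := E.norm_sq ξ
    rw [hc, CStarRing.norm_star_mul_self] at this
    nlinarith [norm_nonneg c, norm_nonneg ξ]
  obtain ⟨h, hh, hhc⟩ := exists_one_sub_sq c hcn
  set b := E.inner ξ η with hb
  obtain ⟨e, he⟩ := E.inner_self_nonneg (E.rsmul ξ b - η)
  have hb' : E.inner η ξ = star b := by rw [hb, E.star_inner]
  have h1 : star e * e = star b * (h + h - h * h) * b - star b * b - star b * b + star d * d := by
    rw [← he, E.inner_sub, E.inner_rsmul, E.inner_sub_left, E.inner_sub_left, E.inner_rsmul_left,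
      E.inner_rsmul_left, hb', hc, hd, hhc, ← hb]
    simp only [sub_mul]
    abel
  have h2 : ‖b‖ ≤ ‖d‖ := by
    refine norm_le_of_star_mul_self_add b e (b - h * b) d ?_
    rw [h1]
    simp only [star_sub, star_mul, hh, mul_sub, sub_mul, mul_add, add_mul, mul_assoc]
    abel
  have h3 := E.norm_sq η
  rw [hd, CStarRing.norm_star_mul_self] at h3
  exact h2.trans (abs_le_of_sq_le_sq' (by nlinarith [norm_nonneg d]) (norm_nonneg _) |>.2)

theorem norm_inner_le (ξ η : E.carrier) : ‖E.inner ξ η‖ ≤ ‖ξ‖ * ‖η‖ := by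
  rcases eq_or_ne ξ 0 with rfl | hξ
  · simp [E.inner_zero_left]
  have hn : 0 < ‖ξ‖ := norm_pos_iff.2 hξ
  have h1 := E.norm_inner_le_of_norm_le_one (ξ := ((‖ξ‖⁻¹ : ℝ) : ℂ) • ξ)
    (by rw [norm_smul]; simp [hn.ne']) η
  rw [E.inner_smul_left, norm_smul, norm_star, Complex.norm_real, norm_inv, norm_norm,
    inv_mul_le_iff₀ hn] at h1
  exact h1

theorem norm_rsmul_le (ξ : E.carrier) (b : B) : ‖E.rsmul ξ b‖ ≤ ‖ξ‖ * ‖b‖ := by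
  have h1 : ‖E.rsmul ξ b‖ ^ 2 ≤ (‖ξ‖ * ‖b‖) ^ 2 := by
    rw [E.norm_sq, E.inner_rsmul, E.inner_rsmul_left, mul_pow, E.norm_sq ξ]
    calc _ ≤ ‖star b‖ * ‖E.inner ξ ξ‖ * ‖b‖ :=
          (norm_mul_le _ _).trans (by gcongr; exact norm_mul_le _ _)
      _ = _ := by rw [norm_star]; ring
  exact abs_le_of_sq_le_sq' h1 (by positivity) |>.2

theorem continuous_rsmul_right (ξ : E.carrier) : Continuous (fun b => E.rsmul ξ b) :=
  ((E.rsmul ξ).mkContinuous ‖ξ‖ (E.norm_rsmul_le ξ)).continuous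

theorem continuous_rsmul_left (b : B) : Continuous (fun ξ => E.rsmul ξ b) :=
  ((E.rsmul.flip b).mkContinuous ‖b‖
    (fun ξ => (E.norm_rsmul_le ξ b).trans_eq (mul_comm _ _))).continuous

theorem continuous_inner_right (ξ : E.carrier) : Continuous (fun η => E.inner ξ η) :=
  ((E.innerₗ ξ).mkContinuous ‖ξ‖ (E.norm_inner_le ξ)).continuous

theorem continuous_inner_left (η : E.carrier) : Continuous (fun ξ => E.inner ξ η) := by
  have : (fun ξ => E.inner ξ η) = fun ξ => star (E.inner η ξ) := by
    ext ξ; rw [E.star_inner]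
  rw [this]
  exact continuous_star.comp (E.continuous_inner_right η)

/-- A Hilbert module is nondegenerate: `ξ` is a limit of vectors `ξ b`. -/
theorem exists_norm_sub_rsmul_lt (ξ : E.carrier) {ε : ℝ} (hε : 0 < ε) :
    ∃ b : B, ‖ξ - E.rsmul ξ b‖ < ε := by
  obtain ⟨b, hb, hb1, hb2⟩ := exists_norm_sub_mul_lt (E.inner ξ ξ) (ε := ε ^ 2 / 2) (by positivity)
  refine ⟨b, ?_⟩
  have h1 : ‖ξ - E.rsmul ξ b‖ ^ 2 < ε ^ 2 := by
    rw [E.norm_sq, E.inner_sub, E.inner_rsmul, E.inner_sub_left, E.inner_rsmul_left, hb]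
    set c := E.inner ξ ξ
    have : c - b * c - (c - b * c) * b = (c - c * b) - b * (c - c * b) := by
      simp only [sub_mul, mul_sub, mul_assoc]; abel
    rw [this]
    calc _ ≤ ‖c - c * b‖ + ‖b‖ * ‖c - c * b‖ :=
          (norm_sub_le _ _).trans (by gcongr; exact norm_mul_le _ _)
      _ ≤ ‖c - c * b‖ + 1 * ‖c - c * b‖ := by gcongr
      _ < _ := by linarith
  exact abs_lt_of_sq_lt_sq h1 hε.le |> lt_of_abs_lt

/-- A closed subspace that contains `ξ b` for all `b` contains `ξ`. -/
theorem mem_of_forall_rsmul_mem {N : Submodule ℂ E.carrier} (hN : IsClosed (N : Set E.carrier))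
    {ξ : E.carrier} (h : ∀ b, E.rsmul ξ b ∈ N) : ξ ∈ N := by
  rw [← SetLike.mem_coe, ← hN.closure_eq, Metric.mem_closure_iff]
  intro ε hε
  obtain ⟨b, hb⟩ := E.exists_norm_sub_rsmul_lt ξ hε
  exact ⟨_, h b, by rwa [dist_eq_norm]⟩

end HilbMod

namespace HilbBimod

variable {X : Type u} [TopologicalSpace X] {A B : C0Alg.{u, v} X} (M : HilbBimod A B)

theorem π_rsmul (a : A) (ξ : M.carrier) (b : B) :
    M.π a (M.rsmul ξ b) = M.rsmul (M.π a ξ) b := by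
  apply M.eq_of_forall_inner
  intro ζ
  have h : ∀ η, M.inner ζ (M.π a η) = M.inner (M.π (star a) ζ) η := by
    intro η; rw [M.adjoint, star_star]
  rw [h, M.inner_rsmul, M.inner_rsmul, h]

theorem π_mul (a b : A) (ξ : M.carrier) : M.π (a * b) ξ = M.π a (M.π b ξ) := by
  rw [map_mul]; rfl

theorem norm_π_le_of_norm_le_one {a : A} (ha : ‖a‖ ≤ 1) (ξ : M.carrier) : ‖M.π a ξ‖ ≤ ‖ξ‖ := by
  obtain ⟨h, hh, hha⟩ := exists_one_sub_sq a ha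
  refine M.norm_le_of_inner_add (ζ := ξ - M.π h ξ) ?_
  rw [M.adjoint, ← M.π_mul, ← hha]
  simp only [M.inner_sub, M.inner_sub_left, M.adjoint, hh, map_add, map_sub, LinearMap.add_apply,
    LinearMap.sub_apply, M.inner_add, ← M.π_mul]
  abel

theorem norm_π_le (a : A) (ξ : M.carrier) : ‖M.π a ξ‖ ≤ ‖a‖ * ‖ξ‖ := by
  rcases eq_or_ne a 0 with rfl | ha
  · simp
  have hn : 0 < ‖a‖ := norm_pos_iff.2 ha
  have h1 := M.norm_π_le_of_norm_le_one (a := ((‖a‖⁻¹ : ℝ) : ℂ) • a)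
    (by rw [norm_smul]; simp [hn.ne']) ξ
  rw [map_smul, LinearMap.smul_apply, norm_smul, Complex.norm_real, norm_inv, norm_norm,
    inv_mul_le_iff₀ hn] at h1
  exact h1

theorem continuous_π_right (a : A) : Continuous (fun ξ => M.π a ξ) :=
  ((M.π a).mkContinuous ‖a‖ (M.norm_π_le a)).continuous

theorem continuous_π_left (ξ : M.carrier) : Continuous (fun a => M.π a ξ) := by
  let φ : A →ₗ[ℂ] M.carrier :=
    { toFun := fun a => M.π a ξ
      map_add' := fun a b => by rw [map_add]; rfl
      map_smul' := fun z a => by rw [map_smul]; rfl }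
  exact (φ.mkContinuous ‖ξ‖ (fun a => (M.norm_π_le a ξ).trans_eq (mul_comm _ _))).continuous

end HilbBimod

/-! ### Fields of fibres over a space with a basis of compact open sets -/

/-- A Hausdorff space whose compact open sets form a basis (a locally compact Boolean space). -/
class LocallyBooleanSpace (X : Type*) [TopologicalSpace X] : Prop extends T2Space X where
  exists_compactOpens : ∀ (x : X) (U : Set X), IsOpen U → x ∈ U →
    ∃ Y : TopologicalSpace.CompactOpens X, x ∈ Y ∧ (Y : Set X) ⊆ U

section CharFun

variable {X : Type*} [TopologicalSpace X]

theorem exists_compactOpens_superset [LocallyBooleanSpace X] {K : Set X} (hK : IsCompact K) :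
    ∃ Y : CompactOpens X, K ⊆ Y := by
  refine hK.induction_on (p := fun s => ∃ Y : CompactOpens X, s ⊆ Y) ⟨⊥, by simp⟩
    (fun s t hst ⟨Y, hY⟩ => ⟨Y, hst.trans hY⟩)
    (fun s t ⟨Y, hY⟩ ⟨Z, hZ⟩ => ⟨Y ⊔ Z, ?_⟩) (fun x _ => ?_)
  · rw [CompactOpens.coe_sup]; exact Set.union_subset_union hY hZ
  · obtain ⟨Y, hx, -⟩ := LocallyBooleanSpace.exists_compactOpens x Set.univ isOpen_univ trivial
    exact ⟨Y, mem_nhdsWithin_of_mem_nhds (Y.isOpen.mem_nhds hx), Y, subset_rfl⟩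

theorem norm_le_of_forall_apply {f : C₀(X, ℂ)} {C : ℝ} (hC : 0 ≤ C) (h : ∀ x, ‖f x‖ ≤ C) :
    ‖f‖ ≤ C := by
  rw [← ZeroAtInftyContinuousMap.norm_toBCF_eq_norm]
  exact (BoundedContinuousFunction.norm_le hC).2 h

variable [T2Space X]

/-- The characteristic function of a compact open set. -/
noncomputable def charFun (Y : CompactOpens X) : C₀(X, ℂ) where
  toFun := (Y : Set X).indicator 1
  continuous_toFun := continuous_one.indicator (by
    have hY : IsClopen (Y : Set X) := ⟨Y.isCompact.isClosed, Y.isOpen⟩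
    simp [hY.frontier_eq])
  zero_at_infty' := by
    refine tendsto_const_nhds.congr' ?_
    filter_upwards [Y.isCompact.compl_mem_cocompact] with x hx
    exact (Set.indicator_of_notMem hx _).symm

theorem charFun_of_mem {Y : CompactOpens X} {x : X} (hx : x ∈ Y) : charFun Y x = 1 :=
  Set.indicator_of_mem (s := (Y : Set X)) hx 1

theorem charFun_of_notMem {Y : CompactOpens X} {x : X} (hx : x ∉ Y) : charFun Y x = 0 :=
  Set.indicator_of_notMem (s := (Y : Set X)) hx 1

theorem charFun_mul_of_le {Y Z : CompactOpens X} (h : Y ≤ Z) :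
    charFun Y * charFun Z = charFun Y := by
  ext x
  rw [ZeroAtInftyContinuousMap.mul_apply]
  by_cases hx : x ∈ Y
  · rw [charFun_of_mem hx, charFun_of_mem (h hx), one_mul]
  · rw [charFun_of_notMem hx, zero_mul]

theorem charFun_mul_self (Y : CompactOpens X) : charFun Y * charFun Y = charFun Y :=
  charFun_mul_of_le le_rfl

theorem star_charFun (Y : CompactOpens X) : star (charFun Y) = charFun Y := by
  ext x
  rw [ZeroAtInftyContinuousMap.star_apply]
  by_cases hx : x ∈ Y
  · rw [charFun_of_mem hx, star_one]
  · rw [charFun_of_notMem hx, star_zero]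

theorem norm_charFun_le (Y : CompactOpens X) : ‖charFun Y‖ ≤ 1 := by
  refine norm_le_of_forall_apply zero_le_one fun x => ?_
  by_cases hx : x ∈ Y
  · simp [charFun_of_mem hx]
  · simp [charFun_of_notMem hx]

theorem charFun_sup (Y Z : CompactOpens X) :
    charFun (Y ⊔ Z) = charFun Y + charFun (Z \ Y) := by
  ext x
  have h1 : x ∈ Y ⊔ Z ↔ x ∈ Y ∨ x ∈ Z := by
    rw [← SetLike.mem_coe, CompactOpens.coe_sup]; rfl
  have h2 : x ∈ Z \ Y ↔ x ∈ Z ∧ x ∉ Y := by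
    rw [← SetLike.mem_coe, CompactOpens.coe_sdiff]; rfl
  rw [ZeroAtInftyContinuousMap.add_apply]
  by_cases hY : x ∈ Y
  · rw [charFun_of_mem (h1.2 (Or.inl hY)), charFun_of_mem hY,
      charFun_of_notMem (fun h => (h2.1 h).2 hY), add_zero]
  · by_cases hZ : x ∈ Z
    · rw [charFun_of_mem (h1.2 (Or.inr hZ)), charFun_of_notMem hY,
        charFun_of_mem (h2.2 ⟨hZ, hY⟩), zero_add]
    · rw [charFun_of_notMem (fun h => (h1.1 h).elim hY hZ), charFun_of_notMem hY,
        charFun_of_notMem (fun h => hZ (h2.1 h).1), zero_add]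

end CharFun

/-- A nondegenerate bounded action of `C₀(X)` on the normed space `E` with fibres `E ⧸ N x`, where
`N x` is the closure of `C₀(X \ {x}) E`. The norm is the maximum norm for the decompositions of `E`
that belong to projections of `C₀(X)`; this is what `C₀(X)`-algebras and Hilbert modules over them
have in common. -/
structure IsC0Mod {X : Type*} {E : Type*} [TopologicalSpace X] [NormedAddCommGroup E]
    [NormedSpace ℂ E] (N : X → Submodule ℂ E) (act : C₀(X, ℂ) →ₗ[ℂ] E →ₗ[ℂ] E) : Prop where
  act_mul : ∀ f g ξ, act (f * g) ξ = act f (act g ξ)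
  norm_act_le : ∀ f ξ, ‖act f ξ‖ ≤ ‖f‖ * ‖ξ‖
  dense : (Submodule.span ℂ {ζ | ∃ f ξ, act f ξ = ζ}).topologicalClosure = ⊤
  norm_le_max : ∀ p, p * p = p → star p = p → ∀ ξ, ‖ξ‖ ≤ max ‖act p ξ‖ ‖ξ - act p ξ‖
  null_eq : ∀ x, N x = (Submodule.span ℂ {ζ | ∃ f ξ, f x = 0 ∧ act f ξ = ζ}).topologicalClosure

namespace IsC0Mod

variable {X : Type*} {E : Type*} [TopologicalSpace X] [NormedAddCommGroup E]
    [NormedSpace ℂ E] {N : X → Submodule ℂ E} {act : C₀(X, ℂ) →ₗ[ℂ] E →ₗ[ℂ] E}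

section Basic

variable (h : IsC0Mod N act)
include h

theorem isClosed (x : X) : IsClosed (N x : Set E) := by
  rw [h.null_eq]; exact Submodule.isClosed_topologicalClosure _

theorem norm_mk_eq_zero {x : X} {ξ : E} : ‖(N x).mkQ ξ‖ = 0 ↔ ξ ∈ N x := by
  have : IsClosed ((N x).toAddSubgroup : Set E) := h.isClosed x
  exact QuotientAddGroup.norm_mk_eq_zero (S := (N x).toAddSubgroup) (m := ξ)

theorem act_mem {x : X} {f : C₀(X, ℂ)} (hf : f x = 0) (ξ : E) : act f ξ ∈ N x := by
  rw [h.null_eq]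
  exact Submodule.le_topologicalClosure _ (Submodule.subset_span ⟨f, ξ, hf, rfl⟩)

/-- A closed subspace that contains `C₀(X \ {x}) E` contains the kernel of the evaluation at `x`. -/
theorem null_le {x : X} {P : Submodule ℂ E} (hP : IsClosed (P : Set E))
    (h' : ∀ f ξ, f x = 0 → act f ξ ∈ P) : N x ≤ P := by
  rw [h.null_eq]
  refine Submodule.topologicalClosure_minimal _ (Submodule.span_le.2 ?_) hP
  rintro _ ⟨f, ξ, hf, rfl⟩
  exact h' f ξ hf

theorem mem_of_forall_act_mem {P : Submodule ℂ E} (hP : IsClosed (P : Set E))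
    (h' : ∀ f ξ, act f ξ ∈ P) (ξ : E) : ξ ∈ P := by
  have : (⊤ : Submodule ℂ E) ≤ P := by
    rw [← h.dense]
    refine Submodule.topologicalClosure_minimal _ (Submodule.span_le.2 ?_) hP
    rintro _ ⟨f, ξ, rfl⟩
    exact h' f ξ
  exact this trivial

theorem continuous_act (f : C₀(X, ℂ)) : Continuous (act f) :=
  ((act f).mkContinuous ‖f‖ (h.norm_act_le f)).continuous

/-- `(f ξ)_x = f(x) ξ_x`. -/
theorem act_sub_smul_mem (f : C₀(X, ℂ)) (x : X) (ξ : E) : act f ξ - f x • ξ ∈ N x := by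
  let P : Submodule ℂ E := (N x).comap (act f - f x • LinearMap.id)
  have hP : IsClosed (P : Set E) := by
    refine (h.isClosed x).preimage (f := fun ξ => act f ξ - f x • ξ) ?_
    exact (h.continuous_act f).sub (continuous_id.const_smul _)
  refine h.mem_of_forall_act_mem hP (fun g ζ => ?_) ξ
  change act f (act g ζ) - f x • act g ζ ∈ N x
  rw [← h.act_mul, ← LinearMap.smul_apply, ← map_smul, ← LinearMap.sub_apply, ← map_sub]
  exact h.act_mem (by simp) ζ

theorem act_mem_iff {f : C₀(X, ℂ)} {x : X} (hf : f x = 1) {ξ : E} : act f ξ ∈ N x ↔ ξ ∈ N x := by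
  have := h.act_sub_smul_mem f x ξ
  rw [hf, one_smul] at this
  exact ⟨fun h1 => by simpa using sub_mem h1 this, fun h1 => by simpa using add_mem this h1⟩

end Basic

omit [TopologicalSpace X] in
theorem norm_mk_le (x : X) (ξ : E) : ‖(N x).mkQ ξ‖ ≤ ‖ξ‖ :=
  Submodule.Quotient.norm_mk_le (N x) ξ

omit [TopologicalSpace X] in
theorem mk_eq_iff {x : X} {ξ η : E} : (N x).mkQ ξ = (N x).mkQ η ↔ ξ - η ∈ N x :=
  Submodule.Quotient.eq (N x)

section Boolean

variable [LocallyBooleanSpace X] (h : IsC0Mod N act)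
include h

theorem act_charFun_of_le {Y Z : CompactOpens X} (hYZ : Y ≤ Z) (ξ : E) :
    act (charFun Y) (act (charFun Z) ξ) = act (charFun Y) ξ := by
  rw [← h.act_mul, charFun_mul_of_le hYZ]

theorem norm_act_charFun_le (Y : CompactOpens X) (ξ : E) : ‖act (charFun Y) ξ‖ ≤ ‖ξ‖ :=
  (h.norm_act_le _ _).trans (mul_le_of_le_one_left (norm_nonneg _) (norm_charFun_le Y))

theorem norm_act_charFun_mono {Y Z : CompactOpens X} (hYZ : Y ≤ Z) (ξ : E) :
    ‖act (charFun Y) ξ‖ ≤ ‖act (charFun Z) ξ‖ := by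
  rw [← h.act_charFun_of_le hYZ]
  exact h.norm_act_charFun_le _ _

theorem act_charFun_mem {Y : CompactOpens X} {x : X} (hx : x ∉ Y) (ξ : E) :
    act (charFun Y) ξ ∈ N x :=
  h.act_mem (charFun_of_notMem hx) ξ

theorem act_charFun_sub_mem {Y : CompactOpens X} {x : X} (hx : x ∈ Y) (ξ : E) :
    act (charFun Y) ξ - ξ ∈ N x := by
  have := h.act_sub_smul_mem (charFun Y) x ξ
  rwa [charFun_of_mem hx, one_smul] at this

theorem norm_mk_act_charFun {Y : CompactOpens X} {x : X} (hx : x ∈ Y) (ξ : E) :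
    ‖(N x).mkQ (act (charFun Y) ξ)‖ = ‖(N x).mkQ ξ‖ :=
  congrArg _ (mk_eq_iff.2 (h.act_charFun_sub_mem hx ξ))

/-- An element with `ξ_x = 0` is small near `x`. -/
theorem exists_norm_act_le_of_mem {x : X} {ξ : E} (hξ : ξ ∈ N x) {ε : ℝ} (hε : 0 < ε) :
    ∃ Y : CompactOpens X, x ∈ Y ∧ ‖act (charFun Y) ξ‖ < ε := by
  have key : ∀ m ∈ Submodule.span ℂ {ζ | ∃ f ξ, f x = 0 ∧ act f ξ = ζ}, ∀ ε > 0,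
      ∃ Y : CompactOpens X, x ∈ Y ∧ ‖act (charFun Y) m‖ < ε := by
    intro m hm
    induction hm using Submodule.span_induction with
    | mem m hm =>
      obtain ⟨f, ζ, hf, rfl⟩ := hm
      intro ε hε
      obtain ⟨Y, hxY, hY⟩ := LocallyBooleanSpace.exists_compactOpens x
        {y | ‖f y‖ < ε / (‖ζ‖ + 1)} (isOpen_lt f.continuous.norm continuous_const)
        (by simp only [Set.mem_ofPred_eq, hf, norm_zero]; positivity)
      refine ⟨Y, hxY, ?_⟩
      have h1 : ‖charFun Y * f‖ ≤ ε / (‖ζ‖ + 1) := by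
        refine norm_le_of_forall_apply (by positivity) fun y => ?_
        rw [ZeroAtInftyContinuousMap.mul_apply]
        by_cases hy : y ∈ Y
        · rw [charFun_of_mem hy, one_mul]; exact (hY hy).le
        · rw [charFun_of_notMem hy, zero_mul, norm_zero]; positivity
      rw [← h.act_mul]
      calc _ ≤ ε / (‖ζ‖ + 1) * ‖ζ‖ := (h.norm_act_le _ _).trans (by gcongr)
        _ < ε := by
          rw [div_mul_eq_mul_div, div_lt_iff₀ (by positivity)]
          nlinarith [norm_nonneg ζ]
    | zero =>
      intro ε hε
      obtain ⟨Y, hxY, -⟩ := LocallyBooleanSpace.exists_compactOpens x Set.univ isOpen_univ trivial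
      exact ⟨Y, hxY, by simpa using hε⟩
    | add m n _ _ hm hn =>
      intro ε hε
      obtain ⟨Y, hxY, hY⟩ := hm (ε / 2) (half_pos hε)
      obtain ⟨Z, hxZ, hZ⟩ := hn (ε / 2) (half_pos hε)
      refine ⟨Y ⊓ Z, ?_, ?_⟩
      · rw [← SetLike.mem_coe, CompactOpens.coe_inf]; exact ⟨hxY, hxZ⟩
      · rw [map_add]
        have h1 := h.norm_act_charFun_mono (inf_le_left : Y ⊓ Z ≤ Y) m
        have h2 := h.norm_act_charFun_mono (inf_le_right : Y ⊓ Z ≤ Z) n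
        linarith [norm_add_le (act (charFun (Y ⊓ Z)) m) (act (charFun (Y ⊓ Z)) n)]
    | smul z m _ hm =>
      intro ε hε
      obtain ⟨Y, hxY, hY⟩ := hm (ε / (‖z‖ + 1)) (by positivity)
      refine ⟨Y, hxY, ?_⟩
      rw [map_smul, norm_smul]
      calc _ ≤ ‖z‖ * (ε / (‖z‖ + 1)) := by gcongr
        _ < ε := by
          rw [mul_div_assoc', div_lt_iff₀ (by positivity)]
          nlinarith [norm_nonneg z]
  rw [h.null_eq, ← SetLike.mem_coe, Submodule.topologicalClosure_coe, Metric.mem_closure_iff] at hξ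
  obtain ⟨m, hm, hξm⟩ := hξ (ε / 2) (half_pos hε)
  obtain ⟨Y, hxY, hY⟩ := key m hm (ε / 2) (half_pos hε)
  refine ⟨Y, hxY, ?_⟩
  have h1 := h.norm_act_charFun_le Y (ξ - m)
  rw [dist_eq_norm] at hξm
  have h2 : act (charFun Y) ξ = act (charFun Y) (ξ - m) + act (charFun Y) m := by
    rw [← map_add, sub_add_cancel]
  rw [h2]
  linarith [norm_add_le (act (charFun Y) (ξ - m)) (act (charFun Y) m)]

/-- The norm of a fibre is the infimum of the norms of the restrictions to neighbourhoods. -/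
theorem exists_norm_act_lt {x : X} {ξ : E} {ε : ℝ} (hξ : ‖(N x).mkQ ξ‖ < ε) :
    ∃ Y : CompactOpens X, x ∈ Y ∧ ‖act (charFun Y) ξ‖ < ε := by
  obtain ⟨ζ, hζ, hζε⟩ := (QuotientAddGroup.norm_lt_iff (S := (N x).toAddSubgroup)).1 hξ
  have hmem : ξ - ζ ∈ N x := by
    rw [← mk_eq_iff]; exact hζ.symm
  obtain ⟨Y, hxY, hY⟩ := h.exists_norm_act_le_of_mem hmem (sub_pos.2 hζε)
  refine ⟨Y, hxY, ?_⟩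
  have h2 : act (charFun Y) ξ = act (charFun Y) (ξ - ζ) + act (charFun Y) ζ := by
    rw [← map_add, sub_add_cancel]
  rw [h2]
  linarith [norm_add_le (act (charFun Y) (ξ - ζ)) (act (charFun Y) ζ),
    h.norm_act_charFun_le Y ζ]

/-- Every element is concentrated on a compact open set, up to `ε`. -/
theorem exists_norm_sub_act_lt (ξ : E) {ε : ℝ} (hε : 0 < ε) :
    ∃ K : CompactOpens X, ∀ L, K ≤ L → ‖ξ - act (charFun L) ξ‖ < ε := by
  have key : ∀ m ∈ Submodule.span ℂ {ζ | ∃ f ξ, act f ξ = ζ}, ∀ ε > 0,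
      ∃ K : CompactOpens X, ∀ L, K ≤ L → ‖m - act (charFun L) m‖ < ε := by
    intro m hm
    induction hm using Submodule.span_induction with
    | mem m hm =>
      obtain ⟨f, ζ, rfl⟩ := hm
      intro ε hε
      obtain ⟨C, hC, hCf⟩ := mem_cocompact.1
        ((zero_at_infty f).eventually (Metric.ball_mem_nhds 0 (ε := ε / (‖ζ‖ + 1)) (by positivity)))
      obtain ⟨K, hK⟩ := exists_compactOpens_superset hC
      refine ⟨K, fun L hL => ?_⟩
      have h1 : ‖f - charFun L * f‖ ≤ ε / (‖ζ‖ + 1) := by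
        refine norm_le_of_forall_apply (by positivity) fun y => ?_
        rw [ZeroAtInftyContinuousMap.sub_apply, ZeroAtInftyContinuousMap.mul_apply]
        by_cases hy : y ∈ L
        · rw [charFun_of_mem hy, one_mul, sub_self, norm_zero]; positivity
        · rw [charFun_of_notMem hy, zero_mul, sub_zero]
          have : f y ∈ Metric.ball 0 (ε / (‖ζ‖ + 1)) := hCf (fun hy' => hy (hL (hK hy')))
          exact (mem_ball_zero_iff.1 this).le
      rw [← h.act_mul, ← LinearMap.sub_apply, ← map_sub]
      calc _ ≤ ε / (‖ζ‖ + 1) * ‖ζ‖ := (h.norm_act_le _ _).trans (by gcongr)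
        _ < ε := by
          rw [div_mul_eq_mul_div, div_lt_iff₀ (by positivity)]
          nlinarith [norm_nonneg ζ]
    | zero =>
      intro ε hε
      exact ⟨⊥, fun L _ => by simpa using hε⟩
    | add m n _ _ hm hn =>
      intro ε hε
      obtain ⟨Y, hY⟩ := hm (ε / 2) (half_pos hε)
      obtain ⟨Z, hZ⟩ := hn (ε / 2) (half_pos hε)
      refine ⟨Y ⊔ Z, fun L hL => ?_⟩
      have h1 := hY L (le_sup_left.trans hL)
      have h2 := hZ L (le_sup_right.trans hL)
      rw [map_add, add_sub_add_comm]
      linarith [norm_add_le (m - act (charFun L) m) (n - act (charFun L) n)]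
    | smul z m _ hm =>
      intro ε hε
      obtain ⟨Y, hY⟩ := hm (ε / (‖z‖ + 1)) (by positivity)
      refine ⟨Y, fun L hL => ?_⟩
      rw [map_smul, ← smul_sub, norm_smul]
      calc _ ≤ ‖z‖ * (ε / (‖z‖ + 1)) := by gcongr; exact (hY L hL).le
        _ < ε := by
          rw [mul_div_assoc', div_lt_iff₀ (by positivity)]
          nlinarith [norm_nonneg z]
  have hξ : ξ ∈ (⊤ : Submodule ℂ E) := trivial
  rw [← h.dense, ← SetLike.mem_coe, Submodule.topologicalClosure_coe, Metric.mem_closure_iff] at hξ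
  obtain ⟨m, hm, hξm⟩ := hξ (ε / 3) (by positivity)
  obtain ⟨K, hK⟩ := key m hm (ε / 3) (by positivity)
  refine ⟨K, fun L hL => ?_⟩
  have h1 := h.norm_act_charFun_le L (ξ - m)
  rw [dist_eq_norm] at hξm
  have h2 : ξ - act (charFun L) ξ =
      ((ξ - m) - act (charFun L) (ξ - m)) + (m - act (charFun L) m) := by
    rw [map_sub]; abel
  rw [h2]
  linarith [norm_add_le ((ξ - m) - act (charFun L) (ξ - m)) (m - act (charFun L) m),
    norm_sub_le (ξ - m) (act (charFun L) (ξ - m)), hK L hL]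

theorem norm_act_sup_lt {Y Z : CompactOpens X} {ξ : E} {ε : ℝ} (hY : ‖act (charFun Y) ξ‖ < ε)
    (hZ : ‖act (charFun Z) ξ‖ < ε) : ‖act (charFun (Y ⊔ Z)) ξ‖ < ε := by
  refine (h.norm_le_max _ (charFun_mul_self Y) (star_charFun Y) _).trans_lt (max_lt ?_ ?_)
  · rwa [h.act_charFun_of_le le_sup_left]
  · rw [h.act_charFun_of_le le_sup_left, charFun_sup, map_add, LinearMap.add_apply,
      add_sub_cancel_left]
    exact (h.norm_act_charFun_mono sdiff_le ξ).trans_lt hZ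

/-- The norm is the supremum of the norms of the fibres. -/
theorem norm_le_of_forall {ξ : E} {C : ℝ} (hξ : ∀ x, ‖(N x).mkQ ξ‖ ≤ C) (hC : 0 ≤ C) :
    ‖ξ‖ ≤ C := by
  refine le_of_forall_pos_le_add fun ε hε => ?_
  -- up to `ε / 2`, `ξ` is concentrated on the compact set `K`, which is covered by finitely many
  -- compact open sets on which `ξ` has norm less than `C + ε / 2`
  obtain ⟨K, hK⟩ := h.exists_norm_sub_act_lt ξ (half_pos hε)
  obtain ⟨Y, hKY, hY⟩ : ∃ Y : CompactOpens X, (K : Set X) ⊆ Y ∧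
      ‖act (charFun Y) ξ‖ < C + ε / 2 := by
    refine K.isCompact.induction_on
      (p := fun s => ∃ Y : CompactOpens X, s ⊆ Y ∧ ‖act (charFun Y) ξ‖ < C + ε / 2)
      ⟨⊥, by simp, ?_⟩ (fun s t hst ⟨Y, hY, hY'⟩ => ⟨Y, hst.trans hY, hY'⟩)
      (fun s t ⟨Y, hY, hY'⟩ ⟨Z, hZ, hZ'⟩ => ⟨Y ⊔ Z, ?_, h.norm_act_sup_lt hY' hZ'⟩)
      (fun x _ => ?_)
    · have : charFun (⊥ : CompactOpens X) = 0 := by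
        ext x; exact charFun_of_notMem (by rw [← SetLike.mem_coe]; simp)
      rw [this]; simp; positivity
    · rw [CompactOpens.coe_sup]; exact Set.union_subset_union hY hZ
    · obtain ⟨Y, hxY, hY⟩ := h.exists_norm_act_lt ((hξ x).trans_lt (lt_add_of_pos_right C
        (half_pos hε)))
      exact ⟨Y, mem_nhdsWithin_of_mem_nhds (Y.isOpen.mem_nhds hxY), Y, subset_rfl, hY⟩
  have h1 := h.norm_act_charFun_mono (Y := K) (Z := Y) hKY ξ
  have h2 := norm_add_le (ξ - act (charFun K) ξ) (act (charFun K) ξ)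
  rw [sub_add_cancel] at h2
  linarith [hK K le_rfl]

/-- An element is determined by its classes in the fibres. -/
theorem eq_of_forall_sub_mem {ξ η : E} (hξ : ∀ x, ξ - η ∈ N x) : ξ = η := by
  rw [← sub_eq_zero, ← norm_le_zero_iff]
  exact h.norm_le_of_forall (fun x => (h.norm_mk_eq_zero.2 (hξ x)).le) le_rfl

/-- A field of fibre classes `(τ x)_x` which is locally approximable by elements of `E`, and
vanishes at infinity, is the field of an element of `E`. -/
theorem exists_forall_sub_mem [CompleteSpace E] (τ : X → E)
    (hloc : ∀ x₀, ∀ ε > 0, ∃ ξ : E, ∀ᶠ x in 𝓝 x₀, ‖(N x).mkQ (τ x - ξ)‖ < ε)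
    (hinf : ∀ ε > 0, ∃ K : Set X, IsCompact K ∧ ∀ x ∉ K, ‖(N x).mkQ (τ x)‖ < ε) :
    ∃ ξ : E, ∀ x, ξ - τ x ∈ N x := by
  have approx : ∀ ε > 0, ∃ ξ : E, ∀ x, ‖(N x).mkQ (τ x - ξ)‖ < ε := by
    intro ε hε
    obtain ⟨K, hK, hKτ⟩ := hinf ε hε
    -- approximations on `Y` and on `Z` are glued along the partition of `Y ⊔ Z` into `Y` and `Z \ Y`
    obtain ⟨Y, hKY, ξ, hξ⟩ : ∃ Y : CompactOpens X, K ⊆ Y ∧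
        ∃ ξ : E, ∀ x ∈ Y, ‖(N x).mkQ (τ x - ξ)‖ < ε := by
      refine hK.induction_on (p := fun s => ∃ Y : CompactOpens X, s ⊆ Y ∧
        ∃ ξ : E, ∀ x ∈ Y, ‖(N x).mkQ (τ x - ξ)‖ < ε) ⟨⊥, by simp, 0, ?_⟩
        (fun s t hst ⟨Y, hY, hY'⟩ => ⟨Y, hst.trans hY, hY'⟩)
        (fun s t ⟨Y, hY, ξ, hξ⟩ ⟨Z, hZ, ζ, hζ⟩ =>
          ⟨Y ⊔ Z, ?_, act (charFun Y) ξ + act (charFun (Z \ Y)) ζ, fun x hx => ?_⟩)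
        (fun x _ => ?_)
      · intro x hx; rw [← SetLike.mem_coe] at hx; simp at hx
      · rw [CompactOpens.coe_sup]; exact Set.union_subset_union hY hZ
      · have h2 : x ∈ Z \ Y ↔ x ∈ Z ∧ x ∉ Y := by
          rw [← SetLike.mem_coe, CompactOpens.coe_sdiff]; rfl
        rw [← SetLike.mem_coe, CompactOpens.coe_sup] at hx
        by_cases hxY : x ∈ Y
        · convert hξ x hxY using 2
          rw [mk_eq_iff]
          have := add_mem (h.act_charFun_sub_mem hxY ξ)
            (h.act_charFun_mem (fun hh => (h2.1 hh).2 hxY : x ∉ Z \ Y) ζ)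
          convert neg_mem this using 1
          abel
        · have hxZ : x ∈ Z := hx.resolve_left hxY
          convert hζ x hxZ using 2
          rw [mk_eq_iff]
          have := add_mem (h.act_charFun_mem hxY ξ)
            (h.act_charFun_sub_mem (h2.2 ⟨hxZ, hxY⟩) ζ)
          convert neg_mem this using 1
          abel
      · obtain ⟨ξ, hξ⟩ := hloc x ε hε
        obtain ⟨U, hU, hUo, hxU⟩ := eventually_nhds_iff.1 hξ
        obtain ⟨Y, hxY, hY⟩ := LocallyBooleanSpace.exists_compactOpens x U hUo hxU
        exact ⟨Y, mem_nhdsWithin_of_mem_nhds (Y.isOpen.mem_nhds hxY), Y, subset_rfl, ξ,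
          fun y hy => hU y (hY hy)⟩
    refine ⟨act (charFun Y) ξ, fun x => ?_⟩
    by_cases hx : x ∈ Y
    · convert hξ x hx using 2
      rw [mk_eq_iff]
      convert neg_mem (h.act_charFun_sub_mem hx ξ) using 1
      abel
    · convert hKτ x (fun hh => hx (hKY hh)) using 2
      rw [mk_eq_iff]
      convert neg_mem (h.act_charFun_mem hx ξ) using 1
      abel
  choose a ha using fun n : ℕ => approx (1 / ((n : ℝ) + 1)) Nat.one_div_pos_of_nat
  have hfib : ∀ n x, ‖(N x).mkQ (a n - τ x)‖ ≤ 1 / ((n : ℝ) + 1) := by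
    intro n x
    rw [← neg_sub, map_neg, norm_neg]
    exact (ha n x).le
  have hcauchy : CauchySeq a := by
    refine cauchySeq_of_le_tendsto_0 (fun n : ℕ => 2 * (1 / ((n : ℝ) + 1))) ?_ ?_
    · intro n m k hn hm
      rw [dist_eq_norm]
      refine h.norm_le_of_forall (fun x => ?_) (by positivity)
      have h1 : a n - a m = (a n - τ x) - (a m - τ x) := by abel
      rw [h1, map_sub]
      have h2 := (hfib n x).trans (Nat.one_div_le_one_div hn)
      have h3 := (hfib m x).trans (Nat.one_div_le_one_div hm)
      linarith [norm_sub_le ((N x).mkQ (a n - τ x)) ((N x).mkQ (a m - τ x))]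
    · simpa using tendsto_one_div_add_atTop_nhds_zero_nat.const_mul (2 : ℝ)
  obtain ⟨ξ, hξ⟩ := cauchySeq_tendsto_of_complete hcauchy
  refine ⟨ξ, fun x => ?_⟩
  rw [← h.norm_mk_eq_zero]
  refine le_antisymm (le_of_tendsto_of_tendsto' (b := atTop)
    (f := fun _ : ℕ => ‖(N x).mkQ (ξ - τ x)‖)
    (g := fun n => ‖ξ - a n‖ + 1 / ((n : ℝ) + 1)) tendsto_const_nhds ?_ ?_) (norm_nonneg _)
  · simpa using ((tendsto_const_nhds (x := ξ)).sub hξ).norm.add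
      tendsto_one_div_add_atTop_nhds_zero_nat
  · intro n
    have h1 : ξ - τ x = (ξ - a n) + (a n - τ x) := by abel
    rw [h1, map_add]
    linarith [norm_add_le ((N x).mkQ (ξ - a n)) ((N x).mkQ (a n - τ x)),
      norm_mk_le (N := N) x (ξ - a n), hfib n x]

end Boolean

end IsC0Mod

/-! ### The fibres of `C₀(X)`-algebras and Hilbert modules -/

theorem IsC0Mod.map_mem {X : Type*} [TopologicalSpace X] {E E' : Type*} [NormedAddCommGroup E]
    [NormedSpace ℂ E] [NormedAddCommGroup E'] [NormedSpace ℂ E'] {N : X → Submodule ℂ E}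
    {N' : X → Submodule ℂ E'} {act : C₀(X, ℂ) →ₗ[ℂ] E →ₗ[ℂ] E}
    {act' : C₀(X, ℂ) →ₗ[ℂ] E' →ₗ[ℂ] E'} (h : IsC0Mod N act) (h' : IsC0Mod N' act') {x : X}
    (T : E →ₗ[ℂ] E') (hT : Continuous T) (hN : ∀ f ξ, f x = 0 → T (act f ξ) ∈ N' x)
    {ξ : E} (hξ : ξ ∈ N x) : T ξ ∈ N' x :=
  h.null_le (P := (N' x).comap T) ((h'.isClosed x).preimage hT) hN hξ

theorem norm_star_zeroAtInfty {X : Type*} [TopologicalSpace X] (f : C₀(X, ℂ)) :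
    ‖star f‖ = ‖f‖ :=
  norm_star f

namespace C0Alg

variable {X : Type u} [TopologicalSpace X] (A : C0Alg.{u, v} X)

theorem smul_mul_smul (f g : C₀(X, ℂ)) (a b : A) :
    A.smul f a * A.smul g b = A.smul (f * g) (a * b) := by
  rw [← A.smul_mul, ← A.mul_smul_comm, ← A.mul_smul]

/-- If `‖f‖ ≤ 1` then `(f a)⋆(f a) + (a - h a)⋆(a - h a) = a⋆a`, where `(1 - h)² = 1 - |f|²`. -/
theorem norm_smul_le_of_norm_le_one {f : C₀(X, ℂ)} (hf : ‖f‖ ≤ 1) (a : A) :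
    ‖A.smul f a‖ ≤ ‖a‖ := by
  obtain ⟨h, hh, hhf⟩ := exists_one_sub_sq f hf
  refine norm_le_of_star_mul_self_add' _ (a - A.smul h a) _ ?_
  rw [A.star_smul, A.smul_mul_smul, ← hhf]
  simp only [star_sub, A.star_smul, hh, mul_sub, sub_mul, A.smul_mul_smul, map_add, map_sub,
    LinearMap.add_apply, LinearMap.sub_apply]
  rw [← A.smul_mul, ← A.mul_smul_comm]
  abel

theorem norm_smul_le (f : C₀(X, ℂ)) (a : A) : ‖A.smul f a‖ ≤ ‖f‖ * ‖a‖ := by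
  rcases eq_or_ne f 0 with rfl | hf
  · simp
  have hn : 0 < ‖f‖ := norm_pos_iff.2 hf
  have h1 := A.norm_smul_le_of_norm_le_one (f := ((‖f‖⁻¹ : ℝ) : ℂ) • f)
    (by rw [norm_smul]; simp [hn.ne']) a
  rw [map_smul, LinearMap.smul_apply, norm_smul, Complex.norm_real, norm_inv, norm_norm,
    inv_mul_le_iff₀ hn] at h1
  exact h1

/-- The direct sum decomposition of `A` by a projection of `C₀(X)`. -/
noncomputable def splitHom (p : C₀(X, ℂ)) (hp : p * p = p) (hp' : star p = p) : A →⋆ₙₐ[ℂ] A × A where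
  toFun a := (A.smul p a, a - A.smul p a)
  map_smul' z a := by simp [smul_sub]
  map_zero' := by simp
  map_add' a b := by simp [add_sub_add_comm]
  map_mul' a b := by
    ext
    · simp [A.smul_mul_smul, hp]
    · simp only [Prod.snd_mul, sub_mul, mul_sub, A.smul_mul_smul, hp]
      rw [← A.smul_mul, ← A.mul_smul_comm]
      abel
  map_star' a := by
    ext
    · simp [A.star_smul, hp']
    · simp [A.star_smul, hp']

theorem isC0Mod : IsC0Mod A.null A.smul where
  act_mul := A.mul_smul
  norm_act_le := A.norm_smul_le
  dense := A.nondegenerate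
  norm_le_max p hp hp' a := by
    have hinj : Function.Injective (A.splitHom p hp hp') := by
      intro a b hab
      have h1 : A.smul p a = A.smul p b := congrArg Prod.fst hab
      have h2 : a - A.smul p a = b - A.smul p b := congrArg Prod.snd hab
      rw [h1] at h2
      exact sub_left_injective h2
    rw [← NonUnitalStarAlgHom.norm_map (A.splitHom p hp hp') hinj a]
    exact le_rfl
  null_eq _ := rfl

theorem continuous_smul (f : C₀(X, ℂ)) : Continuous (A.smul f) := A.isC0Mod.continuous_act f

theorem mul_mem_right {x : X} {a : A} (ha : a ∈ A.null x) (b : A) : a * b ∈ A.null x :=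
  A.isC0Mod.map_mem A.isC0Mod (LinearMap.mulRight ℂ b)
    (continuous_id.mul continuous_const)
    (fun f ξ hf => by
      rw [LinearMap.mulRight_apply, ← A.smul_mul]; exact A.isC0Mod.act_mem hf _) ha

theorem mul_mem_left {x : X} {a : A} (ha : a ∈ A.null x) (b : A) : b * a ∈ A.null x :=
  A.isC0Mod.map_mem A.isC0Mod (LinearMap.mulLeft ℂ b)
    (continuous_const.mul continuous_id)
    (fun f ξ hf => by
      rw [LinearMap.mulLeft_apply, ← A.mul_smul_comm]; exact A.isC0Mod.act_mem hf _) ha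

theorem star_mem {x : X} {a : A} (ha : a ∈ A.null x) : star a ∈ A.null x := by
  let P : Submodule ℂ A :=
    { carrier := {a | star a ∈ A.null x}
      add_mem' := fun {a b} h1 h2 => by
        change star (a + b) ∈ A.null x
        rw [star_add]; exact add_mem h1 h2
      zero_mem' := by
        change star (0 : A) ∈ A.null x
        rw [star_zero]; exact zero_mem _
      smul_mem' := fun z a h => by
        change star (z • a) ∈ A.null x
        rw [StarModule.star_smul]; exact Submodule.smul_mem _ _ h }
  refine A.isC0Mod.null_le (P := P) ((A.isC0Mod.isClosed x).preimage continuous_star)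
    (fun f a hf => ?_) ha
  change star (A.smul f a) ∈ A.null x
  rw [A.star_smul]
  exact A.isC0Mod.act_mem (by rw [ZeroAtInftyContinuousMap.star_apply, hf, star_zero]) _

theorem mul_sub_mul_mem {x : X} {a a' b b' : A} (ha : a - a' ∈ A.null x) (hb : b - b' ∈ A.null x) :
    a * b - a' * b' ∈ A.null x := by
  have := add_mem (A.mul_mem_right ha b) (A.mul_mem_left hb a')
  rw [sub_mul, mul_sub] at this
  simpa using this

/-- Multiplication on the fibre `A_x`. -/
noncomputable def fibreMul (x : X) :
    (A ⧸ A.null x) →ₗ[ℂ] (A ⧸ A.null x) →ₗ[ℂ] (A ⧸ A.null x) :=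
  (A.null x).liftQ
    { toFun := fun a => (A.null x).mapQ (A.null x) (LinearMap.mulLeft ℂ a)
        (fun _ hb => A.mul_mem_left hb a)
      map_add' := fun a b => by
        ext c
        exact congrArg (A.null x).mkQ (add_mul a b c)
      map_smul' := fun z a => by
        ext c
        exact congrArg (A.null x).mkQ (smul_mul_assoc z a c) }
    (fun a ha => by
      ext c
      exact (Submodule.Quotient.mk_eq_zero _).2 (A.mul_mem_right ha c))

/-- The involution on the fibre `A_x`. -/
noncomputable def fibreStar (x : X) : (A ⧸ A.null x) →ₗ⋆[ℂ] (A ⧸ A.null x) :=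
  (A.null x).mapQ (A.null x) (starLinearEquiv ℂ (A := A)).toLinearMap (fun _ ha => A.star_mem ha)

variable [LocallyBooleanSpace X]

/-- The fibre `A_x` is a C⋆-algebra for the quotient norm. The C⋆-identity holds since the
quotient norm is the infimum of the norms of the restrictions to compact open neighbourhoods. -/
noncomputable abbrev fibreCStarAlgebra (x : X) : NonUnitalCStarAlgebra (A ⧸ A.null x) :=
  have : IsClosed (A.null x : Set A) := A.isC0Mod.isClosed x
  letI ng : NormedAddCommGroup (A ⧸ A.null x) := Submodule.Quotient.normedAddCommGroup (A.null x)
  letI ring : NonUnitalRing (A ⧸ A.null x) :=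
    { (inferInstance : AddCommGroup (A ⧸ A.null x)) with
      mul := fun a b => A.fibreMul x a b
      left_distrib := fun a b c => map_add (A.fibreMul x a) b c
      right_distrib := fun a b c => LinearMap.map_add₂ (A.fibreMul x) a b c
      zero_mul := fun a => LinearMap.map_zero₂ (A.fibreMul x) a
      mul_zero := fun a => map_zero (A.fibreMul x a)
      mul_assoc := by
        intro a b c
        obtain ⟨a, rfl⟩ := (A.null x).mkQ_surjective a
        obtain ⟨b, rfl⟩ := (A.null x).mkQ_surjective b
        obtain ⟨c, rfl⟩ := (A.null x).mkQ_surjective c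
        exact congrArg (A.null x).mkQ (mul_assoc a b c) }
  letI nring : NonUnitalNormedRing (A ⧸ A.null x) :=
    { ng, ring with
      norm_mul_le := by
        intro a b
        have key : ∀ (c : A ⧸ A.null x) (ε : ℝ), 0 < ε →
            ∃ d, (A.null x).mkQ d = c ∧ ‖d‖ < ‖c‖ + ε := fun c ε hε =>
          (QuotientAddGroup.norm_lt_iff (S := (A.null x).toAddSubgroup)).1
            (lt_add_of_pos_right _ hε)
        have hle : ∀ ε > 0, ‖A.fibreMul x a b‖ ≤ (‖a‖ + ε) * (‖b‖ + ε) := by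
          intro ε hε
          obtain ⟨c, rfl, hc⟩ := key a ε hε
          obtain ⟨d, rfl, hd⟩ := key b ε hε
          calc _ ≤ ‖c * d‖ := IsC0Mod.norm_mk_le x (c * d)
            _ ≤ ‖c‖ * ‖d‖ := norm_mul_le c d
            _ ≤ _ := by gcongr
        have hlim : Tendsto (fun ε : ℝ => (‖a‖ + ε) * (‖b‖ + ε)) (𝓝[>] 0) (𝓝 (‖a‖ * ‖b‖)) := by
          have : Continuous fun ε : ℝ => (‖a‖ + ε) * (‖b‖ + ε) := by fun_prop
          simpa using (this.tendsto 0).mono_left nhdsWithin_le_nhds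
        exact ge_of_tendsto hlim (eventually_mem_nhdsWithin.mono hle) }
  letI sr : StarRing (A ⧸ A.null x) :=
    { star := fun a => A.fibreStar x a
      star_involutive := by
        intro a
        obtain ⟨a, rfl⟩ := (A.null x).mkQ_surjective a
        exact congrArg (A.null x).mkQ (star_star a)
      star_mul := by
        intro a b
        obtain ⟨a, rfl⟩ := (A.null x).mkQ_surjective a
        obtain ⟨b, rfl⟩ := (A.null x).mkQ_surjective b
        exact congrArg (A.null x).mkQ (star_mul a b)
      star_add := fun a b => map_add (A.fibreStar x) a b }
  { nring, sr, (Submodule.Quotient.normedSpace (A.null x) ℂ : NormedSpace ℂ (A ⧸ A.null x)) with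
    complete := (inferInstance : CompleteSpace (A ⧸ A.null x)).complete
    norm_mul_self_le := by
      intro a
      obtain ⟨a, rfl⟩ := (A.null x).mkQ_surjective a
      change ‖(A.null x).mkQ a‖ * ‖(A.null x).mkQ a‖ ≤ ‖(A.null x).mkQ (star a * a)‖
      refine le_of_forall_gt_imp_ge_of_dense fun r hr => ?_
      obtain ⟨Y, hxY, hY⟩ := A.isC0Mod.exists_norm_act_lt hr
      have h1 : A.smul (charFun Y) (star a * a)
          = star (A.smul (charFun Y) a) * A.smul (charFun Y) a := by
        rw [A.star_smul, A.smul_mul_smul, star_charFun, charFun_mul_self]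
      rw [h1, CStarRing.norm_star_mul_self] at hY
      have h2 : ‖(A.null x).mkQ a‖ ≤ ‖A.smul (charFun Y) a‖ := by
        rw [← A.isC0Mod.norm_mk_act_charFun hxY]; exact IsC0Mod.norm_mk_le _ _
      nlinarith [norm_nonneg ((A.null x).mkQ a)]
    smul_assoc := fun z a b => LinearMap.map_smul₂ (A.fibreMul x) z a b
    smul_comm := fun z a b => (map_smul (A.fibreMul x a) z b).symm
    star_smul := fun z a => map_smulₛₗ (A.fibreStar x) z a }

end C0Alg

namespace HilbMod

variable {X : Type u} [TopologicalSpace X] {B : C0Alg.{u, v} X} (E : HilbMod B)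

theorem norm_rsmul_smul_le (f : C₀(X, ℂ)) (ξ : E.carrier) (b : B) :
    ‖E.rsmul ξ (B.smul f b)‖ ≤ ‖f‖ * ‖E.rsmul ξ b‖ := by
  have h1 : ‖E.rsmul ξ (B.smul f b)‖ ^ 2 ≤ (‖f‖ * ‖E.rsmul ξ b‖) ^ 2 := by
    rw [mul_pow, E.norm_sq, E.norm_sq, E.inner_rsmul, E.inner_rsmul, E.inner_rsmul_left,
      E.inner_rsmul_left, B.star_smul, ← B.smul_mul, B.smul_mul_smul]
    refine (B.norm_smul_le _ _).trans ?_
    gcongr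
    exact (norm_mul_le _ _).trans_eq (by rw [norm_star_zeroAtInfty, sq])
  exact abs_le_of_sq_le_sq' h1 (by positivity) |>.2

/-- The vector `f ξ`, as the limit of the vectors `ξ (f b)` along an approximate unit. -/
theorem exists_act (f : C₀(X, ℂ)) (ξ : E.carrier) :
    ∃ ζ, ∀ η, E.inner η ζ = B.smul f (E.inner η ξ) := by
  choose b hb using fun n : ℕ =>
    E.exists_norm_sub_rsmul_lt ξ (ε := 1 / ((n : ℝ) + 1)) Nat.one_div_pos_of_nat
  have hlim : Tendsto (fun n => E.rsmul ξ (b n)) atTop (𝓝 ξ) := by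
    rw [tendsto_iff_norm_sub_tendsto_zero]
    refine squeeze_zero (fun _ => norm_nonneg _) (fun n => ?_)
      tendsto_one_div_add_atTop_nhds_zero_nat
    rw [norm_sub_rev]; exact (hb n).le
  have hc : CauchySeq fun n => E.rsmul ξ (B.smul f (b n)) := by
    have h1 := hlim.cauchySeq
    rw [Metric.cauchySeq_iff] at h1 ⊢
    intro ε hε
    obtain ⟨n, hn⟩ := h1 (ε / (‖f‖ + 1)) (by positivity)
    refine ⟨n, fun m hm k hk => ?_⟩
    have h2 := hn m hm k hk
    rw [dist_eq_norm, ← map_sub] at h2 ⊢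
    rw [← map_sub]
    refine (E.norm_rsmul_smul_le f ξ _).trans_lt ?_
    rw [lt_div_iff₀ (by positivity)] at h2
    nlinarith [norm_nonneg (E.rsmul ξ (b m - b k))]
  obtain ⟨ζ, hζ⟩ := cauchySeq_tendsto_of_complete hc
  refine ⟨ζ, fun η => tendsto_nhds_unique
    (((E.continuous_inner_right η).tendsto ζ).comp hζ) ?_⟩
  have h3 := ((B.continuous_smul f).tendsto _).comp (((E.continuous_inner_right η).tendsto ξ).comp
    hlim)
  refine h3.congr fun n => ?_
  simp only [Function.comp_apply, E.inner_rsmul, B.mul_smul_comm]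

/-- The action of `C₀(X)` on a Hilbert module, determined by `⟨η, f ξ⟩ = f ⟨η, ξ⟩`. -/
noncomputable def act : C₀(X, ℂ) →ₗ[ℂ] E.carrier →ₗ[ℂ] E.carrier :=
  LinearMap.mk₂ ℂ (fun f ξ => (E.exists_act f ξ).choose)
    (fun f g ξ => E.eq_of_forall_inner fun ζ => by
      rw [E.inner_add, (E.exists_act _ ξ).choose_spec, (E.exists_act _ ξ).choose_spec,
        (E.exists_act _ ξ).choose_spec, map_add, LinearMap.add_apply])
    (fun z f ξ => E.eq_of_forall_inner fun ζ => by
      rw [E.inner_smul, (E.exists_act _ ξ).choose_spec, (E.exists_act _ ξ).choose_spec, map_smul,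
        LinearMap.smul_apply])
    (fun f ξ η => E.eq_of_forall_inner fun ζ => by
      rw [E.inner_add, (E.exists_act f _).choose_spec, (E.exists_act f _).choose_spec,
        (E.exists_act f _).choose_spec, E.inner_add, map_add])
    (fun z f ξ => E.eq_of_forall_inner fun ζ => by
      rw [E.inner_smul, (E.exists_act f _).choose_spec, (E.exists_act f _).choose_spec,
        E.inner_smul, map_smul])

theorem inner_act (f : C₀(X, ℂ)) (ξ η : E.carrier) :
    E.inner η (E.act f ξ) = B.smul f (E.inner η ξ) :=
  (E.exists_act f ξ).choose_spec η

theorem inner_act_left (f : C₀(X, ℂ)) (ξ η : E.carrier) :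
    E.inner (E.act f ξ) η = B.smul (star f) (E.inner ξ η) := by
  rw [← E.star_inner, E.inner_act, B.star_smul, E.star_inner]

theorem rsmul_smul (f : C₀(X, ℂ)) (ξ : E.carrier) (b : B) :
    E.rsmul ξ (B.smul f b) = E.act f (E.rsmul ξ b) :=
  E.eq_of_forall_inner fun ζ => by
    rw [E.inner_act, E.inner_rsmul, E.inner_rsmul, B.mul_smul_comm]

theorem act_rsmul (f : C₀(X, ℂ)) (ξ : E.carrier) (b : B) :
    E.rsmul (E.act f ξ) b = E.act f (E.rsmul ξ b) :=
  E.eq_of_forall_inner fun ζ => by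
    rw [E.inner_act, E.inner_rsmul, E.inner_rsmul, E.inner_act, B.smul_mul]

theorem norm_act_le (f : C₀(X, ℂ)) (ξ : E.carrier) : ‖E.act f ξ‖ ≤ ‖f‖ * ‖ξ‖ := by
  have h1 : ‖E.act f ξ‖ ^ 2 ≤ (‖f‖ * ‖ξ‖) ^ 2 := by
    rw [mul_pow, E.norm_sq, E.norm_sq, E.inner_act, E.inner_act_left, ← B.mul_smul]
    refine (B.norm_smul_le _ _).trans ?_
    gcongr
    exact (norm_mul_le _ _).trans_eq (by rw [norm_star_zeroAtInfty, sq])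
  exact abs_le_of_sq_le_sq' h1 (by positivity) |>.2

theorem isC0Mod : IsC0Mod E.null E.act where
  act_mul f g ξ := E.eq_of_forall_inner fun ζ => by simp only [E.inner_act, B.mul_smul]
  norm_act_le := E.norm_act_le
  dense := by
    refine eq_top_iff.2 fun ξ _ => ?_
    refine E.mem_of_forall_rsmul_mem (ξ := ξ) (Submodule.isClosed_topologicalClosure _) fun b => ?_
    let P : Submodule ℂ B := (Submodule.topologicalClosure
      (Submodule.span ℂ {ζ | ∃ f ξ, E.act f ξ = ζ})).comap (E.rsmul ξ)
    refine B.isC0Mod.mem_of_forall_act_mem (P := P) ((Submodule.isClosed_topologicalClosure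
      _).preimage (E.continuous_rsmul_right ξ)) (fun f c => ?_) b
    change E.rsmul ξ (B.smul f c) ∈ Submodule.topologicalClosure _
    rw [E.rsmul_smul]
    exact Submodule.le_topologicalClosure _ (Submodule.subset_span ⟨f, _, rfl⟩)
  norm_le_max p hp hp' ξ := by
    have h1 := B.isC0Mod.norm_le_max p hp hp' (E.inner ξ ξ)
    have h2 : B.smul p (E.inner ξ ξ) = E.inner (E.act p ξ) (E.act p ξ) := by
      rw [E.inner_act, E.inner_act_left, ← B.mul_smul, hp', hp]
    have h3 : E.inner ξ ξ - B.smul p (E.inner ξ ξ)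
        = E.inner (ξ - E.act p ξ) (ξ - E.act p ξ) := by
      simp only [E.inner_sub, E.inner_sub_left, E.inner_act, E.inner_act_left, ← B.mul_smul, hp',
        hp]
      abel
    rw [h3, h2, ← E.norm_sq, ← E.norm_sq, ← E.norm_sq] at h1
    rcases le_max_iff.1 h1 with h | h
    · exact le_max_of_le_left (abs_le_of_sq_le_sq' h (norm_nonneg _)).2
    · exact le_max_of_le_right (abs_le_of_sq_le_sq' h (norm_nonneg _)).2
  null_eq x := by
    apply le_antisymm
    · refine Submodule.topologicalClosure_mono (Submodule.span_le.2 ?_)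
      rintro _ ⟨f, ξ, b, hf, rfl⟩
      rw [E.rsmul_smul]
      exact Submodule.subset_span ⟨f, _, hf, rfl⟩
    · refine Submodule.topologicalClosure_minimal _ (Submodule.span_le.2 ?_)
        (Submodule.isClosed_topologicalClosure _)
      rintro _ ⟨f, ξ, hf, rfl⟩
      refine E.mem_of_forall_rsmul_mem (Submodule.isClosed_topologicalClosure _) fun b => ?_
      rw [E.act_rsmul, ← E.rsmul_smul]
      exact Submodule.le_topologicalClosure _ (Submodule.subset_span ⟨f, ξ, b, hf, rfl⟩)

variable {x : X}

theorem rsmul_mem_left {ξ : E.carrier} (hξ : ξ ∈ E.null x) (b : B) : E.rsmul ξ b ∈ E.null x :=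
  E.isC0Mod.map_mem E.isC0Mod (E.rsmul.flip b) (E.continuous_rsmul_left b)
    (fun f ζ hf => by
      rw [LinearMap.flip_apply, E.act_rsmul]; exact E.isC0Mod.act_mem hf _) hξ

theorem rsmul_mem_right (ξ : E.carrier) {b : B} (hb : b ∈ B.null x) : E.rsmul ξ b ∈ E.null x :=
  B.isC0Mod.map_mem E.isC0Mod (E.rsmul ξ) (E.continuous_rsmul_right ξ)
    (fun f ζ hf => by rw [E.rsmul_smul]; exact E.isC0Mod.act_mem hf _) hb

theorem inner_mem_right (ξ : E.carrier) {η : E.carrier} (hη : η ∈ E.null x) :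
    E.inner ξ η ∈ B.null x :=
  E.isC0Mod.map_mem B.isC0Mod (E.innerₗ ξ) (E.continuous_inner_right ξ)
    (fun f ζ hf => by
      change E.inner ξ (E.act f ζ) ∈ _
      rw [E.inner_act]; exact B.isC0Mod.act_mem hf _) hη

theorem inner_mem_left {ξ : E.carrier} (hξ : ξ ∈ E.null x) (η : E.carrier) :
    E.inner ξ η ∈ B.null x := by
  rw [← E.star_inner]; exact B.star_mem (E.inner_mem_right η hξ)

theorem mem_null_of_forall_rsmul {ξ : E.carrier} (h : ∀ b, E.rsmul ξ b ∈ E.null x) :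
    ξ ∈ E.null x :=
  E.mem_of_forall_rsmul_mem (E.isC0Mod.isClosed x) h

theorem rsmul_sub_rsmul_mem {ξ ξ' : E.carrier} {b b' : B} (hξ : ξ - ξ' ∈ E.null x)
    (hb : b - b' ∈ B.null x) : E.rsmul ξ b - E.rsmul ξ' b' ∈ E.null x := by
  have := add_mem (E.rsmul_mem_left hξ b) (E.rsmul_mem_right ξ' hb)
  rw [map_sub, map_sub, LinearMap.sub_apply] at this
  simpa using this

theorem inner_sub_inner_mem {ξ ξ' η η' : E.carrier} (hξ : ξ - ξ' ∈ E.null x)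
    (hη : η - η' ∈ E.null x) : E.inner ξ η - E.inner ξ' η' ∈ B.null x := by
  have := add_mem (E.inner_mem_left hξ η) (E.inner_mem_right ξ' hη)
  rw [E.inner_sub_left, E.inner_sub] at this
  simpa using this

/-- `‖ξ_x‖² = ‖⟨ξ, ξ⟩_x‖` -/
theorem norm_mk_sq [LocallyBooleanSpace X] (x : X) (ξ : E.carrier) :
    ‖(E.null x).mkQ ξ‖ ^ 2 = ‖(B.null x).mkQ (E.inner ξ ξ)‖ := by
  have hY : ∀ Y : CompactOpens X, ‖B.smul (charFun Y) (E.inner ξ ξ)‖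
      = ‖E.act (charFun Y) ξ‖ ^ 2 := by
    intro Y
    rw [E.norm_sq, E.inner_act, E.inner_act_left, ← B.mul_smul, star_charFun, charFun_mul_self]
  apply le_antisymm
  · refine le_of_forall_gt_imp_ge_of_dense fun r hr => ?_
    obtain ⟨Y, hxY, h1⟩ := B.isC0Mod.exists_norm_act_lt hr
    rw [hY] at h1
    rw [← E.isC0Mod.norm_mk_act_charFun hxY]
    refine le_trans ?_ h1.le
    gcongr
    exact IsC0Mod.norm_mk_le _ _
  · refine le_of_forall_gt_imp_ge_of_dense fun r hr => ?_
    have hr' : ‖(E.null x).mkQ ξ‖ < √r := Real.lt_sqrt_of_sq_lt hr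
    obtain ⟨Y, hxY, h1⟩ := E.isC0Mod.exists_norm_act_lt hr'
    rw [← B.isC0Mod.norm_mk_act_charFun hxY]
    refine (IsC0Mod.norm_mk_le _ _).trans ?_
    rw [hY]
    exact (Real.lt_sqrt (norm_nonneg _)).1 h1 |>.le

end HilbMod

namespace HilbBimod

variable {X : Type u} [TopologicalSpace X] {A B : C0Alg.{u, v} X} (M : HilbBimod A B) {x : X}

theorem π_act (a : A) (f : C₀(X, ℂ)) (ξ : M.carrier) :
    M.π a (M.act f ξ) = M.act f (M.π a ξ) :=
  M.eq_of_forall_inner fun ζ => by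
    have h : ∀ η, M.inner ζ (M.π a η) = M.inner (M.π (star a) ζ) η := by
      intro η; rw [M.adjoint, star_star]
    rw [h, M.inner_act, M.inner_act, h]

theorem π_mem_right (a : A) {ξ : M.carrier} (hξ : ξ ∈ M.null x) : M.π a ξ ∈ M.null x :=
  M.isC0Mod.map_mem M.isC0Mod (M.π a) (M.continuous_π_right a)
    (fun f ζ hf => by rw [M.π_act]; exact M.isC0Mod.act_mem hf _) hξ

/-- `π` as a bilinear map. -/
def πₗ : A →ₗ[ℂ] M.carrier →ₗ[ℂ] M.carrier where
  toFun := M.π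
  map_add' := map_add M.π
  map_smul' := map_smul M.π

end HilbBimod

/-! ### Slices and projections -/

namespace TopGroupoid

variable {G : Type w} {X : Type u} [TopologicalSpace G] [TopologicalSpace X]
  (𝒢 : TopGroupoid G X)

theorem mul_congr {g g' h h' : G} (hg : g = g') (hh : h = h') (p : 𝒢.src g = 𝒢.rng h)
    (p' : 𝒢.src g' = 𝒢.rng h') : 𝒢.mul g h p = 𝒢.mul g' h' p' := by
  subst hg hh; rfl

theorem eq_unit_of_mul_eq_left {g h : G} (p : 𝒢.src g = 𝒢.rng h) (e : 𝒢.mul g h p = g) :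
    h = 𝒢.unit (𝒢.src g) := by
  calc h = 𝒢.mul (𝒢.unit (𝒢.rng h)) h (𝒢.src_unit _) := (𝒢.unit_mul h).symm
    _ = 𝒢.mul (𝒢.mul (𝒢.inv g) g (𝒢.src_inv g)) h ((𝒢.src_mul _ _ _).trans p) :=
      𝒢.mul_congr ((congrArg 𝒢.unit p.symm).trans (𝒢.inv_mul g).symm) rfl _ _
    _ = 𝒢.mul (𝒢.inv g) (𝒢.mul g h p) ((𝒢.src_inv g).trans (𝒢.rng_mul g h p).symm) :=
      𝒢.mul_assoc _ _ _ _ _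
    _ = 𝒢.mul (𝒢.inv g) g (𝒢.src_inv g) := 𝒢.mul_congr rfl e _ _
    _ = 𝒢.unit (𝒢.src g) := 𝒢.inv_mul g

theorem unit_injective : Function.Injective 𝒢.unit := fun x y h => by
  rw [← 𝒢.src_unit x, h, 𝒢.src_unit]

variable {𝒢}

theorem IsSlice.rng_inj {O : Set G} (hO : 𝒢.IsSlice O) {g h : G} (hg : g ∈ O) (hh : h ∈ O)
    (e : 𝒢.rng g = 𝒢.rng h) : g = h :=
  congrArg Subtype.val (hO.2.2.injective (a₁ := ⟨g, hg⟩) (a₂ := ⟨h, hh⟩) e)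

theorem IsSlice.src_inj {O : Set G} (hO : 𝒢.IsSlice O) {g h : G} (hg : g ∈ O) (hh : h ∈ O)
    (e : 𝒢.src g = 𝒢.src h) : g = h :=
  congrArg Subtype.val (hO.2.1.injective (a₁ := ⟨g, hg⟩) (a₂ := ⟨h, hh⟩) e)

/-- An idempotent slice consists of units. -/
theorem IsSlice.eq_unit_of_mul_self {e : Set G} (hO : 𝒢.IsSlice e) (he : 𝒢.setMul e e = e) {g : G}
    (hg : g ∈ e) : g = 𝒢.unit (𝒢.src g) := by
  obtain ⟨h, hh, k, hk, p, hhk⟩ := he.symm ▸ hg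
  have h1 : g = h := hO.rng_inj hg hh (by rw [← hhk, 𝒢.rng_mul])
  have h2 : g = k := hO.src_inj hg hk (by rw [← hhk, 𝒢.src_mul])
  have := 𝒢.eq_unit_of_mul_eq_left p (hhk.trans h1)
  rwa [← h1, ← h2] at this

end TopGroupoid

namespace CantorInvSemigroup

variable {G : Type w} {X : Type u} [TopologicalSpace G] [TopologicalSpace X]
  {𝒢 : TopGroupoid G X} (S : CantorInvSemigroup 𝒢)

variable {S}

theorem Elt.ext {s t : S.Elt} (h : ∀ g, g ∈ s.1 ↔ g ∈ t.1) : s = t :=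
  Subtype.ext (Set.ext h)

theorem Elt.rng_inj (s : S.Elt) {g h : G} (hg : g ∈ s.1) (hh : h ∈ s.1)
    (e : 𝒢.rng g = 𝒢.rng h) : g = h :=
  (S.isSlice s.1 s.2).rng_inj hg hh e

theorem Elt.src_inj (s : S.Elt) {g h : G} (hg : g ∈ s.1) (hh : h ∈ s.1)
    (e : 𝒢.src g = 𝒢.src h) : g = h :=
  (S.isSlice s.1 s.2).src_inj hg hh e

theorem mul_mem_mul {s t : S.Elt} {g h : G} (hg : g ∈ s.1) (hh : h ∈ t.1)
    (p : 𝒢.src g = 𝒢.rng h) : 𝒢.mul g h p ∈ (s * t).1 :=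
  ⟨g, hg, h, hh, p, rfl⟩

theorem inv_mem_star {s : S.Elt} {g : G} (hg : g ∈ s.1) : 𝒢.inv g ∈ (star s).1 :=
  ⟨g, hg, rfl⟩

theorem Proj.eq_unit (e : S.Proj) {g : G} (hg : g ∈ e.1.1) : g = 𝒢.unit (𝒢.src g) :=
  (S.isSlice _ e.1.2).eq_unit_of_mul_self (congrArg Subtype.val e.2) hg

theorem Proj.eq_unit_rng (e : S.Proj) {g : G} (hg : g ∈ e.1.1) : g = 𝒢.unit (𝒢.rng g) := by
  have := e.eq_unit hg
  rw [this, 𝒢.rng_unit]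

theorem Proj.rng_mem (e : S.Proj) {g : G} (hg : g ∈ e.1.1) : 𝒢.rng g ∈ e.set := by
  change 𝒢.unit (𝒢.rng g) ∈ e.1.1
  rwa [← e.eq_unit_rng hg]

theorem Proj.src_eq_rng (e : S.Proj) {g : G} (hg : g ∈ e.1.1) : 𝒢.src g = 𝒢.rng g := by
  conv_rhs => rw [e.eq_unit hg, 𝒢.rng_unit]

theorem mem_mul_proj (s : S.Elt) (e : S.Proj) {k : G} :
    k ∈ (s * e.1).1 ↔ k ∈ s.1 ∧ 𝒢.src k ∈ e.set := by
  constructor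
  · rintro ⟨g, hg, h, hh, p, rfl⟩
    have h1 : 𝒢.mul g h p = g := by
      rw [𝒢.mul_congr rfl ((e.eq_unit_rng hh).trans (congrArg 𝒢.unit p.symm)) p
        (𝒢.rng_unit _).symm, 𝒢.mul_unit]
    rw [h1]
    exact ⟨hg, p ▸ e.rng_mem hh⟩
  · rintro ⟨hk, hk'⟩
    exact ⟨k, hk, 𝒢.unit (𝒢.src k), hk', _, 𝒢.mul_unit k⟩

theorem mem_proj_mul (s : S.Elt) (e : S.Proj) {k : G} :
    k ∈ (e.1 * s).1 ↔ k ∈ s.1 ∧ 𝒢.rng k ∈ e.set := by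
  constructor
  · rintro ⟨g, hg, h, hh, p, rfl⟩
    have h1 : 𝒢.mul g h p = h := by
      rw [𝒢.mul_congr ((e.eq_unit hg).trans (congrArg 𝒢.unit p)) rfl p (𝒢.src_unit _),
        𝒢.unit_mul]
    rw [h1]
    exact ⟨hh, by rw [← p, e.src_eq_rng hg]; exact e.rng_mem hg⟩
  · rintro ⟨hk, hk'⟩
    exact ⟨𝒢.unit (𝒢.rng k), hk', k, hk, _, 𝒢.unit_mul k⟩

theorem mem_mul_star (s : S.Elt) {k : G} : k ∈ (s * star s).1 ↔ ∃ g ∈ s.1, k = 𝒢.unit (𝒢.rng g) := by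
  constructor
  · rintro ⟨g, hg, _, ⟨h, hh, rfl⟩, p, rfl⟩
    have h1 : g = h := s.src_inj hg hh (p.trans (𝒢.rng_inv h))
    subst h1
    exact ⟨g, hg, 𝒢.mul_inv g⟩
  · rintro ⟨g, hg, rfl⟩
    exact ⟨g, hg, _, inv_mem_star hg, _, 𝒢.mul_inv g⟩

theorem mem_star_mul (s : S.Elt) {k : G} : k ∈ (star s * s).1 ↔ ∃ g ∈ s.1, k = 𝒢.unit (𝒢.src g) := by
  constructor
  · rintro ⟨_, ⟨g, hg, rfl⟩, h, hh, p, rfl⟩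
    have h1 : g = h := s.rng_inj hg hh ((𝒢.src_inv g).symm.trans p)
    subst h1
    exact ⟨g, hg, 𝒢.inv_mul g⟩
  · rintro ⟨g, hg, rfl⟩
    exact ⟨_, inv_mem_star hg, g, hg, _, 𝒢.inv_mul g⟩

theorem mul_self_of_forall_unit {e : S.Elt} (h : ∀ g ∈ e.1, g = 𝒢.unit (𝒢.src g)) : e * e = e := by
  refine Elt.ext fun k => ⟨?_, fun hk => ?_⟩
  · rintro ⟨g, hg, k, hk, p, rfl⟩
    rwa [𝒢.mul_congr ((h g hg).trans (congrArg 𝒢.unit p)) rfl p (𝒢.src_unit _), 𝒢.unit_mul]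
  · refine ⟨k, hk, k, hk, ?_, ?_⟩
    · conv_rhs => rw [h k hk, 𝒢.rng_unit]
    · rw [𝒢.mul_congr rfl (h k hk) _ (𝒢.rng_unit _).symm, 𝒢.mul_unit]

/-- The range projection `s s⋆`. -/
def Elt.rngProj (s : S.Elt) : S.Proj :=
  ⟨s * star s, mul_self_of_forall_unit fun g hg => by
    obtain ⟨h, -, rfl⟩ := (mem_mul_star s).1 hg
    rw [𝒢.src_unit]⟩

/-- The source projection `s⋆ s`. -/
def Elt.srcProj (s : S.Elt) : S.Proj :=
  ⟨star s * s, mul_self_of_forall_unit fun g hg => by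
    obtain ⟨h, -, rfl⟩ := (mem_star_mul s).1 hg
    rw [𝒢.src_unit]⟩

theorem mem_base_mul_star (s : S.Elt) {x : X} :
    x ∈ 𝒢.base (s * star s).1 ↔ ∃ g ∈ s.1, 𝒢.rng g = x := by
  change 𝒢.unit x ∈ (s * star s).1 ↔ _
  rw [mem_mul_star]
  exact ⟨fun ⟨g, hg, h⟩ => ⟨g, hg, (𝒢.unit_injective h).symm⟩, fun ⟨g, hg, h⟩ => ⟨g, hg, h ▸ rfl⟩⟩

theorem mem_rngProj (s : S.Elt) {x : X} : x ∈ s.rngProj.set ↔ ∃ g ∈ s.1, 𝒢.rng g = x :=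
  mem_base_mul_star s

theorem mem_srcProj (s : S.Elt) {x : X} : x ∈ s.srcProj.set ↔ ∃ g ∈ s.1, 𝒢.src g = x := by
  change 𝒢.unit x ∈ (star s * s).1 ↔ _
  rw [mem_star_mul]
  exact ⟨fun ⟨g, hg, h⟩ => ⟨g, hg, (𝒢.unit_injective h).symm⟩, fun ⟨g, hg, h⟩ => ⟨g, hg, h ▸ rfl⟩⟩

/-- The order of the inverse semigroup is inclusion: if `t ⊆ s` then `t = (t t⋆) s`. -/
theorem eq_rngProj_mul_of_subset {s t : S.Elt} (h : t.1 ⊆ s.1) : t = t.rngProj.1 * s :=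
  Elt.ext fun k => by
    rw [mem_proj_mul, mem_rngProj]
    refine ⟨fun hk => ⟨h hk, k, hk, rfl⟩, ?_⟩
    rintro ⟨hk, g, hg, e⟩
    rwa [← s.rng_inj (h hg) hk e]

/-- `s e = (s e s⋆) s`, where `s e s⋆` is written as the range projection of `s e`. -/
theorem mul_proj_eq (s : S.Elt) (e : S.Proj) : s * e.1 = (s * e.1).rngProj.1 * s :=
  eq_rngProj_mul_of_subset fun _ hk => ((mem_mul_proj s e).1 hk).1

theorem rng_mem_conj_iff {s : S.Elt} {e : S.Proj} {g : G} (hg : g ∈ s.1) :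
    𝒢.rng g ∈ (s * e.1).rngProj.set ↔ 𝒢.src g ∈ e.set := by
  rw [mem_rngProj]
  constructor
  · rintro ⟨h, hh, p⟩
    rw [mem_mul_proj] at hh
    rw [← s.rng_inj hh.1 hg p]
    exact hh.2
  · exact fun h => ⟨g, (mem_mul_proj s e).2 ⟨hg, h⟩, rfl⟩

theorem rngProj_mul (s : S.Elt) : s.rngProj.1 * s = s :=
  (eq_rngProj_mul_of_subset subset_rfl).symm

theorem mul_srcProj (s : S.Elt) : s * s.srcProj.1 = s :=
  Elt.ext fun k => by
    rw [mem_mul_proj, mem_srcProj]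
    exact ⟨fun h => h.1, fun h => ⟨h, k, h, rfl⟩⟩

variable (S)

theorem exists_mem (g : G) : ∃ s : S.Elt, g ∈ s.1 := by
  obtain ⟨s, hs, -, -, hg, -⟩ := S.full_basis g Set.univ isOpen_univ trivial
  exact ⟨⟨s, hs⟩, hg⟩

theorem exists_proj_mem (x : X) : ∃ e : S.Proj, x ∈ e.set := by
  obtain ⟨s, hs⟩ := S.exists_mem (𝒢.unit x)
  exact ⟨s.rngProj, (mem_rngProj s).2 ⟨_, hs, 𝒢.rng_unit x⟩⟩

/-- The sets `e \ (f₁ ∪ ⋯ ∪ fₙ)`, for projections `e, f₁, …, fₙ`, form a basis of `X`. Fullness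
yields this for arrows that are close to a unit `x`; such arrows are units, since the source map is
injective on a slice around `x`. -/
theorem exists_proj_nhds (x : X) (O : Set X) (hO : IsOpen O) (hx : x ∈ O) :
    ∃ (e : S.Proj) (F : List S.Proj), x ∈ e.set ∧ (∀ f ∈ F, x ∉ f.set) ∧
      ∀ y ∈ e.set, (∀ f ∈ F, y ∉ f.set) → y ∈ O := by
  obtain ⟨t, ht⟩ := S.exists_mem (𝒢.unit x)
  have hto : IsOpen t.1 := (S.isSlice t.1 t.2).1
  obtain ⟨s, hs, F, hF, hxs, hxF, hsF⟩ := S.full_basis (𝒢.unit x)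
    (t.1 ∩ (fun g => 𝒢.unit (𝒢.src g)) ⁻¹' t.1 ∩ 𝒢.src ⁻¹' O)
    ((hto.inter (hto.preimage (𝒢.continuous_unit.comp 𝒢.continuous_src))).inter
      (hO.preimage 𝒢.continuous_src))
    ⟨⟨ht, by simpa [𝒢.src_unit] using ht⟩, by simpa [𝒢.src_unit] using hx⟩
  let F' : List S.Proj := F.attach.toList.map fun f =>
    ⟨⟨f.1, (hF f.1 f.2).1⟩, Subtype.ext (hF f.1 f.2).2⟩
  refine ⟨Elt.rngProj ⟨s, hs⟩, F', (mem_rngProj _).2 ⟨_, hxs, 𝒢.rng_unit x⟩, ?_, ?_⟩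
  · intro f hf
    obtain ⟨f, -, rfl⟩ := List.mem_map.1 hf
    have := hxF f.1 f.2
    rwa [𝒢.rng_unit] at this
  · intro y hy hyF
    obtain ⟨h, hh, rfl⟩ := (mem_rngProj _).1 hy
    obtain ⟨⟨h1, h2⟩, h3⟩ := hsF h hh fun f hf =>
      hyF _ (List.mem_map.2 ⟨⟨f, hf⟩, by simp, rfl⟩)
    have h4 : h = 𝒢.unit (𝒢.src h) := t.src_inj h1 h2 (𝒢.src_unit _).symm
    rw [h4, 𝒢.rng_unit]
    exact h3

theorem isClopen_diff (e : S.Proj) (F : List S.Proj) :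
    IsClopen {y | y ∈ e.set ∧ ∀ f ∈ F, y ∉ f.set} := by
  have h : IsClopen {y : X | ∀ f ∈ F, y ∉ f.set} := by
    induction F with
    | nil => simpa using isClopen_univ
    | cons f F ih =>
      simp only [List.mem_cons, forall_eq_or_imp]
      exact f.isClopen.compl.inter ih
  exact e.isClopen.inter h

include S in
theorem locallyBooleanSpace [T2Space G] [LocallyCompactSpace G] : LocallyBooleanSpace X := by
  have hT : T2Space X := T2Space.of_injective_continuous 𝒢.unit_injective 𝒢.continuous_unit
  have hemb : IsClosedEmbedding 𝒢.unit :=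
    Function.LeftInverse.isClosedEmbedding 𝒢.src_unit 𝒢.continuous_src 𝒢.continuous_unit
  have : LocallyCompactSpace X := hemb.locallyCompactSpace
  refine { exists_compactOpens := fun x U hU hx => ?_ }
  obtain ⟨K, hK, hxK, hKU⟩ := exists_compact_subset hU hx
  obtain ⟨e, F, hxe, hxF, hF⟩ := S.exists_proj_nhds x (interior K) isOpen_interior hxK
  have hc := S.isClopen_diff e F
  have hsub : {y | y ∈ e.set ∧ ∀ f ∈ F, y ∉ f.set} ⊆ K := fun y hy =>
    interior_subset (hF y hy.1 hy.2)
  exact ⟨⟨⟨_, hK.of_isClosed_subset hc.isClosed hsub⟩, hc.isOpen⟩, ⟨hxe, hxF⟩,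
    hsub.trans hKU⟩

end CantorInvSemigroup

/-! ### Groupoid actions and inverse semigroup actions on a field of fibres -/

namespace FieldAction

variable {G : Type w} {X : Type u} [TopologicalSpace G] [TopologicalSpace X]
  {𝒢 : TopGroupoid G X} {E : Type v} [NormedAddCommGroup E] [NormedSpace ℂ E]
  {N : X → Submodule ℂ E} (V : FieldAction 𝒢 N)

theorem exists_rel (g : G) (ξ : E) : ∃ η, V.Rel g ξ η :=
  ((N (𝒢.rng g)).mkQ_surjective _).imp fun _ h => h.symm

variable {V}

theorem Rel.sub_mem {g : G} {ξ η η' : E} (h : V.Rel g ξ η) (h' : V.Rel g ξ η') :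
    η - η' ∈ N (𝒢.rng g) :=
  IsC0Mod.mk_eq_iff.1 (h.symm.trans h')

theorem Rel.congr_right {g : G} {ξ η η' : E} (h : V.Rel g ξ η) (hη : η - η' ∈ N (𝒢.rng g)) :
    V.Rel g ξ η' :=
  h.trans (IsC0Mod.mk_eq_iff.2 hη)

theorem Rel.congr_left {g : G} {ξ ξ' η : E} (h : V.Rel g ξ η) (hξ : ξ - ξ' ∈ N (𝒢.src g)) :
    V.Rel g ξ' η :=
  (congrArg (V.map g) (IsC0Mod.mk_eq_iff.2 hξ)).symm.trans h

theorem Rel.add {g : G} {ξ ξ' η η' : E} (h : V.Rel g ξ η) (h' : V.Rel g ξ' η') :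
    V.Rel g (ξ + ξ') (η + η') := by
  unfold FieldAction.Rel at *
  rw [map_add, map_add, h, h', map_add]

theorem Rel.smul {g : G} {ξ η : E} (z : ℂ) (h : V.Rel g ξ η) : V.Rel g (z • ξ) (z • η) := by
  unfold FieldAction.Rel at *
  rw [map_smul, map_smul, h, map_smul]

theorem Rel.mul {g h : G} {p : 𝒢.src g = 𝒢.rng h} {ξ η ζ : E} (h1 : V.Rel h ξ η)
    (h2 : V.Rel g η ζ) : V.Rel (𝒢.mul g h p) ξ ζ :=
  V.map_mul g h p ξ η ζ h1 h2

theorem rel_unit (x : X) (ξ : E) : V.Rel (𝒢.unit x) ξ ξ := V.map_unit x ξ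

theorem rel_zero (g : G) : V.Rel g 0 0 := by
  unfold FieldAction.Rel; simp

theorem Rel.mem_of_mem {g : G} {ξ η : E} (h : V.Rel g ξ η) (hξ : ξ ∈ N (𝒢.src g)) :
    η ∈ N (𝒢.rng g) := by
  have h1 : V.Rel g 0 η := h.congr_left (by simpa using hξ)
  simpa using h1.sub_mem (rel_zero g)

theorem ext_of_rel {V V' : FieldAction 𝒢 N} (h : ∀ g ξ η, V.Rel g ξ η → V'.Rel g ξ η) :
    V = V' := by
  have : V.map = V'.map := by
    funext g
    ext ξ
    obtain ⟨η, hη⟩ := V.exists_rel g ξ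
    exact hη.trans (h g ξ η hη).symm
  cases V; cases V'
  simp only at this
  subst this
  rfl

theorem ext_of_groupoidFormula {S : CantorInvSemigroup 𝒢} {U : S.Elt → E → E}
    {V V' : FieldAction 𝒢 N} (h : GroupoidFormula S V U) (h' : GroupoidFormula S V' U) :
    V = V' :=
  ext_of_rel fun g ξ η hη => by
    obtain ⟨s, hs⟩ := S.exists_mem g
    have h1 : V.Rel g ξ (U s ξ) := h s ξ g hs
    have h2 : V'.Rel g ξ (U s ξ) := h' s ξ g hs
    exact h2.congr_right (h1.sub_mem hη)

/-- The condition `x ∉ s s⋆` says that no arrow of `s` has range `x`. -/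
theorem inverseSemigroupFormula_iff {S : CantorInvSemigroup 𝒢} {U : S.Elt → E → E} :
    InverseSemigroupFormula S V U ↔ ∀ s ξ, (∀ g ∈ s.1, V.Rel g ξ (U s ξ)) ∧
      ∀ x, (∀ g ∈ s.1, 𝒢.rng g ≠ x) → U s ξ ∈ N x := by
  refine forall₂_congr fun s ξ => and_congr (forall₂_congr fun g _ => eq_comm)
    (forall_congr' fun x => imp_congr ?_ (Submodule.Quotient.mk_eq_zero _))
  rw [CantorInvSemigroup.mem_base_mul_star]
  push Not
  exact Iff.rfl

end FieldAction

theorem InverseSemigroupFormula.groupoidFormula {G : Type w} {X : Type u} [TopologicalSpace G]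
    [TopologicalSpace X] {𝒢 : TopGroupoid G X} {E : Type v} [NormedAddCommGroup E]
    [NormedSpace ℂ E] {N : X → Submodule ℂ E} {V : FieldAction 𝒢 N} {S : CantorInvSemigroup 𝒢}
    {U : S.Elt → E → E} (h : InverseSemigroupFormula S V U) : GroupoidFormula S V U :=
  fun _ ξ g hg => ((h _ ξ).1 g hg).symm

/-- A contractive action `U` of the inverse semigroup `S` in which every projection `e` acts as the
characteristic function `1_e` on the field of fibres `E ⧸ N x`. -/
structure IsCompatibleAction {G : Type w} {X : Type u} [TopologicalSpace G] [TopologicalSpace X]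
    {𝒢 : TopGroupoid G X} (S : CantorInvSemigroup 𝒢) {E : Type v} [NormedAddCommGroup E]
    [NormedSpace ℂ E] (N : X → Submodule ℂ E) (U : S.Elt → E →ₗ[ℂ] E) : Prop where
  mul : ∀ s t ξ, U (s * t) ξ = U s (U t ξ)
  norm_le : ∀ s ξ, ‖U s ξ‖ ≤ ‖ξ‖
  proj_sub_mem : ∀ (e : S.Proj) ξ, ∀ x ∈ e.set, U e.1 ξ - ξ ∈ N x
  proj_mem : ∀ (e : S.Proj) ξ, ∀ x ∉ e.set, U e.1 ξ ∈ N x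

namespace IsCompatibleAction

variable {G : Type w} {X : Type u} [TopologicalSpace G] [TopologicalSpace X]
  {𝒢 : TopGroupoid G X} {S : CantorInvSemigroup 𝒢} {E : Type v} [NormedAddCommGroup E]
  [NormedSpace ℂ E] {N : X → Submodule ℂ E} {U : S.Elt → E →ₗ[ℂ] E}
  (hU : IsCompatibleAction S N U)
include hU

theorem mem_of_forall_ne {s : S.Elt} {x : X} (hx : ∀ g ∈ s.1, 𝒢.rng g ≠ x) (ξ : E) :
    U s ξ ∈ N x := by
  rw [← CantorInvSemigroup.rngProj_mul s, hU.mul]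
  refine hU.proj_mem _ _ _ fun h => ?_
  obtain ⟨g, hg, e⟩ := (CantorInvSemigroup.mem_rngProj s).1 h
  exact hx g hg e

theorem inverseSemigroupFormula {V : FieldAction 𝒢 N} (h : GroupoidFormula S V fun s => U s) :
    InverseSemigroupFormula S V fun s => U s :=
  FieldAction.inverseSemigroupFormula_iff.2 fun s ξ =>
    ⟨fun g hg => h s ξ g hg, fun _ hx => hU.mem_of_forall_ne hx ξ⟩

theorem sub_mem_of_subset {s t : S.Elt} (hts : t.1 ⊆ s.1) {g : G} (hg : g ∈ t.1) (ξ : E) :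
    U t ξ - U s ξ ∈ N (𝒢.rng g) := by
  have h1 : U t ξ = U t.rngProj.1 (U s ξ) := by
    rw [← hU.mul, ← CantorInvSemigroup.eq_rngProj_mul_of_subset hts]
  rw [h1]
  exact hU.proj_sub_mem _ _ _ ((CantorInvSemigroup.mem_rngProj t).2 ⟨g, hg, rfl⟩)

theorem sub_mem {s t : S.Elt} {g : G} (hs : g ∈ s.1) (ht : g ∈ t.1) (ξ : E) :
    U s ξ - U t ξ ∈ N (𝒢.rng g) := by
  obtain ⟨r, hr, hgr, hrs⟩ := S.full_inter s.1 s.2 t.1 t.2 g ⟨hs, ht⟩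
  have h1 := hU.sub_mem_of_subset (t := ⟨r, hr⟩) (hrs.trans Set.inter_subset_left) hgr ξ
  have h2 := hU.sub_mem_of_subset (t := ⟨r, hr⟩) (hrs.trans Set.inter_subset_right) hgr ξ
  simpa using _root_.sub_mem h2 h1

theorem map_proj_sub_mem {s : S.Elt} {e : S.Proj} {g : G} (hg : g ∈ s.1) (he : 𝒢.src g ∈ e.set)
    (ξ : E) : U s (U e.1 ξ) - U s ξ ∈ N (𝒢.rng g) := by
  rw [← hU.mul, CantorInvSemigroup.mul_proj_eq, hU.mul]
  exact hU.proj_sub_mem _ _ _ ((CantorInvSemigroup.rng_mem_conj_iff hg).2 he)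

theorem map_proj_mem {s : S.Elt} {e : S.Proj} {g : G} (hg : g ∈ s.1) (he : 𝒢.src g ∉ e.set)
    (ξ : E) : U s (U e.1 ξ) ∈ N (𝒢.rng g) := by
  rw [← hU.mul, CantorInvSemigroup.mul_proj_eq, hU.mul]
  exact hU.proj_mem _ _ _ (mt (CantorInvSemigroup.rng_mem_conj_iff hg).1 he)

variable [LocallyBooleanSpace X] {act : C₀(X, ℂ) →ₗ[ℂ] E →ₗ[ℂ] E} (h : IsC0Mod N act)
include h

/-- If `ξ_x = 0`, then the products of `ξ` with `1_e (1 - 1_{f₁}) ⋯ (1 - 1_{fₙ})`, where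
`x ∈ e \ (f₁ ∪ ⋯ ∪ fₙ)`, are arbitrarily small. Here `C` stands for any
set that contains `ξ` and is closed under these multiplications. -/
theorem exists_norm_le_of_mem {x : X} {C : Set E}
    (hC : ∀ ξ ∈ C, ∀ e : S.Proj, x ∈ e.set → U e.1 ξ ∈ C)
    (hC' : ∀ ξ ∈ C, ∀ f : S.Proj, x ∉ f.set → ξ - U f.1 ξ ∈ C) {ξ : E} (hξ : ξ ∈ C)
    (hx : ξ ∈ N x) {ε : ℝ} (hε : 0 < ε) : ∃ ζ ∈ C, ‖ζ‖ ≤ ε := by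
  obtain ⟨Y, hxY, hY⟩ := h.exists_norm_act_le_of_mem hx hε
  obtain ⟨e, F, hxe, hxF, hF⟩ := S.exists_proj_nhds x Y Y.isOpen hxY
  -- `η` agrees with `ξ` outside the sets in `F`, and vanishes on them
  have key : ∀ F : List S.Proj, (∀ f ∈ F, x ∉ f.set) → ∃ η ∈ C,
      (∀ y, (∀ f ∈ F, y ∉ f.set) → η - ξ ∈ N y) ∧ ∀ y, ∀ f ∈ F, y ∈ f.set → η ∈ N y := by
    intro F
    induction F with
    | nil => exact fun _ => ⟨ξ, hξ, by simp, by simp⟩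
    | cons f F ih =>
      intro hxF
      obtain ⟨η, hη, h1, h2⟩ := ih fun f hf => hxF f (List.mem_cons_of_mem _ hf)
      refine ⟨η - U f.1 η, hC' η hη f (hxF f List.mem_cons_self), fun y hy => ?_,
        fun y f' hf' hy => ?_⟩
      · have h3 := h1 y fun f' hf' => hy f' (List.mem_cons_of_mem _ hf')
        have h4 := hU.proj_mem f η y (hy f List.mem_cons_self)
        convert _root_.sub_mem h3 h4 using 1
        abel
      · by_cases hyf : y ∈ f.set
        · have := neg_mem (hU.proj_sub_mem f η y hyf)
          rwa [neg_sub] at this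
        · rcases List.mem_cons.1 hf' with rfl | hf'
          · exact absurd hy hyf
          · exact _root_.sub_mem (h2 y f' hf' hy) (hU.proj_mem f η y hyf)
  obtain ⟨η, hη, h1, h2⟩ := key F hxF
  refine ⟨U e.1 η, hC η hη e hxe, h.norm_le_of_forall (fun y => ?_) hε.le⟩
  by_cases hye : y ∈ e.set
  · have h3 := hU.proj_sub_mem e η y hye
    by_cases hyF : ∀ f ∈ F, y ∉ f.set
    · have h4 := add_mem h3 (h1 y hyF)
      rw [sub_add_sub_cancel] at h4
      rw [IsC0Mod.mk_eq_iff.2 h4, ← h.norm_mk_act_charFun (hF y hye hyF : y ∈ Y)]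
      exact (IsC0Mod.norm_mk_le _ _).trans hY.le
    · push Not at hyF
      obtain ⟨f, hf, hyf⟩ := hyF
      rw [IsC0Mod.mk_eq_iff.2 h3, h.norm_mk_eq_zero.2 (h2 y f hf hyf)]
      exact hε.le
  · rw [h.norm_mk_eq_zero.2 (hU.proj_mem e η y hye)]
    exact hε.le

/-- `U_s` induces a map from the fibre at `s(g)` to the fibre at `r(g)`, for `g ∈ s`. -/
theorem map_mem {s : S.Elt} {g : G} (hg : g ∈ s.1) {ξ : E} (hξ : ξ ∈ N (𝒢.src g)) :
    U s ξ ∈ N (𝒢.rng g) := by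
  rw [← h.norm_mk_eq_zero]
  refine le_antisymm (le_of_forall_pos_le_add fun ε hε => ?_) (norm_nonneg _)
  have h1 : ∀ η ∈ {η | U s η - U s ξ ∈ N (𝒢.rng g)}, ∀ e : S.Proj, 𝒢.src g ∈ e.set →
      U e.1 η ∈ {η | U s η - U s ξ ∈ N (𝒢.rng g)} := fun η hη e he => by
    have := add_mem (hU.map_proj_sub_mem hg he η) hη
    rwa [sub_add_sub_cancel] at this
  have h2 : ∀ η ∈ {η | U s η - U s ξ ∈ N (𝒢.rng g)}, ∀ f : S.Proj, 𝒢.src g ∉ f.set →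
      η - U f.1 η ∈ {η | U s η - U s ξ ∈ N (𝒢.rng g)} := fun η hη f hf => by
    have := _root_.sub_mem hη (hU.map_proj_mem hg hf η)
    change U s (η - U f.1 η) - U s ξ ∈ N (𝒢.rng g)
    convert this using 1
    rw [map_sub]
    abel
  obtain ⟨ζ, hζ, hζε⟩ := hU.exists_norm_le_of_mem h h1 h2 (ξ := ξ) (by simp) hξ hε
  rw [← IsC0Mod.mk_eq_iff.2 hζ, zero_add]
  exact (IsC0Mod.norm_mk_le _ _).trans ((hU.norm_le s ζ).trans hζε)

end IsCompatibleAction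

theorem Submodule.norm_mapQ_le {E : Type*} [NormedAddCommGroup E] [NormedSpace ℂ E]
    {P Q : Submodule ℂ E} {T : E →ₗ[ℂ] E} (hT : ∀ ξ, ‖T ξ‖ ≤ ‖ξ‖) (hPQ : P ≤ Q.comap T)
    (ξ : E ⧸ P) : ‖P.mapQ Q T hPQ ξ‖ ≤ ‖ξ‖ := by
  refine le_of_forall_gt_imp_ge_of_dense fun r hr => ?_
  obtain ⟨ζ, rfl, hζ⟩ := (QuotientAddGroup.norm_lt_iff (S := P.toAddSubgroup)).1 hr
  exact (Submodule.Quotient.norm_mk_le Q (T ζ)).trans ((hT ζ).trans hζ.le)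

section Construction

variable {G : Type w} {X : Type u} [TopologicalSpace G] [TopologicalSpace X]
  {𝒢 : TopGroupoid G X} {S : CantorInvSemigroup 𝒢} {E : Type v} [NormedAddCommGroup E]
  [NormedSpace ℂ E] {N : X → Submodule ℂ E} [LocallyBooleanSpace X]
  {act : C₀(X, ℂ) →ₗ[ℂ] E →ₗ[ℂ] E}

/-- The groupoid action `V_g(ξ_{s(g)}) = (U_s ξ)_{r(g)}`, for any `s` that contains `g`. -/
noncomputable def IsCompatibleAction.fieldAction {U : S.Elt → E →ₗ[ℂ] E}
    (hU : IsCompatibleAction S N U) (h : IsC0Mod N act) : FieldAction 𝒢 N where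
  map g := (N (𝒢.src g)).mapQ (N (𝒢.rng g)) (U (S.exists_mem g).choose)
    fun _ hξ => hU.map_mem h (S.exists_mem g).choose_spec hξ
  map_unit x ξ := by
    obtain ⟨e, he⟩ := S.exists_proj_mem x
    have h1 := hU.sub_mem (S.exists_mem (𝒢.unit x)).choose_spec he ξ
    have h2 := hU.proj_sub_mem e ξ (𝒢.rng (𝒢.unit x)) (by rwa [𝒢.rng_unit])
    have := add_mem h1 h2
    rw [sub_add_sub_cancel] at this
    exact IsC0Mod.mk_eq_iff.2 this
  map_mul g k hgk ξ η ζ h1 h2 := by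
    have hg := (S.exists_mem g).choose_spec
    have hk := (S.exists_mem k).choose_spec
    have h1 := IsC0Mod.mk_eq_iff.1 h1
    have h2 := IsC0Mod.mk_eq_iff.1 h2
    have h3 := hU.sub_mem (S.exists_mem (𝒢.mul g k hgk)).choose_spec
      (CantorInvSemigroup.mul_mem_mul hg hk hgk) ξ
    rw [hU.mul] at h3
    have h4 := hU.map_mem h hg (hgk ▸ h1)
    rw [map_sub] at h4
    have h5 := add_mem h4 h2
    rw [sub_add_sub_cancel] at h5
    have h6 := add_mem h3 ((𝒢.rng_mul g k hgk).symm ▸ h5)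
    rw [sub_add_sub_cancel] at h6
    exact IsC0Mod.mk_eq_iff.2 h6
  continuous σ hσ g₀ ε hε := by
    obtain ⟨s, hs⟩ := S.exists_mem g₀
    obtain ⟨ξ, hξ⟩ := hσ g₀ ε hε
    refine ⟨U s ξ, ?_⟩
    filter_upwards [hξ, (S.isSlice s.1 s.2).1.mem_nhds hs] with g hg hgs
    refine lt_of_le_of_lt ?_ hg
    have h1 : (N (𝒢.rng g)).mkQ (U s ξ) =
        (N (𝒢.src g)).mapQ (N (𝒢.rng g)) (U (S.exists_mem g).choose)
          (fun _ hξ => hU.map_mem h (S.exists_mem g).choose_spec hξ) ((N (𝒢.src g)).mkQ ξ) :=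
      IsC0Mod.mk_eq_iff.2 (hU.sub_mem hgs (S.exists_mem g).choose_spec ξ)
    rw [h1, ← map_sub]
    exact Submodule.norm_mapQ_le (hU.norm_le _) _ _

theorem IsCompatibleAction.groupoidFormula {U : S.Elt → E →ₗ[ℂ] E}
    (hU : IsCompatibleAction S N U) (h : IsC0Mod N act) :
    GroupoidFormula S (hU.fieldAction h) fun s => U s :=
  fun s ξ g hg => IsC0Mod.mk_eq_iff.2 (hU.sub_mem (S.exists_mem g).choose_spec hg ξ)

variable {V : FieldAction 𝒢 N}

theorem InverseSemigroupFormula.unique (h : IsC0Mod N act) {U U' : S.Elt → E → E}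
    (hU : InverseSemigroupFormula S V U) (hU' : InverseSemigroupFormula S V U') : U = U' := by
  rw [FieldAction.inverseSemigroupFormula_iff] at hU hU'
  funext s ξ
  refine h.eq_of_forall_sub_mem fun x => ?_
  by_cases hx : ∀ g ∈ s.1, 𝒢.rng g ≠ x
  · exact sub_mem ((hU s ξ).2 x hx) ((hU' s ξ).2 x hx)
  · push Not at hx
    obtain ⟨g, hg, rfl⟩ := hx
    exact ((hU s ξ).1 g hg).sub_mem ((hU' s ξ).1 g hg)

/-- For a contractive groupoid action, the field `x ↦ 1_{x ∈ s s⋆} V_{xs}(ξ_{s(xs)})` belongs to an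
element of `E`: it is locally approximable, as `V` is continuous and `r` is a homeomorphism from
`s` onto the clopen set `s s⋆`, and it vanishes at infinity, as `ξ` does. -/
theorem FieldAction.exists_semigroup_apply [CompleteSpace E] (h : IsC0Mod N act)
    (hV : ∀ g v, ‖V.map g v‖ ≤ ‖v‖) (s : S.Elt) (ξ : E) :
    ∃ ζ, (∀ g ∈ s.1, V.Rel g ξ ζ) ∧ ∀ x, (∀ g ∈ s.1, 𝒢.rng g ≠ x) → ζ ∈ N x := by
  have hτ : ∀ x : X, ∃ η, (∀ g ∈ s.1, 𝒢.rng g = x → V.Rel g ξ η) ∧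
      ((∀ g ∈ s.1, 𝒢.rng g ≠ x) → η = 0) := by
    intro x
    by_cases hx : ∀ g ∈ s.1, 𝒢.rng g ≠ x
    · exact ⟨0, fun g hg e => absurd e (hx g hg), fun _ => rfl⟩
    · push Not at hx
      obtain ⟨g, hg, rfl⟩ := hx
      obtain ⟨η, hη⟩ := V.exists_rel g ξ
      refine ⟨η, fun g' hg' e => ?_, fun hh => absurd rfl (hh g hg)⟩
      rwa [s.rng_inj hg' hg e]
  choose τ hτ hτ0 using hτ
  have hsrc : IsClosedEmbedding (s.1.domRestrict 𝒢.src) := by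
    refine ⟨(S.isSlice s.1 s.2).2.1, ?_⟩
    convert s.srcProj.isClopen.isClosed using 1
    ext x
    rw [CantorInvSemigroup.mem_srcProj]
    exact ⟨fun ⟨g, hg⟩ => ⟨g.1, g.2, hg⟩, fun ⟨g, hg, hx⟩ => ⟨⟨g, hg⟩, hx⟩⟩
  have hrng : IsEmbedding (s.1.domRestrict 𝒢.rng) := (S.isSlice s.1 s.2).2.2
  suffices ∃ ζ, ∀ x, ζ - τ x ∈ N x by
    obtain ⟨ζ, hζ⟩ := this
    refine ⟨ζ, fun g hg => (hτ _ g hg rfl).congr_right ?_, fun x hx => ?_⟩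
    · rw [← neg_sub]; exact neg_mem (hζ _)
    · have := hζ x
      rwa [hτ0 x hx, sub_zero] at this
  refine h.exists_forall_sub_mem τ (fun x₀ ε hε => ?_) (fun ε hε => ?_)
  · by_cases hx₀ : x₀ ∈ s.rngProj.set
    · obtain ⟨g₀, hg₀, rfl⟩ := (CantorInvSemigroup.mem_rngProj s).1 hx₀
      have hσ : IsPullbackSection N 𝒢.src fun g => (N (𝒢.src g)).mkQ ξ :=
        fun g ε hε => ⟨ξ, Eventually.of_forall fun y => by simpa using hε⟩
      obtain ⟨η, hη⟩ := V.continuous _ hσ g₀ ε hε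
      have h1 : ∀ᶠ g : s.1 in 𝓝 ⟨g₀, hg₀⟩,
          ‖V.map g.1 ((N (𝒢.src g.1)).mkQ ξ) - (N (𝒢.rng g.1)).mkQ η‖ < ε :=
        ((continuous_subtype_val : Continuous (Subtype.val : s.1 → G)).tendsto
          ⟨g₀, hg₀⟩).eventually hη
      rw [hrng.isInducing.nhds_eq_comap, eventually_comap] at h1
      refine ⟨η, ?_⟩
      filter_upwards [h1, s.rngProj.isClopen.isOpen.mem_nhds hx₀] with x hx hxs
      obtain ⟨g, hg, rfl⟩ := (CantorInvSemigroup.mem_rngProj s).1 hxs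
      have h2 := hx ⟨g, hg⟩ rfl
      have h3 : V.map g ((N (𝒢.src g)).mkQ ξ) = (N (𝒢.rng g)).mkQ (τ (𝒢.rng g)) := hτ _ g hg rfl
      simp only [h3] at h2
      rwa [map_sub]
    · refine ⟨0, ?_⟩
      filter_upwards [s.rngProj.isClopen.compl.isOpen.mem_nhds hx₀] with x hx
      rw [hτ0 x fun g hg e => hx ((CantorInvSemigroup.mem_rngProj s).2 ⟨g, hg, e⟩)]
      simpa using hε
  · obtain ⟨K, hK⟩ := h.exists_norm_sub_act_lt ξ hε
    refine ⟨s.1.domRestrict 𝒢.rng '' (s.1.domRestrict 𝒢.src ⁻¹' K),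
      (hsrc.isCompact_preimage K.isCompact).image hrng.continuous, fun x hx => ?_⟩
    by_cases hxs : ∀ g ∈ s.1, 𝒢.rng g ≠ x
    · rw [hτ0 x hxs]; simpa using hε
    · push Not at hxs
      obtain ⟨g, hg, rfl⟩ := hxs
      have hgK : 𝒢.src g ∉ K := fun hgK => hx ⟨⟨g, hg⟩, hgK, rfl⟩
      have h1 : V.Rel g (ξ - act (charFun K) ξ) (τ (𝒢.rng g)) :=
        (hτ _ g hg rfl).congr_left (by simpa using h.act_charFun_mem hgK ξ)
      rw [← h1]
      exact (hV _ _).trans_lt ((IsC0Mod.norm_mk_le _ _).trans_lt (hK K le_rfl))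

/-- The inverse semigroup action of a contractive groupoid action. -/
noncomputable def FieldAction.semigroupMap [CompleteSpace E] (V : FieldAction 𝒢 N)
    (h : IsC0Mod N act) (hV : ∀ g v, ‖V.map g v‖ ≤ ‖v‖) (s : S.Elt) : E →ₗ[ℂ] E :=
  have key : ∀ {ζ ζ' ξ : E}, ((∀ g ∈ s.1, V.Rel g ξ ζ) ∧ ∀ x, (∀ g ∈ s.1, 𝒢.rng g ≠ x) → ζ ∈ N x) →
      ((∀ g ∈ s.1, V.Rel g ξ ζ') ∧ ∀ x, (∀ g ∈ s.1, 𝒢.rng g ≠ x) → ζ' ∈ N x) → ζ = ζ' := by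
    intro ζ ζ' ξ h1 h2
    refine h.eq_of_forall_sub_mem fun x => ?_
    by_cases hx : ∀ g ∈ s.1, 𝒢.rng g ≠ x
    · exact sub_mem (h1.2 x hx) (h2.2 x hx)
    · push Not at hx
      obtain ⟨g, hg, rfl⟩ := hx
      exact (h1.1 g hg).sub_mem (h2.1 g hg)
  { toFun := fun ξ => (FieldAction.exists_semigroup_apply h hV s ξ).choose
    map_add' := fun ξ η => by
      have h1 := (FieldAction.exists_semigroup_apply h hV s ξ).choose_spec
      have h2 := (FieldAction.exists_semigroup_apply h hV s η).choose_spec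
      exact key (FieldAction.exists_semigroup_apply h hV s (ξ + η)).choose_spec
        ⟨fun g hg => (h1.1 g hg).add (h2.1 g hg), fun x hx => add_mem (h1.2 x hx) (h2.2 x hx)⟩
    map_smul' := fun z ξ => by
      have h1 := (FieldAction.exists_semigroup_apply h hV s ξ).choose_spec
      exact key (FieldAction.exists_semigroup_apply h hV s (z • ξ)).choose_spec
        ⟨fun g hg => (h1.1 g hg).smul z, fun x hx => Submodule.smul_mem _ _ (h1.2 x hx)⟩ }

theorem FieldAction.inverseSemigroupFormula_semigroupMap [CompleteSpace E] (h : IsC0Mod N act)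
    (hV : ∀ g v, ‖V.map g v‖ ≤ ‖v‖) :
    InverseSemigroupFormula S V fun s => V.semigroupMap h hV s :=
  FieldAction.inverseSemigroupFormula_iff.2 fun s ξ =>
    (FieldAction.exists_semigroup_apply h hV s ξ).choose_spec

/-- The formula forces the semigroup law, and that projections act as characteristic functions. -/
theorem InverseSemigroupFormula.isCompatibleAction (h : IsC0Mod N act)
    (hV : ∀ g v, ‖V.map g v‖ ≤ ‖v‖) {U : S.Elt → E →ₗ[ℂ] E}
    (hU : InverseSemigroupFormula S V fun s => U s) : IsCompatibleAction S N U := by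
  rw [FieldAction.inverseSemigroupFormula_iff] at hU
  have hproj : ∀ (e : S.Proj) ξ, ∀ x ∈ e.set, U e.1 ξ - ξ ∈ N x := by
    intro e ξ x hx
    have := ((hU e.1 ξ).1 _ hx).sub_mem (FieldAction.rel_unit x ξ)
    rwa [𝒢.rng_unit] at this
  refine ⟨fun s t ξ => h.eq_of_forall_sub_mem fun x => ?_, fun s ξ => ?_, hproj, ?_⟩
  · by_cases hx : ∀ g ∈ s.1, 𝒢.rng g ≠ x
    · refine sub_mem ((hU _ _).2 x ?_) ((hU _ _).2 x hx)
      rintro _ ⟨g, hg, k, -, p, rfl⟩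
      rw [𝒢.rng_mul]
      exact hx g hg
    · push Not at hx
      obtain ⟨g, hg, rfl⟩ := hx
      have h1 := (hU s (U t ξ)).1 g hg
      by_cases hk : ∀ k ∈ t.1, 𝒢.rng k ≠ 𝒢.src g
      · refine sub_mem ((hU _ _).2 _ ?_) (h1.mem_of_mem ((hU _ _).2 _ hk))
        rintro _ ⟨g', hg', k, hk', p, rfl⟩ e
        rw [𝒢.rng_mul] at e
        have := s.rng_inj hg' hg e
        subst this
        exact hk k hk' p.symm
      · push Not at hk
        obtain ⟨k, hk, e⟩ := hk
        have h2 := ((hU (s * t) ξ).1 _ (CantorInvSemigroup.mul_mem_mul hg hk e.symm)).sub_mem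
          (((hU t ξ).1 k hk).mul h1)
        rwa [𝒢.rng_mul] at h2
  · refine h.norm_le_of_forall (fun x => ?_) (norm_nonneg _)
    by_cases hx : ∀ g ∈ s.1, 𝒢.rng g ≠ x
    · rw [h.norm_mk_eq_zero.2 ((hU s ξ).2 x hx)]
      exact norm_nonneg _
    · push Not at hx
      obtain ⟨g, hg, rfl⟩ := hx
      have h1 : V.map g ((N (𝒢.src g)).mkQ ξ) = (N (𝒢.rng g)).mkQ (U s ξ) := (hU s ξ).1 g hg
      rw [← h1]
      exact (hV _ _).trans (IsC0Mod.norm_mk_le _ _)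
  · intro e ξ x hx
    refine (hU _ _).2 x fun g hg e' => hx ?_
    rw [← e']
    exact e.rng_mem hg

/-- Two elements agree if they agree on the range of `s`, fibre by fibre, and vanish elsewhere. -/
theorem IsC0Mod.eq_of_slice (h : IsC0Mod N act) (s : S.Elt) {ξ η : E}
    (h1 : ∀ g ∈ s.1, ξ - η ∈ N (𝒢.rng g)) (h2 : ∀ x, (∀ g ∈ s.1, 𝒢.rng g ≠ x) → ξ ∈ N x)
    (h3 : ∀ x, (∀ g ∈ s.1, 𝒢.rng g ≠ x) → η ∈ N x) : ξ = η := by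
  refine h.eq_of_forall_sub_mem fun x => ?_
  by_cases hx : ∀ g ∈ s.1, 𝒢.rng g ≠ x
  · exact sub_mem (h2 x hx) (h3 x hx)
  · push Not at hx
    obtain ⟨g, hg, rfl⟩ := hx
    exact h1 g hg

/-- Two elements agree if they agree on the projection `e`, fibre by fibre, and vanish elsewhere. -/
theorem IsC0Mod.eq_of_proj (h : IsC0Mod N act) (e : S.Proj) {ξ η : E}
    (h1 : ∀ x ∈ e.set, ξ - η ∈ N x) (h2 : ∀ x ∉ e.set, ξ ∈ N x) (h3 : ∀ x ∉ e.set, η ∈ N x) :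
    ξ = η :=
  h.eq_of_forall_sub_mem fun x => by
    by_cases hx : x ∈ e.set
    · exact h1 x hx
    · exact sub_mem (h2 x hx) (h3 x hx)

end Construction

/-! ### The correspondence for `C₀(X)`-algebras -/

section Algebras

variable {G : Type w} {X : Type u} [TopologicalSpace G] [TopologicalSpace X]
  {𝒢 : TopGroupoid G X} {S : CantorInvSemigroup 𝒢} {A : C0Alg.{u, v} X}

theorem GAlgAction.ext_toFieldAction {α α' : GAlgAction 𝒢 A}
    (h : α.toFieldAction = α'.toFieldAction) : α = α' := by
  cases α; cases α'; congr

theorem SAlgAction.ext_map {β β' : SAlgAction S A} (h : ∀ s a, β.map s a = β'.map s a) :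
    β = β' := by
  have : β.map = β'.map := by
    funext s
    ext a
    exact h s a
  cases β; cases β'; congr

theorem SAlgAction.ext_fun {β β' : SAlgAction S A}
    (h : (fun s => (β.map s : A → A)) = fun s => (β'.map s : A → A)) : β = β' :=
  SAlgAction.ext_map fun s => congrFun (congrFun h s)

theorem C0Alg.smul_clopenMul_sub_mem (A : C0Alg.{u, v} X) (e : S.Proj) (f : C₀(X, ℂ)) {x : X}
    (hx : x ∈ e.set) (a : A) :
    A.smul (clopenMul e.set e.isClopen f) a - f x • a ∈ A.null x := by
  have h := A.isC0Mod.act_sub_smul_mem (clopenMul e.set e.isClopen f) x a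
  have h1 : clopenMul e.set e.isClopen f x = f x := Set.indicator_of_mem hx f
  rwa [h1] at h

theorem C0Alg.smul_clopenMul_mem (A : C0Alg.{u, v} X) (e : S.Proj) (f : C₀(X, ℂ)) {x : X}
    (hx : x ∉ e.set) (a : A) :
    A.smul (clopenMul e.set e.isClopen f) a ∈ A.null x :=
  A.isC0Mod.act_mem (Set.indicator_of_notMem hx f) a

variable [LocallyBooleanSpace X]

/-- The maps `α_g` are contractive, as ⋆-homomorphisms between C⋆-algebras. -/
theorem GAlgAction.norm_map_le (α : GAlgAction 𝒢 A) (g : G) (a : A ⧸ A.null (𝒢.src g)) :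
    ‖α.map g a‖ ≤ ‖a‖ := by
  let _ := A.fibreCStarAlgebra (𝒢.src g)
  let _ := A.fibreCStarAlgebra (𝒢.rng g)
  let φ : (A ⧸ A.null (𝒢.src g)) →⋆ₙₐ[ℂ] (A ⧸ A.null (𝒢.rng g)) :=
    { α.map g with
      map_zero' := map_zero (α.map g)
      map_mul' := by
        intro a b
        obtain ⟨a, rfl⟩ := (A.null _).mkQ_surjective a
        obtain ⟨b, rfl⟩ := (A.null _).mkQ_surjective b
        obtain ⟨a', ha⟩ := α.exists_rel g a
        obtain ⟨b', hb⟩ := α.exists_rel g b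
        have h := α.map_prod g a a' b b' ha hb
        have ha : α.map g ((A.null _).mkQ a) = (A.null _).mkQ a' := ha
        have hb : α.map g ((A.null _).mkQ b) = (A.null _).mkQ b' := hb
        change α.map g ((A.null _).mkQ (a * b))
          = A.fibreMul _ (α.map g ((A.null _).mkQ a)) (α.map g ((A.null _).mkQ b))
        rw [ha, hb]
        exact h
      map_star' := by
        intro a
        obtain ⟨a, rfl⟩ := (A.null _).mkQ_surjective a
        obtain ⟨a', ha⟩ := α.exists_rel g a
        have h := α.map_star g a a' ha
        have ha : α.map g ((A.null _).mkQ a) = (A.null _).mkQ a' := ha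
        change α.map g ((A.null _).mkQ (star a)) = A.fibreStar _ (α.map g ((A.null _).mkQ a))
        rw [ha]
        exact h }
  exact NonUnitalStarAlgHom.norm_apply_le φ a

/-- The endomorphism `β_s` that belongs to a groupoid action `α`. -/
noncomputable def GAlgAction.semigroupHom (α : GAlgAction 𝒢 A) (s : S.Elt) : A →⋆ₙₐ[ℂ] A :=
  have h := FieldAction.inverseSemigroupFormula_iff.1
    (α.inverseSemigroupFormula_semigroupMap (S := S) A.isC0Mod α.norm_map_le)
  { α.semigroupMap A.isC0Mod α.norm_map_le s with
    map_zero' := map_zero (α.semigroupMap A.isC0Mod α.norm_map_le s)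
    map_mul' := fun a b => A.isC0Mod.eq_of_slice s
      (fun g hg => ((h s (a * b)).1 g hg).sub_mem
        (α.map_prod g _ _ _ _ ((h s a).1 g hg) ((h s b).1 g hg)))
      (h s (a * b)).2 (fun x hx => A.mul_mem_right ((h s a).2 x hx) _)
    map_star' := fun a => A.isC0Mod.eq_of_slice s
      (fun g hg => ((h s (star a)).1 g hg).sub_mem (α.map_star g _ _ ((h s a).1 g hg)))
      (h s (star a)).2 (fun x hx => A.star_mem ((h s a).2 x hx)) }

theorem GAlgAction.inverseSemigroupFormula_semigroupHom (α : GAlgAction 𝒢 A) :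
    InverseSemigroupFormula S α.toFieldAction fun s => α.semigroupHom s :=
  α.inverseSemigroupFormula_semigroupMap A.isC0Mod α.norm_map_le

/-- Endomorphisms of a `C₀(X)`-algebra which form a compatible action on the field of its fibres
are a compatible action in the algebraic sense. -/
def IsCompatibleAction.toSAlgAction {β : S.Elt → A →⋆ₙₐ[ℂ] A}
    (hU : IsCompatibleAction S A.null fun s => (β s : A →ₗ[ℂ] A)) : SAlgAction S A where
  map := β
  map_mul := hU.mul
  central e a b := A.isC0Mod.eq_of_proj e
    (fun x hx => by
      have h1 := A.mul_mem_right (hU.proj_sub_mem e a x hx) b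
      have h2 := A.mul_mem_left (hU.proj_sub_mem e b x hx) a
      rw [sub_mul] at h1
      rw [mul_sub] at h2
      have := _root_.sub_mem h1 h2
      rwa [sub_sub_sub_cancel_right] at this)
    (fun x hx => A.mul_mem_right (hU.proj_mem e a x hx) b)
    (fun x hx => A.mul_mem_left (hU.proj_mem e b x hx) a)
  compatible e f a := A.isC0Mod.eq_of_proj e
    (fun x hx => by
      have h1 := A.isC0Mod.act_sub_smul_mem f x (β e.1 a)
      have hp : β e.1 a - a ∈ A.null x := hU.proj_sub_mem e a x hx
      have h2 := Submodule.smul_mem _ (f x) hp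
      rw [smul_sub] at h2
      have h3 := add_mem h1 h2
      rw [sub_add_sub_cancel] at h3
      have := _root_.sub_mem h3 (A.smul_clopenMul_sub_mem e f hx a)
      rwa [sub_sub_sub_cancel_right] at this)
    (fun x hx => by
      have h1 := A.isC0Mod.act_sub_smul_mem f x (β e.1 a)
      have hp : β e.1 a ∈ A.null x := hU.proj_mem e a x hx
      have h2 := Submodule.smul_mem _ (f x) hp
      have h3 := add_mem h1 h2
      rwa [sub_add_cancel] at h3)
    (fun x hx => A.smul_clopenMul_mem e f hx a)

/-- The inverse semigroup action that belongs to a groupoid action on a `C₀(X)`-algebra. -/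
noncomputable def GAlgAction.toSAlgAction (S : CantorInvSemigroup 𝒢) (α : GAlgAction 𝒢 A) :
    SAlgAction S A :=
  IsCompatibleAction.toSAlgAction (β := α.semigroupHom)
    (InverseSemigroupFormula.isCompatibleAction A.isC0Mod α.norm_map_le
      α.inverseSemigroupFormula_semigroupHom)

theorem GAlgAction.inverseSemigroupFormula_toSAlgAction (α : GAlgAction 𝒢 A) :
    InverseSemigroupFormula S α.toFieldAction fun s => (α.toSAlgAction S).map s :=
  α.inverseSemigroupFormula_semigroupHom

theorem SAlgAction.isCompatibleAction (β : SAlgAction S A) :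
    IsCompatibleAction S A.null fun s => (β.map s : A →ₗ[ℂ] A) where
  mul := β.map_mul
  norm_le s a := NonUnitalStarAlgHom.norm_apply_le (β.map s) a
  proj_sub_mem e a x hx := by
    obtain ⟨Y, hxY, -⟩ := LocallyBooleanSpace.exists_compactOpens x Set.univ isOpen_univ trivial
    have h1 := A.smul_clopenMul_sub_mem e (charFun Y) hx a
    rw [← β.compatible, charFun_of_mem hxY, one_smul] at h1
    have := sub_mem h1 (A.isC0Mod.act_charFun_sub_mem hxY (β.map e.1 a))
    rwa [sub_sub_sub_cancel_left] at this
  proj_mem e a x hx := by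
    obtain ⟨Y, hxY, -⟩ := LocallyBooleanSpace.exists_compactOpens x Set.univ isOpen_univ trivial
    have h1 := A.smul_clopenMul_mem e (charFun Y) hx a
    rw [← β.compatible] at h1
    exact (A.isC0Mod.act_mem_iff (charFun_of_mem hxY)).1 h1

/-- The groupoid action that belongs to an inverse semigroup action on a `C₀(X)`-algebra. -/
noncomputable def SAlgAction.toGAlgAction (β : SAlgAction S A) : GAlgAction 𝒢 A :=
  have h := β.isCompatibleAction.groupoidFormula A.isC0Mod
  { β.isCompatibleAction.fieldAction A.isC0Mod with
    map_prod := fun g a a₁ b b₁ ha hb => by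
      obtain ⟨s, hs⟩ := S.exists_mem g
      have h1 := h s (a * b) g hs
      refine FieldAction.Rel.congr_right h1 ?_
      have h2 := FieldAction.Rel.sub_mem (h s a g hs) ha
      have h3 := FieldAction.Rel.sub_mem (h s b g hs) hb
      have := A.mul_sub_mul_mem h2 h3
      convert this using 2
      exact _root_.map_mul (β.map s) a b
    map_star := fun g a a₁ ha => by
      obtain ⟨s, hs⟩ := S.exists_mem g
      refine FieldAction.Rel.congr_right (h s (star a) g hs) ?_
      have := A.star_mem (FieldAction.Rel.sub_mem (h s a g hs) ha)
      rw [star_sub] at this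
      convert this using 2
      exact StarHomClass.map_star (β.map s) a }

theorem SAlgAction.groupoidFormula_toGAlgAction (β : SAlgAction S A) :
    GroupoidFormula S β.toGAlgAction.toFieldAction fun s => β.map s :=
  β.isCompatibleAction.groupoidFormula A.isC0Mod

theorem SAlgAction.inverseSemigroupFormula_iff (β : SAlgAction S A) (α : GAlgAction 𝒢 A) :
    InverseSemigroupFormula S α.toFieldAction (fun s => β.map s) ↔
      GroupoidFormula S α.toFieldAction fun s => β.map s :=
  ⟨fun h => h.groupoidFormula, fun h => β.isCompatibleAction.inverseSemigroupFormula h⟩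

theorem GAlgAction.toSAlgAction_eq_iff (β : SAlgAction S A) (α : GAlgAction 𝒢 A) :
    α.toSAlgAction S = β ↔ InverseSemigroupFormula S α.toFieldAction fun s => β.map s :=
  ⟨fun h => h ▸ α.inverseSemigroupFormula_toSAlgAction, fun h =>
    SAlgAction.ext_fun (α.inverseSemigroupFormula_toSAlgAction.unique A.isC0Mod h)⟩

end Algebras

/-! ### The correspondence for Hilbert bimodules -/

section Bimodules

variable {G : Type w} {X : Type u} [TopologicalSpace G] [TopologicalSpace X]
  {𝒢 : TopGroupoid G X} {S : CantorInvSemigroup 𝒢} {A B : C0Alg.{u, v} X}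
  {αA : GAlgAction 𝒢 A} {αB : GAlgAction 𝒢 B} {βA : SAlgAction S A} {βB : SAlgAction S B}
  {M : HilbBimod A B}

theorem GBimodAction.ext_toFieldAction {V V' : GBimodAction αA αB M}
    (h : V.toFieldAction = V'.toFieldAction) : V = V' := by
  cases V; cases V'; congr

theorem SBimodAction.ext_map {U U' : SBimodAction βA βB M} (h : ∀ s ξ, U.map s ξ = U'.map s ξ) :
    U = U' := by
  have : U.map = U'.map := by
    funext s
    ext ξ
    exact h s ξ
  cases U; cases U'; congr

namespace SBimodAction

variable (U : SBimodAction βA βB M)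

theorem map_srcProj (s : S.Elt) (ξ : M.carrier) : U.map s (U.map s.srcProj.1 ξ) = U.map s ξ := by
  rw [← U.map_mul, CantorInvSemigroup.mul_srcProj]

theorem map_star_map (s : S.Elt) (ξ : M.carrier) :
    U.map (star s) (U.map s ξ) = U.map s.srcProj.1 ξ :=
  (U.map_mul _ _ _).symm

end SBimodAction

theorem SBimodAction.ext_fun {U U' : SBimodAction βA βB M}
    (h : (fun s => (U.map s : M.carrier → M.carrier))
      = fun s => (U'.map s : M.carrier → M.carrier)) :
    U = U' :=
  SBimodAction.ext_map fun s => congrFun (congrFun h s)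

/-- If `(f a) ξ = a (f ξ)`, then `π` induces left multiplications of the fibres `A_x` on `E_x`. -/
theorem HilbBimod.π_mem_left (hM : ∀ f a ξ b, M.π (A.smul f a) (M.rsmul ξ b)
    = M.π a (M.rsmul ξ (B.smul f b))) {x : X} {a : A} (ha : a ∈ A.null x) (ξ : M.carrier) :
    M.π a ξ ∈ M.null x := by
  refine M.mem_null_of_forall_rsmul fun b => ?_
  rw [← M.π_rsmul]
  refine A.isC0Mod.map_mem M.isC0Mod (M.πₗ.flip (M.rsmul ξ b)) (M.continuous_π_left _)
    (fun f c hf => ?_) ha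
  change M.π (A.smul f c) (M.rsmul ξ b) ∈ M.null x
  rw [hM, M.rsmul_smul]
  exact M.π_mem_right _ (M.isC0Mod.act_mem hf _)

theorem HilbBimod.π_sub_π_mem (hM : ∀ f a ξ b, M.π (A.smul f a) (M.rsmul ξ b)
    = M.π a (M.rsmul ξ (B.smul f b))) {x : X} {a a' : A} {ξ ξ' : M.carrier}
    (ha : a - a' ∈ A.null x) (hξ : ξ - ξ' ∈ M.null x) : M.π a ξ - M.π a' ξ' ∈ M.null x := by
  have := add_mem (M.π_mem_left hM ha ξ) (M.π_mem_right a' hξ)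
  rw [map_sub, map_sub, LinearMap.sub_apply] at this
  simpa using this

variable [LocallyBooleanSpace X]

theorem GBimodAction.norm_map_le (V : GBimodAction αA αB M) (g : G)
    (ξ : M.carrier ⧸ M.null (𝒢.src g)) : ‖V.map g ξ‖ ≤ ‖ξ‖ := by
  obtain ⟨ξ, rfl⟩ := (M.null _).mkQ_surjective ξ
  obtain ⟨η, hη⟩ := V.exists_rel g ξ
  have h1 : αB.map g ((B.null _).mkQ (M.inner ξ ξ)) = (B.null _).mkQ (M.inner η η) :=
    V.map_inner g ξ η ξ η hη hη
  have h2 : V.map g ((M.null _).mkQ ξ) = (M.null _).mkQ η := hη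
  have h3 : ‖V.map g ((M.null _).mkQ ξ)‖ ^ 2 ≤ ‖(M.null (𝒢.src g)).mkQ ξ‖ ^ 2 := by
    rw [h2, M.norm_mk_sq, M.norm_mk_sq, ← h1]
    exact αB.norm_map_le g _
  exact abs_le_of_sq_le_sq' h3 (norm_nonneg _) |>.2

/-- The inverse semigroup action that belongs to a groupoid action on a Hilbert bimodule. -/
noncomputable def GBimodAction.toSBimodAction (V : GBimodAction αA αB M)
    (hA : InverseSemigroupFormula S αA.toFieldAction fun s => βA.map s)
    (hB : InverseSemigroupFormula S αB.toFieldAction fun s => βB.map s) :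
    SBimodAction βA βB M :=
  have hV := V.inverseSemigroupFormula_semigroupMap (S := S) M.isC0Mod V.norm_map_le
  have hU := hV.isCompatibleAction M.isC0Mod V.norm_map_le
  have h := FieldAction.inverseSemigroupFormula_iff.1 hV
  have hA' := FieldAction.inverseSemigroupFormula_iff.1 hA
  have hB' := FieldAction.inverseSemigroupFormula_iff.1 hB
  { map := V.semigroupMap M.isC0Mod V.norm_map_le
    map_mul := hU.mul
    map_rsmul := fun s ξ b => M.isC0Mod.eq_of_slice s
      (fun g hg => ((h s _).1 g hg).sub_mem
        (V.map_rsmul g _ _ _ _ ((h s ξ).1 g hg) ((hB' s b).1 g hg)))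
      (h s _).2 (fun x hx => M.rsmul_mem_left ((h s ξ).2 x hx) _)
    map_inner := fun s ξ η => B.isC0Mod.eq_of_slice s
      (fun g hg => by
        -- `V_g V_{g⁻¹} = 1` shows that `V_g` maps the class of `U_{s⋆} η` to the class of `η`
        have h1 := (h (star s) η).1 _ (CantorInvSemigroup.inv_mem_star hg)
        obtain ⟨ζ, hζ⟩ := V.exists_rel g (V.semigroupMap M.isC0Mod V.norm_map_le (star s) η)
        have h2 := h1.mul (p := (𝒢.rng_inv g).symm) hζ
        rw [𝒢.mul_inv] at h2
        have h3 := h2.sub_mem (FieldAction.rel_unit (𝒢.rng g) η)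
        rw [𝒢.rng_unit] at h3
        have h4 := hζ.congr_right h3
        have h5 := V.map_inner g _ _ _ _ ((h s ξ).1 g hg) h4
        have := ((hB' s _).1 g hg).sub_mem h5
        rw [← neg_sub]
        exact neg_mem this)
      (fun x hx => M.inner_mem_left ((h s ξ).2 x hx) _) (hB' s _).2
    map_π := fun s a ξ => M.isC0Mod.eq_of_slice s
      (fun g hg => ((h s _).1 g hg).sub_mem
        (V.map_π g _ _ _ _ ((hA' s a).1 g hg) ((h s _).1 g hg)))
      (h s _).2 (fun x hx => M.π_mem_right _ ((h s _).2 x hx))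
    compatible := fun e ξ b => M.isC0Mod.eq_of_proj e
      (fun x hx => by
        have h1 := M.rsmul_mem_left (hU.proj_sub_mem e ξ x hx) b
        have h2 := M.rsmul_mem_right ξ (βB.isCompatibleAction.proj_sub_mem e b x hx)
        rw [map_sub, LinearMap.sub_apply] at h1
        rw [map_sub] at h2
        have := sub_mem h1 h2
        rwa [sub_sub_sub_cancel_right] at this)
      (fun x hx => M.rsmul_mem_left (hU.proj_mem e ξ x hx) b)
      (fun x hx => M.rsmul_mem_right ξ (βB.isCompatibleAction.proj_mem e b x hx))
    compatible_π := fun e a ξ => M.isC0Mod.eq_of_proj e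
      (fun x hx => by
        have h1 := M.π_mem_left V.π_smul (βA.isCompatibleAction.proj_sub_mem e a x hx) ξ
        have h2 := M.π_mem_right a (hU.proj_sub_mem e ξ x hx)
        rw [map_sub, LinearMap.sub_apply] at h1
        rw [map_sub] at h2
        have := sub_mem h1 h2
        rwa [sub_sub_sub_cancel_right] at this)
      (fun x hx => M.π_mem_left V.π_smul (βA.isCompatibleAction.proj_mem e a x hx) ξ)
      (fun x hx => M.π_mem_right a (hU.proj_mem e ξ x hx)) }

theorem GBimodAction.inverseSemigroupFormula_toSBimodAction (V : GBimodAction αA αB M)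
    (hA : InverseSemigroupFormula S αA.toFieldAction fun s => βA.map s)
    (hB : InverseSemigroupFormula S αB.toFieldAction fun s => βB.map s) :
    InverseSemigroupFormula S V.toFieldAction fun s => (V.toSBimodAction hA hB).map s :=
  V.inverseSemigroupFormula_semigroupMap M.isC0Mod V.norm_map_le

namespace SBimodAction

variable (U : SBimodAction βA βB M)

theorem proj_sub_mem (e : S.Proj) (ξ : M.carrier) {x : X} (hx : x ∈ e.set) :
    U.map e.1 ξ - ξ ∈ M.null x :=
  M.mem_null_of_forall_rsmul fun b => by
    rw [map_sub, LinearMap.sub_apply, U.compatible, ← map_sub]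
    exact M.rsmul_mem_right ξ (βB.isCompatibleAction.proj_sub_mem e b x hx)

theorem proj_mem (e : S.Proj) (ξ : M.carrier) {x : X} (hx : x ∉ e.set) :
    U.map e.1 ξ ∈ M.null x :=
  M.mem_null_of_forall_rsmul fun b => by
    rw [U.compatible]
    exact M.rsmul_mem_right ξ (βB.isCompatibleAction.proj_mem e b x hx)

theorem isCompatibleAction : IsCompatibleAction S M.null U.map where
  mul := U.map_mul
  norm_le s ξ := by
    have h1 : ‖U.map s.srcProj.1 ξ‖ ≤ ‖ξ‖ := by
      refine M.isC0Mod.norm_le_of_forall (fun x => ?_) (norm_nonneg _)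
      by_cases hx : x ∈ s.srcProj.set
      · rw [IsC0Mod.mk_eq_iff.2 (U.proj_sub_mem _ ξ hx)]
        exact IsC0Mod.norm_mk_le _ _
      · rw [M.isC0Mod.norm_mk_eq_zero.2 (U.proj_mem _ ξ hx)]
        exact norm_nonneg _
    have h2 : ‖U.map s ξ‖ ^ 2 ≤ ‖ξ‖ ^ 2 := by
      rw [M.norm_sq, U.map_inner, ← U.map_mul]
      refine (NonUnitalStarAlgHom.norm_apply_le (βB.map s) _).trans ?_
      refine (M.norm_inner_le _ _).trans ?_
      rw [sq]
      gcongr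
      exact h1
    exact abs_le_of_sq_le_sq' h2 (norm_nonneg _) |>.2
  proj_sub_mem e ξ _ hx := U.proj_sub_mem e ξ hx
  proj_mem e ξ _ hx := U.proj_mem e ξ hx

theorem continuous_map (s : S.Elt) : Continuous (U.map s) :=
  ((U.map s).mkContinuous 1 fun ξ => by
    rw [one_mul]; exact U.isCompatibleAction.norm_le s ξ).continuous

/-- `⟨ξ, U_e η⟩ = β_e ⟨ξ, η⟩` -/
theorem inner_map_proj (e : S.Proj) (ξ η : M.carrier) :
    M.inner ξ (U.map e.1 η) = βB.map e.1 (M.inner ξ η) :=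
  B.isC0Mod.eq_of_proj e
    (fun x hx => by
      have h1 := M.inner_mem_right ξ (U.proj_sub_mem e η hx)
      rw [M.inner_sub] at h1
      have := sub_mem h1 (βB.isCompatibleAction.proj_sub_mem e (M.inner ξ η) x hx)
      rwa [sub_sub_sub_cancel_right] at this)
    (fun x hx => M.inner_mem_right ξ (U.proj_mem e η hx))
    (fun x hx => βB.isCompatibleAction.proj_mem e (M.inner ξ η) x hx)

/-- `⟨U_s ξ, U_s η⟩ = β_s ⟨ξ, η⟩` -/
theorem inner_map_map (s : S.Elt) (ξ η : M.carrier) :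
    M.inner (U.map s ξ) (U.map s η) = βB.map s (M.inner ξ η) := by
  rw [U.map_inner, U.map_star_map, U.inner_map_proj, ← βB.map_mul,
    CantorInvSemigroup.mul_srcProj]

theorem map_proj_π (e : S.Proj) (a : A) (ξ : M.carrier) :
    U.map e.1 (M.π a ξ) = M.π a (U.map e.1 ξ) :=
  M.isC0Mod.eq_of_proj e
    (fun x hx => by
      have h1 := U.proj_sub_mem e (M.π a ξ) hx
      have h2 := M.π_mem_right a (U.proj_sub_mem e ξ hx)
      rw [map_sub] at h2
      have := sub_mem h1 h2
      rwa [sub_sub_sub_cancel_right] at this)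
    (fun x hx => U.proj_mem e _ hx) (fun x hx => M.π_mem_right a (U.proj_mem e ξ hx))

/-- `U_s π(a) = π(β_s(a)) U_s` -/
theorem map_π' (s : S.Elt) (a : A) (ξ : M.carrier) :
    U.map s (M.π a ξ) = M.π (βA.map s a) (U.map s ξ) := by
  have h := U.map_π s a (U.map s ξ)
  rwa [U.map_star_map, ← U.map_proj_π, U.map_srcProj, U.map_srcProj] at h

include U in
/-- Left multiplication by the products of `a` with `1_e (1 - 1_{f₁}) ⋯ (1 - 1_{fₙ})` does not
depend on these factors in the fibre at `x ∈ e \ (f₁ ∪ ⋯ ∪ fₙ)`. -/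
theorem π_mem_left_of_action {x : X} {a : A} (ha : a ∈ A.null x) (ξ : M.carrier) :
    M.π a ξ ∈ M.null x := by
  rw [← M.isC0Mod.norm_mk_eq_zero]
  refine le_antisymm (le_of_forall_pos_le_add fun ε hε => ?_) (norm_nonneg _)
  let C : Set A := {b | ∀ ζ, M.π b ζ - M.π a ζ ∈ M.null x}
  have h1 : ∀ b ∈ C, ∀ e : S.Proj, x ∈ e.set → (βA.map e.1 : A →ₗ[ℂ] A) b ∈ C := by
    intro b hb e he ζ
    change M.π (βA.map e.1 b) ζ - M.π a ζ ∈ M.null x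
    rw [U.compatible_π]
    have h2 := M.π_mem_right b (U.proj_sub_mem e ζ he)
    rw [map_sub] at h2
    have := add_mem h2 (hb ζ)
    rwa [sub_add_sub_cancel] at this
  have h2 : ∀ b ∈ C, ∀ f : S.Proj, x ∉ f.set → b - (βA.map f.1 : A →ₗ[ℂ] A) b ∈ C := by
    intro b hb f hf ζ
    change M.π (b - βA.map f.1 b) ζ - M.π a ζ ∈ M.null x
    rw [map_sub, LinearMap.sub_apply, U.compatible_π, sub_right_comm]
    exact sub_mem (hb ζ) (M.π_mem_right b (U.proj_mem f ζ hf))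
  obtain ⟨b, hb, hbε⟩ := βA.isCompatibleAction.exists_norm_le_of_mem A.isC0Mod h1 h2 (ξ := a)
    (fun ζ => by rw [sub_self]; exact zero_mem _) ha (ε := ε / (‖ξ‖ + 1)) (by positivity)
  rw [← IsC0Mod.mk_eq_iff.2 (hb ξ), zero_add]
  refine (IsC0Mod.norm_mk_le _ _).trans ((M.norm_π_le b ξ).trans ?_)
  calc ‖b‖ * ‖ξ‖ ≤ ε / (‖ξ‖ + 1) * ‖ξ‖ := by gcongr
    _ ≤ ε := by
      rw [div_mul_eq_mul_div, div_le_iff₀ (by positivity)]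
      nlinarith [norm_nonneg ξ]

include U in
/-- Compatibility with `S` forces compatibility with the `C₀(X)`-structures. -/
theorem π_smul (f : C₀(X, ℂ)) (a : A) (ξ : M.carrier) (b : B) :
    M.π (A.smul f a) (M.rsmul ξ b) = M.π a (M.rsmul ξ (B.smul f b)) :=
  M.isC0Mod.eq_of_forall_sub_mem fun x => by
    have h1 := U.π_mem_left_of_action (A.isC0Mod.act_sub_smul_mem f x a) (M.rsmul ξ b)
    have h2 := M.isC0Mod.act_sub_smul_mem f x (M.π a (M.rsmul ξ b))
    rw [M.rsmul_smul, M.π_act]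
    rw [map_sub, LinearMap.sub_apply, map_smul, LinearMap.smul_apply] at h1
    have := sub_mem h1 h2
    rwa [sub_sub_sub_cancel_right] at this

/-- The groupoid action that belongs to an inverse semigroup action on a Hilbert bimodule. -/
noncomputable def toGBimodAction
    (hA : GroupoidFormula S αA.toFieldAction fun s => βA.map s)
    (hB : GroupoidFormula S αB.toFieldAction fun s => βB.map s) : GBimodAction αA αB M :=
  have h := U.isCompatibleAction.groupoidFormula M.isC0Mod
  { U.isCompatibleAction.fieldAction M.isC0Mod with
    map_rsmul := fun g ξ ξ₁ b b₁ hξ hb => by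
      obtain ⟨s, hs⟩ := S.exists_mem g
      refine FieldAction.Rel.congr_right (h s (M.rsmul ξ b) g hs) ?_
      beta_reduce
      rw [U.map_rsmul]
      exact M.rsmul_sub_rsmul_mem (FieldAction.Rel.sub_mem (h s ξ g hs) hξ)
        (FieldAction.Rel.sub_mem (hB s b g hs) hb)
    map_inner := fun g ξ ξ₁ η η₁ hξ hη => by
      obtain ⟨s, hs⟩ := S.exists_mem g
      refine FieldAction.Rel.congr_right (hB s (M.inner ξ η) g hs) ?_
      beta_reduce
      rw [← U.inner_map_map]
      exact M.inner_sub_inner_mem (FieldAction.Rel.sub_mem (h s ξ g hs) hξ)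
        (FieldAction.Rel.sub_mem (h s η g hs) hη)
    map_π := fun g a a₁ ξ ξ₁ ha hξ => by
      obtain ⟨s, hs⟩ := S.exists_mem g
      refine FieldAction.Rel.congr_right (h s (M.π a ξ) g hs) ?_
      beta_reduce
      rw [U.map_π']
      exact M.π_sub_π_mem U.π_smul (FieldAction.Rel.sub_mem (hA s a g hs) ha)
        (FieldAction.Rel.sub_mem (h s ξ g hs) hξ)
    π_smul := U.π_smul }

theorem groupoidFormula_toGBimodAction
    (hA : GroupoidFormula S αA.toFieldAction fun s => βA.map s)
    (hB : GroupoidFormula S αB.toFieldAction fun s => βB.map s) :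
    GroupoidFormula S (U.toGBimodAction hA hB).toFieldAction fun s => U.map s :=
  U.isCompatibleAction.groupoidFormula M.isC0Mod

theorem inverseSemigroupFormula_iff (V : GBimodAction αA αB M) :
    InverseSemigroupFormula S V.toFieldAction (fun s => U.map s) ↔
      GroupoidFormula S V.toFieldAction fun s => U.map s :=
  ⟨fun h => h.groupoidFormula, fun h => U.isCompatibleAction.inverseSemigroupFormula h⟩

end SBimodAction

end Bimodules

/-! ### Morphisms and the equivalence of categories -/

section Morphisms

variable {G : Type w} {X : Type u} [TopologicalSpace G] [TopologicalSpace X]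
  {𝒢 : TopGroupoid G X} {S : CantorInvSemigroup 𝒢}

namespace GHom

variable {M N : GHilbBimod.{u, w, v} 𝒢} (φ : GHom M N)

theorem homA_mem {x : X} {a : M.A} (ha : a ∈ M.A.null x) : φ.homA a ∈ N.A.null x := by
  let ψ : M.A →⋆ₙₐ[ℂ] N.A := φ.homA
  refine M.A.isC0Mod.map_mem N.A.isC0Mod (ψ : M.A →ₗ[ℂ] N.A) ψ.continuous_of_cstar
    (fun f a hf => ?_) ha
  have h : ψ (M.A.smul f a) = N.A.smul f (ψ a) := φ.smulA f a
  change ψ (M.A.smul f a) ∈ _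
  rw [h]
  exact N.A.isC0Mod.act_mem hf _

theorem homB_mem {x : X} {b : M.B} (hb : b ∈ M.B.null x) : φ.homB b ∈ N.B.null x := by
  let ψ : M.B →⋆ₙₐ[ℂ] N.B := φ.homB
  refine M.B.isC0Mod.map_mem N.B.isC0Mod (ψ : M.B →ₗ[ℂ] N.B) ψ.continuous_of_cstar
    (fun f b hf => ?_) hb
  have h : ψ (M.B.smul f b) = N.B.smul f (ψ b) := φ.smulB f b
  change ψ (M.B.smul f b) ∈ _
  rw [h]
  exact N.B.isC0Mod.act_mem hf _

theorem homE_mem {x : X} {ξ : M.M.carrier} (hξ : ξ ∈ M.M.null x) : φ.homE ξ ∈ N.M.null x := by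
  refine Submodule.topologicalClosure_minimal _ (t := (N.M.null x).comap φ.homE.toLinearMap)
    (Submodule.span_le.2 ?_) ((N.M.isC0Mod.isClosed x).preimage φ.homE.continuous) hξ
  rintro _ ⟨f, ξ, b, hf, rfl⟩
  change φ.homE (M.M.rsmul ξ (M.B.smul f b)) ∈ N.M.null x
  have h : φ.homE (M.M.rsmul ξ (M.B.smul f b)) = N.M.rsmul (φ.homE ξ) (φ.homB (M.B.smul f b)) :=
    φ.hom_rsmul _ _
  rw [h]
  exact N.M.rsmul_mem_right _ (φ.homB_mem (M.B.isC0Mod.act_mem hf b))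

end GHom

/-- A map which intertwines groupoid actions on the fibres intertwines the associated inverse
semigroup actions. -/
theorem InverseSemigroupFormula.equivariant [LocallyBooleanSpace X] {E E' : Type v}
    [NormedAddCommGroup E] [NormedSpace ℂ E] [NormedAddCommGroup E'] [NormedSpace ℂ E']
    {N : X → Submodule ℂ E} {N' : X → Submodule ℂ E'} {act' : C₀(X, ℂ) →ₗ[ℂ] E' →ₗ[ℂ] E'}
    (h' : IsC0Mod N' act') {V : FieldAction 𝒢 N} {V' : FieldAction 𝒢 N'} {U : S.Elt → E → E}
    {U' : S.Elt → E' → E'} (hU : InverseSemigroupFormula S V U)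
    (hU' : InverseSemigroupFormula S V' U') {T : E → E'}
    (hT : ∀ x, ∀ ξ ∈ N x, T ξ ∈ N' x) (hTV : ∀ g ξ η, V.Rel g ξ η → V'.Rel g (T ξ) (T η))
    (s : S.Elt) (ξ : E) : T (U s ξ) = U' s (T ξ) := by
  rw [FieldAction.inverseSemigroupFormula_iff] at hU hU'
  exact h'.eq_of_slice s (fun g hg => (hTV g _ _ ((hU s ξ).1 g hg)).sub_mem ((hU' s _).1 g hg))
    (fun x hx => hT x _ ((hU s ξ).2 x hx)) (hU' s _).2

/-- A linear map which intertwines inverse semigroup actions intertwines the associated groupoid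
actions on the fibres. -/
theorem GroupoidFormula.equivariant {E E' : Type v}
    [NormedAddCommGroup E] [NormedSpace ℂ E] [NormedAddCommGroup E'] [NormedSpace ℂ E']
    {N : X → Submodule ℂ E} {N' : X → Submodule ℂ E'}
    {V : FieldAction 𝒢 N} {V' : FieldAction 𝒢 N'} {U : S.Elt → E → E}
    {U' : S.Elt → E' → E'} (hU : GroupoidFormula S V U)
    (hU' : GroupoidFormula S V' U') (T : E →ₗ[ℂ] E')
    (hT : ∀ x, ∀ ξ ∈ N x, T ξ ∈ N' x) (hTU : ∀ s ξ, T (U s ξ) = U' s (T ξ)) {g : G} {ξ η : E}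
    (h : V.Rel g ξ η) : V'.Rel g (T ξ) (T η) := by
  obtain ⟨s, hs⟩ := S.exists_mem g
  have h1 : V'.Rel g (T ξ) (U' s (T ξ)) := hU' s (T ξ) g hs
  have h2 : V.Rel g ξ (U s ξ) := hU s ξ g hs
  refine h1.congr_right ?_
  rw [← hTU, ← map_sub]
  exact hT _ _ (h2.sub_mem h)

variable [LocallyBooleanSpace X]

/-- An equivariant ⋆-homomorphism between compatible `S`-Hilbert C⋆-algebras induces maps between
the fibres. -/
theorem SAlgAction.hom_mem {A A' : C0Alg.{u, v} X} (β : SAlgAction S A) (β' : SAlgAction S A')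
    (φ : A →⋆ₙₐ[ℂ] A') (hφ : ∀ s a, φ (β.map s a) = β'.map s (φ a)) {x : X} {a : A}
    (ha : a ∈ A.null x) : φ a ∈ A'.null x := by
  rw [← A'.isC0Mod.norm_mk_eq_zero]
  refine le_antisymm (le_of_forall_pos_le_add fun ε hε => ?_) (norm_nonneg _)
  let C : Set A := {b | φ b - φ a ∈ A'.null x}
  have h1 : ∀ b ∈ C, ∀ e : S.Proj, x ∈ e.set → (β.map e.1 : A →ₗ[ℂ] A) b ∈ C := by
    intro b hb e he
    change φ (β.map e.1 b) - φ a ∈ A'.null x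
    rw [hφ]
    have h2 : β'.map e.1 (φ b) - φ b ∈ A'.null x :=
      β'.isCompatibleAction.proj_sub_mem e (φ b) x he
    have := add_mem h2 hb
    rwa [sub_add_sub_cancel] at this
  have h2 : ∀ b ∈ C, ∀ f : S.Proj, x ∉ f.set → b - (β.map f.1 : A →ₗ[ℂ] A) b ∈ C := by
    intro b hb f hf
    change φ (b - β.map f.1 b) - φ a ∈ A'.null x
    rw [map_sub, hφ, sub_right_comm]
    exact sub_mem hb (β'.isCompatibleAction.proj_mem f (φ b) x hf)
  obtain ⟨b, hb, hbε⟩ := β.isCompatibleAction.exists_norm_le_of_mem A.isC0Mod h1 h2 (ξ := a)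
    (by change φ a - φ a ∈ A'.null x; rw [sub_self]; exact zero_mem _) ha hε
  rw [← IsC0Mod.mk_eq_iff.2 hb, zero_add]
  exact (IsC0Mod.norm_mk_le _ _).trans ((NonUnitalStarAlgHom.norm_apply_le φ b).trans hbε)

/-- Equivariance forces `C₀(X)`-linearity. -/
theorem SAlgAction.hom_smul {A A' : C0Alg.{u, v} X} (β : SAlgAction S A) (β' : SAlgAction S A')
    (φ : A →⋆ₙₐ[ℂ] A') (hφ : ∀ s a, φ (β.map s a) = β'.map s (φ a)) (f : C₀(X, ℂ)) (a : A) :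
    φ (A.smul f a) = A'.smul f (φ a) :=
  A'.isC0Mod.eq_of_forall_sub_mem fun x => by
    have h1 := β.hom_mem β' φ hφ (A.isC0Mod.act_sub_smul_mem f x a)
    rw [map_sub, map_smul] at h1
    have := sub_mem h1 (A'.isC0Mod.act_sub_smul_mem f x (φ a))
    rwa [sub_sub_sub_cancel_right] at this

theorem SHom.homE_mem {M N : SHilbBimod.{u, w, v} S} (φ : SHom M N) {x : X} {ξ : M.M.carrier}
    (hξ : ξ ∈ M.M.null x) : φ.homE ξ ∈ N.M.null x := by
  refine Submodule.topologicalClosure_minimal _ (t := (N.M.null x).comap φ.homE.toLinearMap)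
    (Submodule.span_le.2 ?_) ((N.M.isC0Mod.isClosed x).preimage φ.homE.continuous) hξ
  rintro _ ⟨f, ξ, b, hf, rfl⟩
  change φ.homE (M.M.rsmul ξ (M.B.smul f b)) ∈ N.M.null x
  have h : φ.homE (M.M.rsmul ξ (M.B.smul f b)) = N.M.rsmul (φ.homE ξ) (φ.homB (M.B.smul f b)) :=
    φ.hom_rsmul _ _
  rw [h]
  exact N.M.rsmul_mem_right _
    (M.βB.hom_mem N.βB φ.homB φ.equivB (M.B.isC0Mod.act_mem hf b))

end Morphisms

/-- An endofunctor is the identity if it fixes all objects and does not change the morphisms of an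
underlying category. -/
theorem functor_eq_id_of_faithful {C : Type*} {D : Type*} [Category C] [Category D] (U : C ⥤ D)
    [U.Faithful] {F : C ⥤ C} (hFU : F ⋙ U = U) (hF : ∀ M, F.obj M = M) : F = 𝟭 C := by
  refine CategoryTheory.Functor.ext hF fun M N φ => U.map_injective ?_
  rw [Functor.map_comp, Functor.map_comp, eqToHom_map, eqToHom_map]
  exact CategoryTheory.Functor.congr_hom hFU φ

section Functors

variable {G : Type w} {X : Type u} [TopologicalSpace G] [TopologicalSpace X]
  {𝒢 : TopGroupoid G X} (S : CantorInvSemigroup 𝒢) [LocallyBooleanSpace X]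

/-- The inverse semigroup actions that belong to the groupoid actions of a `𝒢`-Hilbert bimodule. -/
noncomputable def GHilbBimod.toSHilbBimod (M : GHilbBimod.{u, w, v} 𝒢) :
    SHilbBimod.{u, w, v} S where
  A := M.A
  B := M.B
  βA := M.αA.toSAlgAction S
  βB := M.αB.toSAlgAction S
  M := M.M
  U := M.V.toSBimodAction M.αA.inverseSemigroupFormula_toSAlgAction
    M.αB.inverseSemigroupFormula_toSAlgAction

/-- The functor from `𝒢`-Hilbert bimodules to compatible `S`-Hilbert bimodules. -/
noncomputable def toSFunctor : GHilbBimod.{u, w, v} 𝒢 ⥤ SHilbBimod.{u, w, v} S where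
  obj M := M.toSHilbBimod S
  map {M N} φ :=
    { φ.toBimodHom with
      equivA := fun s a => InverseSemigroupFormula.equivariant N.A.isC0Mod
        M.αA.inverseSemigroupFormula_toSAlgAction N.αA.inverseSemigroupFormula_toSAlgAction
        (T := φ.homA) (fun _ _ => GHom.homA_mem φ) φ.equivA s a
      equivB := fun s b => InverseSemigroupFormula.equivariant N.B.isC0Mod
        M.αB.inverseSemigroupFormula_toSAlgAction N.αB.inverseSemigroupFormula_toSAlgAction
        (T := φ.homB) (fun _ _ => GHom.homB_mem φ) φ.equivB s b
      equivE := fun s ξ => InverseSemigroupFormula.equivariant N.M.isC0Mod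
        (M.V.inverseSemigroupFormula_toSBimodAction M.αA.inverseSemigroupFormula_toSAlgAction
          M.αB.inverseSemigroupFormula_toSAlgAction)
        (N.V.inverseSemigroupFormula_toSBimodAction N.αA.inverseSemigroupFormula_toSAlgAction
          N.αB.inverseSemigroupFormula_toSAlgAction)
        (T := φ.homE) (fun _ _ => GHom.homE_mem φ) φ.equivE s ξ }
  map_id _ := rfl
  map_comp _ _ := rfl

variable {S}

/-- The groupoid actions that belong to the inverse semigroup actions of a compatible `S`-Hilbert
bimodule. -/
noncomputable def SHilbBimod.toGHilbBimod (M : SHilbBimod.{u, w, v} S) :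
    GHilbBimod.{u, w, v} 𝒢 where
  A := M.A
  B := M.B
  αA := M.βA.toGAlgAction
  αB := M.βB.toGAlgAction
  M := M.M
  V := M.U.toGBimodAction M.βA.groupoidFormula_toGAlgAction M.βB.groupoidFormula_toGAlgAction

variable (S)

/-- The functor from compatible `S`-Hilbert bimodules to `𝒢`-Hilbert bimodules. -/
noncomputable def toGFunctor : SHilbBimod.{u, w, v} S ⥤ GHilbBimod.{u, w, v} 𝒢 where
  obj M := M.toGHilbBimod
  map {M N} φ :=
    { φ.toBimodHom with
      smulA := M.βA.hom_smul N.βA φ.homA φ.equivA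
      smulB := M.βB.hom_smul N.βB φ.homB φ.equivB
      equivA := fun _ _ _ h => GroupoidFormula.equivariant M.βA.groupoidFormula_toGAlgAction
        N.βA.groupoidFormula_toGAlgAction (LinearMapClass.linearMap (F := M.A →⋆ₙₐ[ℂ] N.A) φ.homA)
        (fun _ _ => M.βA.hom_mem N.βA φ.homA φ.equivA) φ.equivA h
      equivB := fun _ _ _ h => GroupoidFormula.equivariant M.βB.groupoidFormula_toGAlgAction
        N.βB.groupoidFormula_toGAlgAction (LinearMapClass.linearMap (F := M.B →⋆ₙₐ[ℂ] N.B) φ.homB)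
        (fun _ _ => M.βB.hom_mem N.βB φ.homB φ.equivB) φ.equivB h
      equivE := fun _ _ _ h => GroupoidFormula.equivariant
        (M.U.groupoidFormula_toGBimodAction M.βA.groupoidFormula_toGAlgAction
          M.βB.groupoidFormula_toGAlgAction)
        (N.U.groupoidFormula_toGBimodAction N.βA.groupoidFormula_toGAlgAction
          N.βB.groupoidFormula_toGAlgAction)
        φ.homE.toLinearMap (fun _ _ => SHom.homE_mem φ) φ.equivE h }
  map_id _ := rfl
  map_comp _ _ := rfl

variable {S}

omit [LocallyBooleanSpace X] in
theorem GHilbBimod.mk_congr {A B : C0Alg.{u, v} X} {αA αA' : GAlgAction 𝒢 A}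
    {αB αB' : GAlgAction 𝒢 B} {M : HilbBimod A B} {V : GBimodAction αA αB M}
    {V' : GBimodAction αA' αB' M} (hA : αA = αA') (hB : αB = αB')
    (hV : V.toFieldAction = V'.toFieldAction) :
    (⟨A, B, αA, αB, M, V⟩ : GHilbBimod.{u, w, v} 𝒢) = ⟨A, B, αA', αB', M, V'⟩ := by
  subst hA hB
  rw [GBimodAction.ext_toFieldAction hV]

omit [LocallyBooleanSpace X] in
theorem SHilbBimod.mk_congr {A B : C0Alg.{u, v} X} {βA βA' : SAlgAction S A}
    {βB βB' : SAlgAction S B} {M : HilbBimod A B} {U : SBimodAction βA βB M}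
    {U' : SBimodAction βA' βB' M} (hA : βA = βA') (hB : βB = βB')
    (hU : (fun s => (U.map s : M.carrier → M.carrier))
      = fun s => (U'.map s : M.carrier → M.carrier)) :
    (⟨A, B, βA, βB, M, U⟩ : SHilbBimod.{u, w, v} S) = ⟨A, B, βA', βB', M, U'⟩ := by
  subst hA hB
  rw [SBimodAction.ext_fun hU]

/-- The functor assigns `U` to `V` if and only if these actions satisfy the formulas. -/
theorem toSHilbBimod_eq_iff {A B : C0Alg.{u, v} X} {αA : GAlgAction 𝒢 A} {αB : GAlgAction 𝒢 B}
    {βA : SAlgAction S A} {βB : SAlgAction S B} {M : HilbBimod A B} {V : GBimodAction αA αB M}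
    {U : SBimodAction βA βB M} :
    (toSFunctor S).obj ⟨A, B, αA, αB, M, V⟩ = ⟨A, B, βA, βB, M, U⟩ ↔
      InverseSemigroupFormula S αA.toFieldAction (fun s => βA.map s) ∧
      InverseSemigroupFormula S αB.toFieldAction (fun s => βB.map s) ∧
      InverseSemigroupFormula S V.toFieldAction (fun s => U.map s) := by
  constructor
  · intro h
    have hA : αA.toSAlgAction S = βA := by
      injection h
    have hB : αB.toSAlgAction S = βB := by
      injection h
    subst hA hB
    have hU : V.toSBimodAction αA.inverseSemigroupFormula_toSAlgAction
        αB.inverseSemigroupFormula_toSAlgAction = U := by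
      injection h
    subst hU
    exact ⟨αA.inverseSemigroupFormula_toSAlgAction, αB.inverseSemigroupFormula_toSAlgAction,
      V.inverseSemigroupFormula_toSBimodAction _ _⟩
  · rintro ⟨hA, hB, hV⟩
    exact SHilbBimod.mk_congr ((GAlgAction.toSAlgAction_eq_iff βA αA).2 hA)
      ((GAlgAction.toSAlgAction_eq_iff βB αB).2 hB)
      ((V.inverseSemigroupFormula_toSBimodAction _ _).unique M.isC0Mod hV)

theorem toGHilbBimod_toSHilbBimod (M : GHilbBimod.{u, w, v} 𝒢) :
    (M.toSHilbBimod S).toGHilbBimod = M :=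
  GHilbBimod.mk_congr
    (GAlgAction.ext_toFieldAction (FieldAction.ext_of_groupoidFormula
      (M.αA.toSAlgAction S).groupoidFormula_toGAlgAction
      M.αA.inverseSemigroupFormula_toSAlgAction.groupoidFormula))
    (GAlgAction.ext_toFieldAction (FieldAction.ext_of_groupoidFormula
      (M.αB.toSAlgAction S).groupoidFormula_toGAlgAction
      M.αB.inverseSemigroupFormula_toSAlgAction.groupoidFormula))
    (FieldAction.ext_of_groupoidFormula
      ((M.toSHilbBimod S).U.groupoidFormula_toGBimodAction _ _)
      (M.V.inverseSemigroupFormula_toSBimodAction M.αA.inverseSemigroupFormula_toSAlgAction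
        M.αB.inverseSemigroupFormula_toSAlgAction).groupoidFormula)

theorem toSHilbBimod_toGHilbBimod (M : SHilbBimod.{u, w, v} S) :
    (M.toGHilbBimod).toSHilbBimod S = M :=
  toSHilbBimod_eq_iff.2
    ⟨M.βA.isCompatibleAction.inverseSemigroupFormula M.βA.groupoidFormula_toGAlgAction,
      M.βB.isCompatibleAction.inverseSemigroupFormula M.βB.groupoidFormula_toGAlgAction,
      M.U.isCompatibleAction.inverseSemigroupFormula (M.U.groupoidFormula_toGBimodAction _ _)⟩

variable (S)

instance : (forgetG.{u, w, v} 𝒢).Faithful where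
  map_injective h := GHom.ext (congrArg BimodHom.homA h) (congrArg BimodHom.homB h)
    (congrArg BimodHom.homE h)

instance : (forgetS.{u, w, v} S).Faithful where
  map_injective h := SHom.ext (congrArg BimodHom.homA h) (congrArg BimodHom.homB h)
    (congrArg BimodHom.homE h)

theorem toSFunctor_comp_toGFunctor :
    toSFunctor.{u, w, v} S ⋙ toGFunctor S = 𝟭 (GHilbBimod.{u, w, v} 𝒢) :=
  functor_eq_id_of_faithful (forgetG 𝒢) rfl (fun M => toGHilbBimod_toSHilbBimod (S := S) M)

theorem toGFunctor_comp_toSFunctor :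
    toGFunctor.{u, w, v} S ⋙ toSFunctor S = 𝟭 (SHilbBimod.{u, w, v} S) :=
  functor_eq_id_of_faithful (forgetS S) rfl (fun M => toSHilbBimod_toGHilbBimod (S := S) M)

/-- The equivalence between `𝒢`-Hilbert bimodules and compatible `S`-Hilbert bimodules. -/
noncomputable def bimodEquivalence : GHilbBimod.{u, w, v} 𝒢 ≌ SHilbBimod.{u, w, v} S :=
  CategoryTheory.Equivalence.mk (toSFunctor S) (toGFunctor S)
    (eqToIso (toSFunctor_comp_toGFunctor S).symm) (eqToIso (toGFunctor_comp_toSFunctor S))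

end Functors

/-! ### Elementary tensors and the fibres -/

section Density

variable {E F : Type*} [NormedAddCommGroup E] [NormedSpace ℂ E] [NormedAddCommGroup F]
  [NormedSpace ℂ F]

theorem Submodule.mem_of_dense_span {D : Set E}
    (hD : (Submodule.span ℂ D).topologicalClosure = ⊤) {P : Submodule ℂ E}
    (hP : IsClosed (P : Set E)) (h : ∀ ξ ∈ D, ξ ∈ P) (ξ : E) : ξ ∈ P :=
  Submodule.topologicalClosure_minimal _ (Submodule.span_le.2 h) hP (hD ▸ Submodule.mem_top)

theorem LinearMap.eq_of_dense_span {D : Set E}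
    (hD : (Submodule.span ℂ D).topologicalClosure = ⊤) {T T' : E →ₗ[ℂ] F} (hT : Continuous T)
    (hT' : Continuous T') (h : ∀ ξ ∈ D, T ξ = T' ξ) (ξ : E) : T ξ = T' ξ :=
  Submodule.mem_of_dense_span hD (P := LinearMap.eqLocus T T') (isClosed_eq hT hT') h ξ

end Density

theorem HilbMod.eq_of_dense_inner {X : Type u} [TopologicalSpace X] {B : C0Alg.{u, v} X}
    (E : HilbMod B) {D : Set E.carrier} (hD : (Submodule.span ℂ D).topologicalClosure = ⊤)
    {ξ η : E.carrier} (h : ∀ ζ ∈ D, E.inner ζ ξ = E.inner ζ η) : ξ = η := by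
  refine E.eq_of_forall_inner fun ζ => ?_
  have : E.innerₗ ξ ζ = E.innerₗ η ζ := by
    refine LinearMap.eq_of_dense_span hD (E.continuous_inner_right ξ) (E.continuous_inner_right η)
      (fun ζ hζ => ?_) ζ
    change E.inner ξ ζ = E.inner η ζ
    rw [← E.star_inner, h ζ hζ, E.star_inner]
  rw [← E.star_inner]
  change star (E.innerₗ ξ ζ) = _
  rw [this]
  exact E.star_inner _ _

/-- If `(f a) ξ = a (f ξ)` holds for the vectors `ξ` in `E B`, then it holds throughout. -/
theorem HilbBimod.π_smul_eq_act {X : Type u} [TopologicalSpace X] {A B : C0Alg.{u, v} X}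
    {M : HilbBimod A B} (hM : ∀ f a ξ b, M.π (A.smul f a) (M.rsmul ξ b)
      = M.π a (M.rsmul ξ (B.smul f b))) (f : C₀(X, ℂ)) (a : A) (ξ : M.carrier) :
    M.π (A.smul f a) ξ = M.act f (M.π a ξ) :=
  M.mem_of_forall_rsmul_mem (ξ := ξ)
    (N := LinearMap.eqLocus (M.π (A.smul f a)) (M.act f ∘ₗ M.π a))
    (isClosed_eq (M.continuous_π_right _)
      ((M.isC0Mod.continuous_act f).comp (M.continuous_π_right a)))
    fun b => by
      change M.π (A.smul f a) (M.rsmul ξ b) = M.act f (M.π a (M.rsmul ξ b))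
      rw [hM, M.rsmul_smul, M.π_act]

section Tensor

variable {X : Type u} [TopologicalSpace X]

namespace IsInternalTensor

variable {A B C : C0Alg.{u, v} X} {M : HilbBimod A B} {N : HilbBimod B C} {P : HilbBimod A C}
  {t : M.carrier →ₗ[ℂ] N.carrier →ₗ[ℂ] P.carrier} (ht : IsInternalTensor M N P t)
include ht

theorem norm_le (ξ : M.carrier) (η : N.carrier) : ‖t ξ η‖ ≤ ‖ξ‖ * ‖η‖ := by
  have h : ‖t ξ η‖ ^ 2 ≤ (‖ξ‖ * ‖η‖) ^ 2 := by
    rw [P.norm_sq, ht.inner]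
    calc _ ≤ ‖η‖ * (‖M.inner ξ ξ‖ * ‖η‖) :=
          (N.norm_inner_le _ _).trans (by gcongr; exact N.norm_π_le _ _)
      _ = _ := by rw [← M.norm_sq]; ring
  exact abs_le_of_sq_le_sq' h (by positivity) |>.2

theorem act_right (f : C₀(X, ℂ)) (ξ : M.carrier) (η : N.carrier) :
    t ξ (N.act f η) = P.act f (t ξ η) :=
  P.eq_of_dense_inner ht.dense <| by
    rintro _ ⟨ξ', η', rfl⟩
    rw [P.inner_act, ht.inner, ht.inner, N.π_act, N.inner_act]

theorem act_left (hN : ∀ f b η c, N.π (B.smul f b) (N.rsmul η c)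
    = N.π b (N.rsmul η (C.smul f c))) (f : C₀(X, ℂ)) (ξ : M.carrier) (η : N.carrier) :
    t (M.act f ξ) η = P.act f (t ξ η) :=
  P.eq_of_dense_inner ht.dense <| by
    rintro _ ⟨ξ', η', rfl⟩
    rw [P.inner_act, ht.inner, ht.inner, M.inner_act, N.π_smul_eq_act hN, N.inner_act]

theorem mem_right {x : X} (ξ : M.carrier) {η : N.carrier} (hη : η ∈ N.null x) :
    t ξ η ∈ P.null x :=
  N.isC0Mod.map_mem P.isC0Mod (t ξ) ((t ξ).mkContinuous ‖ξ‖ (ht.norm_le ξ)).continuous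
    (fun f η hf => by rw [ht.act_right]; exact P.isC0Mod.act_mem hf _) hη

theorem mem_left (hN : ∀ f b η c, N.π (B.smul f b) (N.rsmul η c)
    = N.π b (N.rsmul η (C.smul f c))) {x : X} {ξ : M.carrier} (hξ : ξ ∈ M.null x)
    (η : N.carrier) : t ξ η ∈ P.null x :=
  M.isC0Mod.map_mem P.isC0Mod (t.flip η) ((t.flip η).mkContinuous ‖η‖
      fun ξ => (ht.norm_le ξ η).trans_eq (mul_comm _ _)).continuous
    (fun f ξ hf => by
      rw [LinearMap.flip_apply, ht.act_left hN]; exact P.isC0Mod.act_mem hf _) hξ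

end IsInternalTensor

namespace IsC0Tensor

variable {A₁ A₂ A : C0Alg.{u, v} X} {t : A₁ →ₗ[ℂ] A₂ →ₗ[ℂ] A}

theorem flip (ht : IsC0Tensor A₁ A₂ A t) : IsC0Tensor A₂ A₁ A t.flip where
  mul a a₁ b b₁ := ht.mul b b₁ a a₁
  star a b := ht.star b a
  smul_left f a b := ht.smul_right f b a
  smul_right f a b := ht.smul_left f b a
  dense := by
    have : {c | ∃ a b, t.flip a b = c} = {c | ∃ a b, t a b = c} := by
      ext c
      exact exists_comm
    rw [this]
    exact ht.dense

/-- For `‖a‖ ≤ 1` this holds since `(ac ⊗ b)⋆(ac ⊗ b) + (c - hc ⊗ b)⋆(c - hc ⊗ b)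
= (c ⊗ b)⋆(c ⊗ b)`, where `(1 - h)² = 1 - a⋆a`. -/
theorem norm_mul_left_le (ht : IsC0Tensor A₁ A₂ A t) (a c : A₁) (b : A₂) :
    ‖t (a * c) b‖ ≤ ‖a‖ * ‖t c b‖ := by
  have key : ∀ a : A₁, ‖a‖ ≤ 1 → ‖t (a * c) b‖ ≤ ‖t c b‖ := by
    intro a ha
    obtain ⟨h, hh, hha⟩ := exists_one_sub_sq a ha
    refine norm_le_of_star_mul_self_add' _ (t (c - h * c) b) _ ?_
    rw [ht.star, ht.star, ht.star, ht.mul, ht.mul, ht.mul, ← LinearMap.add_apply, ← map_add]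
    congr 2
    rw [star_mul, star_sub, star_mul, hh]
    have h1 : Star.star c * Star.star a * (a * c) = Star.star c * (Star.star a * a) * c := by
      noncomm_ring
    rw [h1, ← hha]
    noncomm_ring
  rcases eq_or_ne a 0 with rfl | ha
  · simp
  have hn : 0 < ‖a‖ := norm_pos_iff.2 ha
  have h1 := key (((‖a‖⁻¹ : ℝ) : ℂ) • a) (by rw [norm_smul]; simp [hn.ne'])
  rwa [smul_mul_assoc, map_smul, LinearMap.smul_apply, norm_smul, Complex.norm_real, norm_inv,
    norm_norm, inv_mul_le_iff₀ hn] at h1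

/-- Every C⋆-seminorm on the algebraic tensor product is a cross-seminorm. -/
theorem norm_le (ht : IsC0Tensor A₁ A₂ A t) (a : A₁) (b : A₂) : ‖t a b‖ ≤ ‖a‖ * ‖b‖ := by
  -- for selfadjoint `c` and `d`, `‖c ⊗ d‖² = ‖c c ⊗ d d‖ ≤ ‖c‖ ‖d‖ ‖c ⊗ d‖`
  have key : ∀ c d, Star.star c = c → Star.star d = d → ‖t c d‖ ≤ ‖c‖ * ‖d‖ := by
    intro c d hc hd
    have h1 : ‖t c d‖ * ‖t c d‖ ≤ ‖c‖ * ‖d‖ * ‖t c d‖ := by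
      rw [← CStarRing.norm_star_mul_self, ht.star, ht.mul, hc, hd, mul_assoc]
      exact (ht.norm_mul_left_le c c (d * d)).trans (by
        gcongr; exact ht.flip.norm_mul_left_le d d c)
    rcases (norm_nonneg (t c d)).eq_or_lt with h0 | h0
    · rw [← h0]; positivity
    · exact le_of_mul_le_mul_right h1 h0
  have h1 : ‖t a b‖ * ‖t a b‖ ≤ (‖a‖ * ‖b‖) * (‖a‖ * ‖b‖) := by
    rw [← CStarRing.norm_star_mul_self, ht.star, ht.mul]
    refine (key _ _ (by simp) (by simp)).trans_eq ?_
    rw [CStarRing.norm_star_mul_self, CStarRing.norm_star_mul_self]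
    ring
  exact abs_le_of_sq_le_sq' (by simpa [sq] using h1) (by positivity) |>.2

theorem mem_right (ht : IsC0Tensor A₁ A₂ A t) {x : X} (a : A₁) {b : A₂} (hb : b ∈ A₂.null x) :
    t a b ∈ A.null x :=
  A₂.isC0Mod.map_mem A.isC0Mod (t a) ((t a).mkContinuous ‖a‖ (ht.norm_le a)).continuous
    (fun f b hf => by rw [ht.smul_right]; exact A.isC0Mod.act_mem hf _) hb

theorem mem_left (ht : IsC0Tensor A₁ A₂ A t) {x : X} {a : A₁} (ha : a ∈ A₁.null x) (b : A₂) :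
    t a b ∈ A.null x :=
  ht.flip.mem_right b ha

end IsC0Tensor

namespace IsExternalTensor

variable {A₁ B₁ A₂ B₂ A B : C0Alg.{u, v} X} {tA : A₁ →ₗ[ℂ] A₂ →ₗ[ℂ] A}
  {tB : B₁ →ₗ[ℂ] B₂ →ₗ[ℂ] B} {M : HilbBimod A₁ B₁} {N : HilbBimod A₂ B₂} {P : HilbBimod A B}
  {t : M.carrier →ₗ[ℂ] N.carrier →ₗ[ℂ] P.carrier} (hB : IsC0Tensor B₁ B₂ B tB)
  (ht : IsExternalTensor tA tB M N P t)
include hB ht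

theorem norm_le (ξ : M.carrier) (η : N.carrier) : ‖t ξ η‖ ≤ ‖ξ‖ * ‖η‖ := by
  have h : ‖t ξ η‖ ^ 2 ≤ (‖ξ‖ * ‖η‖) ^ 2 := by
    rw [P.norm_sq, ht.inner, mul_pow, M.norm_sq, N.norm_sq]
    exact hB.norm_le _ _
  exact abs_le_of_sq_le_sq' h (by positivity) |>.2

theorem act_right (f : C₀(X, ℂ)) (ξ : M.carrier) (η : N.carrier) :
    t ξ (N.act f η) = P.act f (t ξ η) :=
  P.eq_of_dense_inner ht.dense <| by
    rintro _ ⟨ξ', η', rfl⟩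
    rw [P.inner_act, ht.inner, ht.inner, N.inner_act, hB.smul_right]

theorem act_left (f : C₀(X, ℂ)) (ξ : M.carrier) (η : N.carrier) :
    t (M.act f ξ) η = P.act f (t ξ η) :=
  P.eq_of_dense_inner ht.dense <| by
    rintro _ ⟨ξ', η', rfl⟩
    rw [P.inner_act, ht.inner, ht.inner, M.inner_act, hB.smul_left]

theorem mem_right {x : X} (ξ : M.carrier) {η : N.carrier} (hη : η ∈ N.null x) :
    t ξ η ∈ P.null x :=
  N.isC0Mod.map_mem P.isC0Mod (t ξ) ((t ξ).mkContinuous ‖ξ‖ (ht.norm_le hB ξ)).continuous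
    (fun f η hf => by rw [ht.act_right hB]; exact P.isC0Mod.act_mem hf _) hη

theorem mem_left {x : X} {ξ : M.carrier} (hξ : ξ ∈ M.null x) (η : N.carrier) :
    t ξ η ∈ P.null x :=
  M.isC0Mod.map_mem P.isC0Mod (t.flip η) ((t.flip η).mkContinuous ‖η‖
      fun ξ => (ht.norm_le hB ξ η).trans_eq (mul_comm _ _)).continuous
    (fun f ξ hf => by
      rw [LinearMap.flip_apply, ht.act_left hB]; exact P.isC0Mod.act_mem hf _) hξ

end IsExternalTensor

end Tensor

/-! ### Diagonal actions correspond to diagonal actions -/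

theorem LinearMap.sub_mem_of_mem {E₁ E₂ E : Type*} [AddCommGroup E₁] [Module ℂ E₁]
    [AddCommGroup E₂] [Module ℂ E₂] [AddCommGroup E] [Module ℂ E] {N₁ : Submodule ℂ E₁}
    {N₂ : Submodule ℂ E₂} {N : Submodule ℂ E} {t : E₁ →ₗ[ℂ] E₂ →ₗ[ℂ] E}
    (h₁ : ∀ ξ ∈ N₁, ∀ η, t ξ η ∈ N) (h₂ : ∀ ξ, ∀ η ∈ N₂, t ξ η ∈ N) {ξ ξ' : E₁} {η η' : E₂}
    (hξ : ξ - ξ' ∈ N₁) (hη : η - η' ∈ N₂) : t ξ η - t ξ' η' ∈ N := by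
  have := add_mem (h₁ _ hξ η) (h₂ ξ' _ hη)
  rw [map_sub, map_sub, LinearMap.sub_apply] at this
  simpa using this

section Diagonal

variable {G : Type w} {X : Type u} [TopologicalSpace G] [TopologicalSpace X]
  {𝒢 : TopGroupoid G X} {S : CantorInvSemigroup 𝒢} [LocallyBooleanSpace X]
  {E₁ E₂ E : Type v} [NormedAddCommGroup E₁] [NormedSpace ℂ E₁] [NormedAddCommGroup E₂]
  [NormedSpace ℂ E₂] [NormedAddCommGroup E] [NormedSpace ℂ E]
  {N₁ : X → Submodule ℂ E₁} {N₂ : X → Submodule ℂ E₂} {N : X → Submodule ℂ E}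
  {act : C₀(X, ℂ) →ₗ[ℂ] E →ₗ[ℂ] E} {V₁ : FieldAction 𝒢 N₁} {V₂ : FieldAction 𝒢 N₂}
  {V : FieldAction 𝒢 N} {U₁ : S.Elt → E₁ → E₁} {U₂ : S.Elt → E₂ → E₂} {U : S.Elt → E → E}
  {t : E₁ →ₗ[ℂ] E₂ →ₗ[ℂ] E}

/-- Diagonal groupoid actions correspond to diagonal inverse semigroup actions, if `ξ ⊗ η` is defined
on the fibres. -/
theorem gDiagonal_iff_sDiagonal (h : IsC0Mod N act)
    (hU₁ : InverseSemigroupFormula S V₁ U₁) (hU₂ : InverseSemigroupFormula S V₂ U₂)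
    (hU : InverseSemigroupFormula S V U) (h₁ : ∀ x, ∀ ξ ∈ N₁ x, ∀ η, t ξ η ∈ N x)
    (h₂ : ∀ x ξ, ∀ η ∈ N₂ x, t ξ η ∈ N x) :
    GDiagonal V₁ V₂ t V ↔ SDiagonal U₁ U₂ t U := by
  rw [FieldAction.inverseSemigroupFormula_iff] at hU₁ hU₂ hU
  constructor
  · intro hV s ξ η
    exact h.eq_of_slice s
      (fun g hg => ((hU s _).1 g hg).sub_mem
        (hV g _ _ _ _ ((hU₁ s ξ).1 g hg) ((hU₂ s η).1 g hg)))
      (hU s _).2 (fun x hx => h₁ x _ ((hU₁ s ξ).2 x hx) _)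
  · intro hd g ξ ξ₁ η η₁ hξ hη
    obtain ⟨s, hs⟩ := S.exists_mem g
    have h3 := (hU s (t ξ η)).1 g hs
    rw [hd] at h3
    exact h3.congr_right (LinearMap.sub_mem_of_mem (h₁ _) (h₂ _)
      (((hU₁ s ξ).1 g hs).sub_mem hξ) (((hU₂ s η).1 g hs).sub_mem hη))

end Diagonal

section Transport

variable {G : Type w} {X : Type u} [TopologicalSpace G] [TopologicalSpace X]
  {𝒢 : TopGroupoid G X} {S : CantorInvSemigroup 𝒢} [LocallyBooleanSpace X]
  {E₁ E₂ : Type v} [NormedAddCommGroup E₁] [NormedSpace ℂ E₁] [NormedAddCommGroup E₂]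
  [NormedSpace ℂ E₂] {N₁ : X → Submodule ℂ E₁} {N₂ : X → Submodule ℂ E₂}
  {V₁ : FieldAction 𝒢 N₁} {V₂ : FieldAction 𝒢 N₂}
  {U₁ : S.Elt → E₁ → E₁} {U₂ : S.Elt → E₂ → E₂} {A B : C0Alg.{u, v} X}

/-- A unique diagonal inverse semigroup action on an algebra gives a unique diagonal groupoid
action. -/
theorem existsUnique_gAlgAction {t : E₁ →ₗ[ℂ] E₂ →ₗ[ℂ] A}
    (hU₁ : InverseSemigroupFormula S V₁ U₁) (hU₂ : InverseSemigroupFormula S V₂ U₂)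
    (h₁ : ∀ x, ∀ ξ ∈ N₁ x, ∀ η, t ξ η ∈ A.null x)
    (h₂ : ∀ x ξ, ∀ η ∈ N₂ x, t ξ η ∈ A.null x)
    (h : ∃! β : SAlgAction S A, SDiagonal U₁ U₂ t fun s => β.map s) :
    ∃! α : GAlgAction 𝒢 A, GDiagonal V₁ V₂ t α.toFieldAction := by
  obtain ⟨β, hβ, hβu⟩ := h
  have hf : InverseSemigroupFormula S β.toGAlgAction.toFieldAction fun s => β.map s :=
    (β.inverseSemigroupFormula_iff _).2 β.groupoidFormula_toGAlgAction
  refine ⟨β.toGAlgAction, (gDiagonal_iff_sDiagonal A.isC0Mod hU₁ hU₂ hf h₁ h₂).2 hβ,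
    fun α hα => ?_⟩
  have h3 := hβu (α.toSAlgAction S) ((gDiagonal_iff_sDiagonal A.isC0Mod hU₁ hU₂
    α.inverseSemigroupFormula_toSAlgAction h₁ h₂).1 hα)
  rw [GAlgAction.toSAlgAction_eq_iff] at h3
  exact GAlgAction.ext_toFieldAction
    (FieldAction.ext_of_groupoidFormula h3.groupoidFormula hf.groupoidFormula)

/-- A unique diagonal inverse semigroup action on a bimodule gives a unique diagonal groupoid
action. -/
theorem existsUnique_gBimodAction {αA : GAlgAction 𝒢 A} {αB : GAlgAction 𝒢 B}
    {βA : SAlgAction S A} {βB : SAlgAction S B} {P : HilbBimod A B}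
    {t : E₁ →ₗ[ℂ] E₂ →ₗ[ℂ] P.carrier}
    (hA : InverseSemigroupFormula S αA.toFieldAction fun s => βA.map s)
    (hB : InverseSemigroupFormula S αB.toFieldAction fun s => βB.map s)
    (hU₁ : InverseSemigroupFormula S V₁ U₁) (hU₂ : InverseSemigroupFormula S V₂ U₂)
    (h₁ : ∀ x, ∀ ξ ∈ N₁ x, ∀ η, t ξ η ∈ P.null x)
    (h₂ : ∀ x ξ, ∀ η ∈ N₂ x, t ξ η ∈ P.null x)
    (h : ∃! U : SBimodAction βA βB P, SDiagonal U₁ U₂ t fun s => U.map s) :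
    ∃! V : GBimodAction αA αB P, GDiagonal V₁ V₂ t V.toFieldAction := by
  obtain ⟨U, hU, hUu⟩ := h
  let V' := U.toGBimodAction hA.groupoidFormula hB.groupoidFormula
  have hf : InverseSemigroupFormula S V'.toFieldAction fun s => U.map s :=
    (U.inverseSemigroupFormula_iff _).2 (U.groupoidFormula_toGBimodAction _ _)
  refine ⟨V', (gDiagonal_iff_sDiagonal P.isC0Mod hU₁ hU₂ hf h₁ h₂).2 hU, fun V hV => ?_⟩
  have hf' := V.inverseSemigroupFormula_toSBimodAction hA hB
  have h3 := hUu _ ((gDiagonal_iff_sDiagonal P.isC0Mod hU₁ hU₂ hf' h₁ h₂).1 hV)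
  rw [h3] at hf'
  exact GBimodAction.ext_toFieldAction
    (FieldAction.ext_of_groupoidFormula hf'.groupoidFormula hf.groupoidFormula)

end Transport

/-! ### Existence and uniqueness of diagonal inverse semigroup actions -/

section Extension

variable {X : Type u} [TopologicalSpace X] {B : C0Alg.{u, v} X} (P : HilbMod B)

namespace HilbMod

variable {P}

theorem norm_le_of_inner_map {u : P.carrier →ₗ[ℂ] P.carrier} {β : B →⋆ₙₐ[ℂ] B}
    (h : ∀ ζ ζ', P.inner (u ζ) (u ζ') = β (P.inner ζ ζ')) (ζ : P.carrier) : ‖u ζ‖ ≤ ‖ζ‖ := by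
  have h1 : ‖u ζ‖ ^ 2 ≤ ‖ζ‖ ^ 2 := by
    rw [P.norm_sq, P.norm_sq, h]
    exact NonUnitalStarAlgHom.norm_apply_le β _
  exact abs_le_of_sq_le_sq' h1 (norm_nonneg _) |>.2

theorem continuous_of_inner_map {u : P.carrier →ₗ[ℂ] P.carrier} {β : B →⋆ₙₐ[ℂ] B}
    (h : ∀ ζ ζ', P.inner (u ζ) (u ζ') = β (P.inner ζ ζ')) : Continuous u :=
  (u.mkContinuous 1 fun ζ => by rw [one_mul]; exact norm_le_of_inner_map h ζ).continuous

/-- A map which preserves inner products along `β` is automatically `β`-linear. -/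
theorem map_rsmul_of_inner_map {u : P.carrier →ₗ[ℂ] P.carrier} {β : B →⋆ₙₐ[ℂ] B}
    (h : ∀ ζ ζ', P.inner (u ζ) (u ζ') = β (P.inner ζ ζ')) (ζ : P.carrier) (b : B) :
    u (P.rsmul ζ b) = P.rsmul (u ζ) (β b) := by
  rw [← sub_eq_zero]
  apply P.eq_zero_of_inner_self
  simp only [P.inner_sub, P.inner_sub_left, P.inner_rsmul, P.inner_rsmul_left, h, map_mul,
    map_star, mul_assoc]
  abel

/-- A bilinear map on elementary tensors which preserves inner products along `β` extends to the
completed tensor product. -/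
theorem exists_extension {E₁ E₂ : Type*} [AddCommGroup E₁] [Module ℂ E₁] [AddCommGroup E₂]
    [Module ℂ E₂] {t : E₁ →ₗ[ℂ] E₂ →ₗ[ℂ] P.carrier}
    (ht : (Submodule.span ℂ {ζ | ∃ ξ η, t ξ η = ζ}).topologicalClosure = ⊤)
    {T : E₁ →ₗ[ℂ] E₂ →ₗ[ℂ] P.carrier} {β : B →⋆ₙₐ[ℂ] B}
    (h : ∀ ξ ξ' η η', P.inner (T ξ η) (T ξ' η') = β (P.inner (t ξ η) (t ξ' η'))) :
    ∃ u : P.carrier →ₗ[ℂ] P.carrier, (∀ ξ η, u (t ξ η) = T ξ η) ∧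
      ∀ ζ ζ', P.inner (u ζ) (u ζ') = β (P.inner ζ ζ') := by
  let t' := TensorProduct.lift t
  let T' := TensorProduct.lift T
  have h1 : ∀ ξ η z, P.inner (T ξ η) (T' z) = β (P.inner (t ξ η) (t' z)) := by
    intro ξ η z
    induction z using TensorProduct.induction_on with
    | zero => simp [P.inner_zero]
    | tmul ξ' η' => exact h ξ ξ' η η'
    | add z z' hz hz' => rw [map_add, map_add, P.inner_add, P.inner_add, hz, hz', map_add]
  have h2 : ∀ z z', P.inner (T' z) (T' z') = β (P.inner (t' z) (t' z')) := by
    intro z z'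
    induction z using TensorProduct.induction_on with
    | zero => simp [P.inner_zero_left]
    | tmul ξ η => exact h1 ξ η z'
    | add z z' hz hz' =>
      rw [map_add, map_add, P.inner_add_left, P.inner_add_left, hz, hz', map_add]
  have hnorm : ∀ z, ‖T' z‖ ≤ 1 * ‖t' z‖ := by
    intro z
    have h3 : ‖T' z‖ ^ 2 ≤ ‖t' z‖ ^ 2 := by
      rw [P.norm_sq, P.norm_sq, h2]
      exact NonUnitalStarAlgHom.norm_apply_le β _
    rw [one_mul]
    exact abs_le_of_sq_le_sq' h3 (norm_nonneg _) |>.2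
  have hdense : DenseRange t' := by
    have hle : Submodule.span ℂ {ζ | ∃ ξ η, t ξ η = ζ} ≤ LinearMap.range t' := by
      refine Submodule.span_le.2 ?_
      rintro _ ⟨ξ, η, rfl⟩
      exact ⟨ξ ⊗ₜ η, TensorProduct.lift.tmul _ _⟩
    intro ζ
    have h3 : ζ ∈ (Submodule.span ℂ {ζ | ∃ ξ η, t ξ η = ζ}).topologicalClosure :=
      ht ▸ Submodule.mem_top
    exact closure_mono hle h3
  let u := T'.extendOfNorm t'
  have hu : ∀ z, u (t' z) = T' z := LinearMap.extendOfNorm_eq hdense ⟨1, hnorm⟩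
  refine ⟨u, fun ξ η => hu (ξ ⊗ₜ η), fun ζ ζ' => ?_⟩
  have h4 : ∀ z ζ', P.inner (u (t' z)) (u ζ') = β (P.inner (t' z) ζ') := by
    intro z ζ'
    refine hdense.induction_on (p := fun ζ' => P.inner (u (t' z)) (u ζ') = β (P.inner (t' z) ζ')) ζ'
      (isClosed_eq ((P.continuous_inner_right _).comp u.continuous)
        (β.continuous_of_cstar.comp (P.continuous_inner_right _))) fun z' => ?_
    rw [hu, hu, h2]
  exact hdense.induction_on (p := fun ζ => P.inner (u ζ) (u ζ') = β (P.inner ζ ζ')) ζ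
    (isClosed_eq ((P.continuous_inner_left _).comp u.continuous)
      (β.continuous_of_cstar.comp (P.continuous_inner_left _))) fun z => h4 z ζ'

end HilbMod

end Extension

section Constructor

variable {G : Type w} {X : Type u} [TopologicalSpace G] [TopologicalSpace X]
  {𝒢 : TopGroupoid G X} {S : CantorInvSemigroup 𝒢} [LocallyBooleanSpace X] {A B : C0Alg.{u, v} X}

/-- A compatible action on the field of fibres of a Hilbert bimodule, which preserves the inner
products and intertwines the left multiplications, is a compatible action in the algebraic sense. -/
def IsCompatibleAction.toSBimodAction {P : HilbBimod A B} {T : S.Elt → P.carrier →ₗ[ℂ] P.carrier}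
    (hT : IsCompatibleAction S P.null T) {βA : SAlgAction S A} {βB : SAlgAction S B}
    (h : ∀ s ζ ζ', P.inner (T s ζ) (T s ζ') = βB.map s (P.inner ζ ζ'))
    (hπ : ∀ s a ζ, T s (P.π a ζ) = P.π (βA.map s a) (T s ζ))
    (hπ' : ∀ f a ζ, P.π (A.smul f a) ζ = P.act f (P.π a ζ)) : SBimodAction βA βB P where
  map := T
  map_mul := hT.mul
  map_rsmul s ζ b := HilbMod.map_rsmul_of_inner_map (h s) ζ b
  -- `⟨T_s ζ, ζ'⟩ = ⟨T_s ζ, T_{s s⋆} ζ'⟩ = β_s ⟨ζ, T_{s⋆} ζ'⟩`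
  map_inner s ζ ζ' := by
    rw [← h, ← hT.mul]
    have hs : T s ζ = T s.rngProj.1 (T s ζ) := by
      rw [← hT.mul, CantorInvSemigroup.rngProj_mul]
    refine B.isC0Mod.eq_of_proj s.rngProj (fun x hx => ?_) (fun x hx => ?_) (fun x hx => ?_)
    · rw [← P.inner_sub, ← neg_sub]
      exact P.inner_mem_right _ (neg_mem (hT.proj_sub_mem s.rngProj ζ' x hx))
    · rw [hs]
      exact P.inner_mem_left (hT.proj_mem _ _ x hx) _
    · exact P.inner_mem_right _ (hT.proj_mem s.rngProj ζ' x hx)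
  map_π s a ζ := hπ s a _
  compatible e ζ b := P.isC0Mod.eq_of_proj e
    (fun x hx => by
      have h1 := P.rsmul_mem_left (hT.proj_sub_mem e ζ x hx) b
      have h2 := P.rsmul_mem_right ζ (βB.isCompatibleAction.proj_sub_mem e b x hx)
      rw [map_sub, LinearMap.sub_apply] at h1
      rw [map_sub] at h2
      have := _root_.sub_mem h1 h2
      rwa [sub_sub_sub_cancel_right] at this)
    (fun x hx => P.rsmul_mem_left (hT.proj_mem e ζ x hx) b)
    (fun x hx => P.rsmul_mem_right ζ (βB.isCompatibleAction.proj_mem e b x hx))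
  compatible_π e a ζ :=
    have hP : ∀ f a ξ b, P.π (A.smul f a) (P.rsmul ξ b) = P.π a (P.rsmul ξ (B.smul f b)) :=
      fun f a ξ b => by rw [hπ', P.rsmul_smul, P.π_act]
    P.isC0Mod.eq_of_proj e
      (fun x hx => by
        have h1 := P.π_mem_left hP (βA.isCompatibleAction.proj_sub_mem e a x hx) ζ
        have h2 := P.π_mem_right a (hT.proj_sub_mem e ζ x hx)
        rw [map_sub, LinearMap.sub_apply] at h1
        rw [map_sub] at h2
        have := _root_.sub_mem h1 h2
        rwa [sub_sub_sub_cancel_right] at this)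
      (fun x hx => P.π_mem_left hP (βA.isCompatibleAction.proj_mem e a x hx) ζ)
      (fun x hx => P.π_mem_right a (hT.proj_mem e ζ x hx))

variable {E₁ E₂ : Type v} [NormedAddCommGroup E₁] [NormedSpace ℂ E₁] [NormedAddCommGroup E₂]
  [NormedSpace ℂ E₂] {N₁ : X → Submodule ℂ E₁} {N₂ : X → Submodule ℂ E₂}
  {U₁ : S.Elt → E₁ →ₗ[ℂ] E₁} {U₂ : S.Elt → E₂ →ₗ[ℂ] E₂}

omit [LocallyBooleanSpace X] in
/-- Contractions which are diagonal on elementary tensors form a compatible action on the field of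
fibres, if the factors do. -/
theorem IsCompatibleAction.tensor {E : Type v} [NormedAddCommGroup E] [NormedSpace ℂ E]
    {N : X → Submodule ℂ E} (hN : ∀ x, IsClosed (N x : Set E))
    (hU₁ : IsCompatibleAction S N₁ U₁) (hU₂ : IsCompatibleAction S N₂ U₂)
    {t : E₁ →ₗ[ℂ] E₂ →ₗ[ℂ] E}
    (ht : (Submodule.span ℂ {ζ | ∃ ξ η, t ξ η = ζ}).topologicalClosure = ⊤)
    (h₁ : ∀ x, ∀ ξ ∈ N₁ x, ∀ η, t ξ η ∈ N x) (h₂ : ∀ x ξ, ∀ η ∈ N₂ x, t ξ η ∈ N x)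
    {T : S.Elt → E →ₗ[ℂ] E} (hT : ∀ s ζ, ‖T s ζ‖ ≤ ‖ζ‖)
    (hd : ∀ s ξ η, T s (t ξ η) = t (U₁ s ξ) (U₂ s η)) : IsCompatibleAction S N T := by
  have hc : ∀ s, Continuous (T s) := fun s =>
    ((T s).mkContinuous 1 fun ζ => by rw [one_mul]; exact hT s ζ).continuous
  refine ⟨fun s s' => ?_, hT, fun e ζ x hx => ?_, fun e ζ x hx => ?_⟩
  · refine LinearMap.eq_of_dense_span (T := T (s * s')) (T' := T s ∘ₗ T s') ht (hc _)
      ((hc _).comp (hc _)) ?_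
    rintro _ ⟨ξ, η, rfl⟩
    rw [LinearMap.comp_apply, hd, hd, hd, hU₁.mul, hU₂.mul]
  · have hc' : Continuous ⇑(T e.1 - LinearMap.id : E →ₗ[ℂ] E) := (hc e.1).sub continuous_id
    refine Submodule.mem_of_dense_span ht (P := (N x).comap (T e.1 - LinearMap.id))
      ((hN x).preimage hc') ?_ ζ
    rintro _ ⟨ξ, η, rfl⟩
    change T e.1 (t ξ η) - t ξ η ∈ N x
    rw [hd]
    exact LinearMap.sub_mem_of_mem (h₁ x) (h₂ x) (hU₁.proj_sub_mem e ξ x hx)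
      (hU₂.proj_sub_mem e η x hx)
  · refine Submodule.mem_of_dense_span ht (P := (N x).comap (T e.1))
      ((hN x).preimage (hc _)) ?_ ζ
    rintro _ ⟨ξ, η, rfl⟩
    change T e.1 (t ξ η) ∈ N x
    rw [hd]
    exact h₁ x _ (hU₁.proj_mem e ξ x hx) _

/-- Existence and uniqueness of the diagonal action on a Hilbert bimodule generated by elementary
tensors. The equivariance `hπ` of the left multiplication has to be tested on elementary tensors
only, for the extension `u` of `ξ ⊗ η ↦ U₁_s ξ ⊗ U₂_s η`. -/
theorem existsUnique_sBimodAction {P : HilbBimod A B} (hU₁ : IsCompatibleAction S N₁ U₁)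
    (hU₂ : IsCompatibleAction S N₂ U₂) {t : E₁ →ₗ[ℂ] E₂ →ₗ[ℂ] P.carrier}
    (ht : (Submodule.span ℂ {ζ | ∃ ξ η, t ξ η = ζ}).topologicalClosure = ⊤)
    (h₁ : ∀ x, ∀ ξ ∈ N₁ x, ∀ η, t ξ η ∈ P.null x) (h₂ : ∀ x ξ, ∀ η ∈ N₂ x, t ξ η ∈ P.null x)
    {βA : SAlgAction S A} {βB : SAlgAction S B}
    (h : ∀ s ξ ξ' η η', P.inner (t (U₁ s ξ) (U₂ s η)) (t (U₁ s ξ') (U₂ s η'))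
      = βB.map s (P.inner (t ξ η) (t ξ' η')))
    (hπ : ∀ s, ∀ u : P.carrier →ₗ[ℂ] P.carrier, Continuous u →
      (∀ ξ η, u (t ξ η) = t (U₁ s ξ) (U₂ s η)) →
      ∀ a ξ η, u (P.π a (t ξ η)) = P.π (βA.map s a) (t (U₁ s ξ) (U₂ s η)))
    (hπ' : ∀ f a ζ, P.π (A.smul f a) ζ = P.act f (P.π a ζ)) :
    ∃! U : SBimodAction βA βB P,
      SDiagonal (fun s => U₁ s) (fun s => U₂ s) t (fun s => U.map s) := by
  choose T hd hi using fun s => HilbMod.exists_extension (P := P.toHilbMod) ht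
    (T := t.compl₁₂ (U₁ s) (U₂ s)) (h s)
  have hc := fun s => HilbMod.continuous_of_inner_map (hi s)
  have hT : IsCompatibleAction S P.null T := hU₁.tensor P.isC0Mod.isClosed hU₂ ht h₁ h₂
    (fun s => HilbMod.norm_le_of_inner_map (hi s)) hd
  refine ⟨hT.toSBimodAction hi (fun s a => ?_) hπ', hd, fun U hU => SBimodAction.ext_map fun s => ?_⟩
  · refine LinearMap.eq_of_dense_span (T := T s ∘ₗ P.π a) (T' := P.π (βA.map s a) ∘ₗ T s) ht
      ((hc s).comp (P.continuous_π_right a)) ((P.continuous_π_right _).comp (hc s)) ?_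
    rintro _ ⟨ξ, η, rfl⟩
    rw [LinearMap.comp_apply, LinearMap.comp_apply, hπ s _ (hc s) (hd s), hd]
    rfl
  · refine LinearMap.eq_of_dense_span ht (U.continuous_map s) (hc s) ?_
    rintro _ ⟨ξ, η, rfl⟩
    exact (hU s ξ η).trans (hd s ξ η).symm

end Constructor

section Existence

variable {G : Type w} {X : Type u} [TopologicalSpace G] [TopologicalSpace X]
  {𝒢 : TopGroupoid G X} {S : CantorInvSemigroup 𝒢} [LocallyBooleanSpace X]

theorem IsInternalTensor.existsUnique_sBimodAction {A B C : C0Alg.{u, v} X} {M : HilbBimod A B}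
    {N : HilbBimod B C} {P : HilbBimod A C} {t : M.carrier →ₗ[ℂ] N.carrier →ₗ[ℂ] P.carrier}
    (ht : IsInternalTensor M N P t) {βA : SAlgAction S A} {βB : SAlgAction S B}
    {βC : SAlgAction S C} (UM : SBimodAction βA βB M) (UN : SBimodAction βB βC N) :
    ∃! UP : SBimodAction βA βC P,
      SDiagonal (fun s => UM.map s) (fun s => UN.map s) t (fun s => UP.map s) := by
  refine _root_.existsUnique_sBimodAction UM.isCompatibleAction UN.isCompatibleAction ht.dense
    (fun x ξ hξ η => ht.mem_left UN.π_smul hξ η) (fun x ξ η hη => ht.mem_right ξ hη)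
    (fun s ξ ξ' η η' => ?_) (fun s u _ hu a ξ η => ?_) (fun f a ζ => ?_)
  · rw [ht.inner, ht.inner, UM.inner_map_map, ← UN.map_π', UN.inner_map_map]
  · rw [ht.π, hu, ht.π, UM.map_π']
  · refine LinearMap.eq_of_dense_span (T := P.π (A.smul f a)) (T' := P.act f ∘ₗ P.π a) ht.dense
      (P.continuous_π_right _) ((P.isC0Mod.continuous_act f).comp (P.continuous_π_right a)) ?_ ζ
    rintro _ ⟨ξ, η, rfl⟩
    rw [LinearMap.comp_apply, ht.π, ht.π, HilbBimod.π_smul_eq_act UM.π_smul,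
      ht.act_left UN.π_smul]

theorem IsExternalTensor.existsUnique_sBimodAction {A₁ B₁ A₂ B₂ A B : C0Alg.{u, v} X}
    {tA : A₁ →ₗ[ℂ] A₂ →ₗ[ℂ] A} {tB : B₁ →ₗ[ℂ] B₂ →ₗ[ℂ] B} {M : HilbBimod A₁ B₁}
    {N : HilbBimod A₂ B₂} {P : HilbBimod A B} {t : M.carrier →ₗ[ℂ] N.carrier →ₗ[ℂ] P.carrier}
    (hA : IsC0Tensor A₁ A₂ A tA) (hB : IsC0Tensor B₁ B₂ B tB)
    (ht : IsExternalTensor tA tB M N P t) {βA₁ : SAlgAction S A₁} {βB₁ : SAlgAction S B₁}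
    {βA₂ : SAlgAction S A₂} {βB₂ : SAlgAction S B₂} (UM : SBimodAction βA₁ βB₁ M)
    (UN : SBimodAction βA₂ βB₂ N) {βA : SAlgAction S A} {βB : SAlgAction S B}
    (hβA : SDiagonal (fun s => βA₁.map s) (fun s => βA₂.map s) tA (fun s => βA.map s))
    (hβB : SDiagonal (fun s => βB₁.map s) (fun s => βB₂.map s) tB (fun s => βB.map s)) :
    ∃! U : SBimodAction βA βB P,
      SDiagonal (fun s => UM.map s) (fun s => UN.map s) t (fun s => U.map s) := by
  refine _root_.existsUnique_sBimodAction UM.isCompatibleAction UN.isCompatibleAction ht.dense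
    (fun x ξ hξ η => ht.mem_left hB hξ η) (fun x ξ η hη => ht.mem_right hB ξ hη)
    (fun s ξ ξ' η η' => ?_) (fun s u huc hu a ξ η => ?_) (fun f a ζ => ?_)
  · rw [ht.inner, ht.inner, UM.inner_map_map, UN.inner_map_map]
    exact (hβB s _ _).symm
  · refine LinearMap.eq_of_dense_span (T := u ∘ₗ P.πₗ.flip (t ξ η))
      (T' := P.πₗ.flip (t (UM.map s ξ) (UN.map s η)) ∘ₗ (βA.map s : A →ₗ[ℂ] A)) hA.dense
      (huc.comp (P.continuous_π_left _))
      ((P.continuous_π_left _).comp (βA.map s).continuous_of_cstar) ?_ a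
    rintro _ ⟨a, b, rfl⟩
    change u (P.π (tA a b) (t ξ η)) = P.π (βA.map s (tA a b)) _
    have h : βA.map s (tA a b) = tA (βA₁.map s a) (βA₂.map s b) := hβA s a b
    rw [h, ht.π, ht.π, hu, UM.map_π', UN.map_π']
  · refine LinearMap.eq_of_dense_span (T := P.π (A.smul f a)) (T' := P.act f ∘ₗ P.π a) ht.dense
      (P.continuous_π_right _) ((P.isC0Mod.continuous_act f).comp (P.continuous_π_right a)) ?_ ζ
    rintro _ ⟨ξ, η, rfl⟩
    refine LinearMap.eq_of_dense_span (T := P.πₗ.flip (t ξ η) ∘ₗ A.smul f)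
      (T' := P.act f ∘ₗ P.πₗ.flip (t ξ η)) hA.dense
      ((P.continuous_π_left _).comp (A.continuous_smul f))
      ((P.isC0Mod.continuous_act f).comp (P.continuous_π_left _)) ?_ a
    rintro _ ⟨a, b, rfl⟩
    change P.π (A.smul f (tA a b)) (t ξ η) = P.act f (P.π (tA a b) (t ξ η))
    rw [← hA.smul_left, ht.π, ht.π, HilbBimod.π_smul_eq_act UM.π_smul, ht.act_left hB]

/-- `β_s` is `C₀(X)`-linear up to the homeomorphism of slices: at `r(g)`, for `g ∈ s`, the function
`f` has to be evaluated at `s(g)`. -/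
theorem SAlgAction.map_smul_sub_mem {A : C0Alg.{u, v} X} (β : SAlgAction S A) {s : S.Elt} {g : G}
    (hg : g ∈ s.1) (f : C₀(X, ℂ)) (a : A) :
    β.map s (A.smul f a) - f (𝒢.src g) • β.map s a ∈ A.null (𝒢.rng g) := by
  have h := β.isCompatibleAction.map_mem A.isC0Mod hg
    (A.isC0Mod.act_sub_smul_mem f (𝒢.src g) a)
  rw [map_sub, map_smul] at h
  exact h

theorem IsMaxC0Tensor.existsUnique_sAlgAction {A₁ A₂ A : C0Alg.{u, v} X}
    {t : A₁ →ₗ[ℂ] A₂ →ₗ[ℂ] A} (ht : IsMaxC0Tensor A₁ A₂ A t) (β₁ : SAlgAction S A₁)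
    (β₂ : SAlgAction S A₂) :
    ∃! β : SAlgAction S A,
      SDiagonal (fun s => β₁.map s) (fun s => β₂.map s) t (fun s => β.map s) := by
  -- the map `a ⊗ b ↦ β₁_s a ⊗ β₂_s b` is `C₀(X)`-balanced: in the fibre at `r(g)`, for `g ∈ s`, both
  -- sides are multiplied by `f(s(g))`, and outside the range of `s` both vanish
  have hbal : ∀ s f a b, t (β₁.map s (A₁.smul f a)) (β₂.map s b)
      = t (β₁.map s a) (β₂.map s (A₂.smul f b)) := by
    intro s f a b
    refine A.isC0Mod.eq_of_slice s (fun g hg => ?_)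
      (fun x hx => ht.mem_left (β₁.isCompatibleAction.mem_of_forall_ne hx _) _)
      (fun x hx => ht.mem_left (β₁.isCompatibleAction.mem_of_forall_ne hx a) _)
    have h1 := ht.mem_left (β₁.map_smul_sub_mem hg f a) (β₂.map s b)
    have h2 := ht.mem_right (β₁.map s a) (β₂.map_smul_sub_mem hg f b)
    rw [map_sub, LinearMap.sub_apply, map_smul, LinearMap.smul_apply] at h1
    rw [map_sub, map_smul] at h2
    have := sub_mem h1 h2
    rwa [sub_sub_sub_cancel_right] at this
  choose β hd using fun s => ht.universal A
    (t.compl₁₂ (β₁.map s : A₁ →ₗ[ℂ] A₁) (β₂.map s : A₂ →ₗ[ℂ] A₂))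
    (fun a a₁ b b₁ => by
      change t (β₁.map s a) (β₂.map s b) * t (β₁.map s a₁) (β₂.map s b₁)
        = t (β₁.map s (a * a₁)) (β₂.map s (b * b₁))
      rw [ht.mul, _root_.map_mul (β₁.map s) a a₁, _root_.map_mul (β₂.map s) b b₁])
    (fun a b => by
      change Star.star (t (β₁.map s a) (β₂.map s b))
        = t (β₁.map s (Star.star a)) (β₂.map s (Star.star b))
      rw [ht.star, StarHomClass.map_star (β₁.map s) a, StarHomClass.map_star (β₂.map s) b])
    (hbal s)
  have hβ : IsCompatibleAction S A.null fun s => (β s : A →ₗ[ℂ] A) :=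
    β₁.isCompatibleAction.tensor A.isC0Mod.isClosed β₂.isCompatibleAction ht.dense
      (fun x a ha b => ht.mem_left ha b) (fun x a b hb => ht.mem_right a hb)
      (fun s a => NonUnitalStarAlgHom.norm_apply_le (β s) a) hd
  refine ⟨hβ.toSAlgAction, hd, fun β' hβ' => SAlgAction.ext_map fun s => ?_⟩
  refine LinearMap.eq_of_dense_span (T := (β'.map s : A →ₗ[ℂ] A)) (T' := (β s : A →ₗ[ℂ] A))
    ht.dense (β'.map s).continuous_of_cstar (β s).continuous_of_cstar ?_
  rintro _ ⟨a, b, rfl⟩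
  exact (hβ' s a b).trans (hd s a b).symm

end Existence

theorem existsUnique_sigma {α β : Type*} {γ : α → β → Type*} {p : α → Prop} {q : β → Prop}
    {r : ∀ a b, γ a b → Prop} (ha : ∃! a, p a) (hb : ∃! b, q b)
    (hc : ∀ a b, p a → q b → ∃! c, r a b c) :
    ∃! z : Σ (a : α) (b : β), γ a b, p z.1 ∧ q z.2.1 ∧ r z.1 z.2.1 z.2.2 := by
  obtain ⟨a, ha, ha'⟩ := ha
  obtain ⟨b, hb, hb'⟩ := hb
  obtain ⟨c, hc, hc'⟩ := hc a b ha hb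
  refine ⟨⟨a, b, c⟩, ⟨ha, hb, hc⟩, ?_⟩
  rintro ⟨a', b', c'⟩ ⟨h1, h2, h3⟩
  obtain rfl := ha' a' h1
  obtain rfl := hb' b' h2
  obtain rfl := hc' c' h3
  rfl
theorem proposition5p2 {G : Type w} {X : Type u} [TopologicalSpace G] [TopologicalSpace X]
    [T2Space G] [LocallyCompactSpace G] (𝒢 : TopGroupoid G X) (h𝒢 : 𝒢.IsRDiscrete)
    (S : CantorInvSemigroup 𝒢) :
    ∃ ρ : GHilbBimod.{u, w, v} 𝒢 ≌ SHilbBimod.{u, w, v} S,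
      -- `ρ⁻¹ ρ` and `ρ ρ⁻¹` are the identity functors
      ρ.functor ⋙ ρ.inverse = 𝟭 _ ∧ ρ.inverse ⋙ ρ.functor = 𝟭 _ ∧
      -- `ρ` changes neither the underlying Hilbert bimodules nor the maps between them
      ρ.functor ⋙ forgetS S = forgetG 𝒢 ∧
      -- the actions determine each other by either of the two formulas
      (∀ (A B : C0Alg.{u, v} X) (αA : GAlgAction 𝒢 A) (αB : GAlgAction 𝒢 B) (βA : SAlgAction S A)
        (βB : SAlgAction S B) (M : HilbBimod A B) (V : GBimodAction αA αB M)
        (U : SBimodAction βA βB M),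
        (ρ.functor.obj ⟨A, B, αA, αB, M, V⟩ = ⟨A, B, βA, βB, M, U⟩ ↔
          InverseSemigroupFormula S αA.toFieldAction (fun s => βA.map s) ∧
          InverseSemigroupFormula S αB.toFieldAction (fun s => βB.map s) ∧
          InverseSemigroupFormula S V.toFieldAction (fun s => U.map s)) ∧
        (ρ.functor.obj ⟨A, B, αA, αB, M, V⟩ = ⟨A, B, βA, βB, M, U⟩ ↔
          GroupoidFormula S αA.toFieldAction (fun s => βA.map s) ∧
          GroupoidFormula S αB.toFieldAction (fun s => βB.map s) ∧
          GroupoidFormula S V.toFieldAction (fun s => U.map s))) ∧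
      -- internal tensor products
      (∀ (A B C : C0Alg.{u, v} X) (αA : GAlgAction 𝒢 A) (αB : GAlgAction 𝒢 B)
        (αC : GAlgAction 𝒢 C) (βA : SAlgAction S A) (βB : SAlgAction S B) (βC : SAlgAction S C)
        (M : HilbBimod A B) (VM : GBimodAction αA αB M) (UM : SBimodAction βA βB M)
        (N : HilbBimod B C) (VN : GBimodAction αB αC N) (UN : SBimodAction βB βC N)
        (P : HilbBimod A C) (t : M.carrier →ₗ[ℂ] N.carrier →ₗ[ℂ] P.carrier),
        ρ.functor.obj ⟨A, B, αA, αB, M, VM⟩ = ⟨A, B, βA, βB, M, UM⟩ →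
        ρ.functor.obj ⟨B, C, αB, αC, N, VN⟩ = ⟨B, C, βB, βC, N, UN⟩ →
        IsInternalTensor M N P t →
        (∃! VP : GBimodAction αA αC P,
          GDiagonal VM.toFieldAction VN.toFieldAction t VP.toFieldAction) ∧
        (∃! UP : SBimodAction βA βC P,
          SDiagonal (fun s => UM.map s) (fun s => UN.map s) t (fun s => UP.map s)) ∧
        ∀ (VP : GBimodAction αA αC P) (UP : SBimodAction βA βC P),
          ρ.functor.obj ⟨A, C, αA, αC, P, VP⟩ = ⟨A, C, βA, βC, P, UP⟩ →
          (GDiagonal VM.toFieldAction VN.toFieldAction t VP.toFieldAction ↔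
            SDiagonal (fun s => UM.map s) (fun s => UN.map s) t (fun s => UP.map s))) ∧
      -- external tensor products
      (∀ (A₁ B₁ A₂ B₂ : C0Alg.{u, v} X)
        (αA₁ : GAlgAction 𝒢 A₁) (αB₁ : GAlgAction 𝒢 B₁)
        (βA₁ : SAlgAction S A₁) (βB₁ : SAlgAction S B₁)
        (αA₂ : GAlgAction 𝒢 A₂) (αB₂ : GAlgAction 𝒢 B₂)
        (βA₂ : SAlgAction S A₂) (βB₂ : SAlgAction S B₂)
        (M : HilbBimod A₁ B₁) (VM : GBimodAction αA₁ αB₁ M) (UM : SBimodAction βA₁ βB₁ M)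
        (N : HilbBimod A₂ B₂) (VN : GBimodAction αA₂ αB₂ N) (UN : SBimodAction βA₂ βB₂ N)
        (A B : C0Alg.{u, v} X) (tA : A₁ →ₗ[ℂ] A₂ →ₗ[ℂ] A) (tB : B₁ →ₗ[ℂ] B₂ →ₗ[ℂ] B)
        (P : HilbBimod A B) (t : M.carrier →ₗ[ℂ] N.carrier →ₗ[ℂ] P.carrier),
        ρ.functor.obj ⟨A₁, B₁, αA₁, αB₁, M, VM⟩ = ⟨A₁, B₁, βA₁, βB₁, M, UM⟩ →
        ρ.functor.obj ⟨A₂, B₂, αA₂, αB₂, N, VN⟩ = ⟨A₂, B₂, βA₂, βB₂, N, UN⟩ →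
        IsC0Tensor A₁ A₂ A tA → IsC0Tensor B₁ B₂ B tB → IsExternalTensor tA tB M N P t →
        (IsMaxC0Tensor A₁ A₂ A tA → IsMaxC0Tensor B₁ B₂ B tB →
          (∃! Z : Σ (αA : GAlgAction 𝒢 A) (αB : GAlgAction 𝒢 B), GBimodAction αA αB P,
            GDiagonal αA₁.toFieldAction αA₂.toFieldAction tA Z.1.toFieldAction ∧
            GDiagonal αB₁.toFieldAction αB₂.toFieldAction tB Z.2.1.toFieldAction ∧
            GDiagonal VM.toFieldAction VN.toFieldAction t Z.2.2.toFieldAction) ∧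
          (∃! W : Σ (βA : SAlgAction S A) (βB : SAlgAction S B), SBimodAction βA βB P,
            SDiagonal (fun s => βA₁.map s) (fun s => βA₂.map s) tA (fun s => W.1.map s) ∧
            SDiagonal (fun s => βB₁.map s) (fun s => βB₂.map s) tB (fun s => W.2.1.map s) ∧
            SDiagonal (fun s => UM.map s) (fun s => UN.map s) t (fun s => W.2.2.map s))) ∧
        ∀ (αA : GAlgAction 𝒢 A) (αB : GAlgAction 𝒢 B) (V : GBimodAction αA αB P)
          (βA : SAlgAction S A) (βB : SAlgAction S B) (U : SBimodAction βA βB P),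
          ρ.functor.obj ⟨A, B, αA, αB, P, V⟩ = ⟨A, B, βA, βB, P, U⟩ →
          ((GDiagonal αA₁.toFieldAction αA₂.toFieldAction tA αA.toFieldAction ∧
            GDiagonal αB₁.toFieldAction αB₂.toFieldAction tB αB.toFieldAction ∧
            GDiagonal VM.toFieldAction VN.toFieldAction t V.toFieldAction) ↔
           (SDiagonal (fun s => βA₁.map s) (fun s => βA₂.map s) tA (fun s => βA.map s) ∧
            SDiagonal (fun s => βB₁.map s) (fun s => βB₂.map s) tB (fun s => βB.map s) ∧
            SDiagonal (fun s => UM.map s) (fun s => UN.map s) t (fun s => U.map s)))) := by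
  have := S.locallyBooleanSpace
  refine ⟨bimodEquivalence S, toSFunctor_comp_toGFunctor S, toGFunctor_comp_toSFunctor S, rfl,
    ?_, ?_, ?_⟩
  · intro A B αA αB βA βB M V U
    have h := toSHilbBimod_eq_iff (V := V) (U := U)
    refine ⟨h, ?_⟩
    rw [← βA.inverseSemigroupFormula_iff, ← βB.inverseSemigroupFormula_iff,
      ← U.inverseSemigroupFormula_iff]
    exact h
  · intro A B C αA αB αC βA βB βC M VM UM N VN UN P t hM hN ht
    obtain ⟨hA, -, hUM⟩ := toSHilbBimod_eq_iff.1 hM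
    obtain ⟨-, hC, hUN⟩ := toSHilbBimod_eq_iff.1 hN
    have h₁ : ∀ x, ∀ ξ ∈ M.null x, ∀ η, t ξ η ∈ P.null x :=
      fun x ξ hξ η => ht.mem_left VN.π_smul hξ η
    have h₂ : ∀ x ξ, ∀ η ∈ N.null x, t ξ η ∈ P.null x := fun x ξ η hη => ht.mem_right ξ hη
    have hS := ht.existsUnique_sBimodAction UM UN
    exact ⟨existsUnique_gBimodAction hA hC hUM hUN h₁ h₂ hS, hS, fun VP UP hP =>
      gDiagonal_iff_sDiagonal P.isC0Mod hUM hUN (toSHilbBimod_eq_iff.1 hP).2.2 h₁ h₂⟩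
  · intro A₁ B₁ A₂ B₂ αA₁ αB₁ βA₁ βB₁ αA₂ αB₂ βA₂ βB₂ M VM UM N VN UN A B tA tB P t hM hN hA hB ht
    obtain ⟨hA₁, hB₁, hUM⟩ := toSHilbBimod_eq_iff.1 hM
    obtain ⟨hA₂, hB₂, hUN⟩ := toSHilbBimod_eq_iff.1 hN
    have hA₁' : ∀ x, ∀ a ∈ A₁.null x, ∀ b, tA a b ∈ A.null x := fun x a ha b => hA.mem_left ha b
    have hA₂' : ∀ x a, ∀ b ∈ A₂.null x, tA a b ∈ A.null x := fun x a b hb => hA.mem_right a hb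
    have hB₁' : ∀ x, ∀ a ∈ B₁.null x, ∀ b, tB a b ∈ B.null x := fun x a ha b => hB.mem_left ha b
    have hB₂' : ∀ x a, ∀ b ∈ B₂.null x, tB a b ∈ B.null x := fun x a b hb => hB.mem_right a hb
    have h₁ : ∀ x, ∀ ξ ∈ M.null x, ∀ η, t ξ η ∈ P.null x :=
      fun x ξ hξ η => ht.mem_left hB hξ η
    have h₂ : ∀ x ξ, ∀ η ∈ N.null x, t ξ η ∈ P.null x := fun x ξ η hη => ht.mem_right hB ξ hη
    refine ⟨fun hAmax hBmax => ⟨?_, ?_⟩, fun αA αB V βA βB U hP => ?_⟩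
    · refine existsUnique_sigma
        (r := fun αA αB (V : GBimodAction αA αB P) =>
          GDiagonal VM.toFieldAction VN.toFieldAction t V.toFieldAction)
        (existsUnique_gAlgAction hA₁ hA₂ hA₁' hA₂' (hAmax.existsUnique_sAlgAction βA₁ βA₂))
        (existsUnique_gAlgAction hB₁ hB₂ hB₁' hB₂' (hBmax.existsUnique_sAlgAction βB₁ βB₂))
        fun αA αB hαA hαB => ?_
      have hfA := αA.inverseSemigroupFormula_toSAlgAction (S := S)
      have hfB := αB.inverseSemigroupFormula_toSAlgAction (S := S)
      exact existsUnique_gBimodAction hfA hfB hUM hUN h₁ h₂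
        (ht.existsUnique_sBimodAction hA hB UM UN
          ((gDiagonal_iff_sDiagonal A.isC0Mod hA₁ hA₂ hfA hA₁' hA₂').1 hαA)
          ((gDiagonal_iff_sDiagonal B.isC0Mod hB₁ hB₂ hfB hB₁' hB₂').1 hαB))
    · exact existsUnique_sigma (hAmax.existsUnique_sAlgAction βA₁ βA₂)
        (hBmax.existsUnique_sAlgAction βB₁ βB₂)
        fun βA βB hβA hβB => ht.existsUnique_sBimodAction hA hB UM UN hβA hβB
    · obtain ⟨hfA, hfB, hfU⟩ := toSHilbBimod_eq_iff.1 hP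
      exact and_congr (gDiagonal_iff_sDiagonal A.isC0Mod hA₁ hA₂ hfA hA₁' hA₂')
        (and_congr (gDiagonal_iff_sDiagonal B.isC0Mod hB₁ hB₂ hfB hB₁' hB₂')
          (gDiagonal_iff_sDiagonal P.isC0Mod hUM hUN hfU h₁ h₂))
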